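/- **Setting.** Let $c>1$. A MultiQueue for $p$ threads consists of $m=cp$ sequential priority queues $Q[1],\dots,Q[m]$ (the local queues), initially empty, each with a lock flag and a word storing its minimum ($\infty$ if it is empty). An *insert*$(e)$ repeatedly draws $i\in\{1,\dots,m\}$ uniformly at random and tries to lock $Q[i]$ until this succeeds; it then inserts $e$ into $Q[i]$ and unlocks $Q[i]$. A *deleteMin* repeatedly draws $i,j\in\{1,\dots,m\}$ independently and uniformly at random, reads the minima of $Q[i]$ and $Q[j]$, and tries to lock the queue with the smaller one, until this succeeds; it then removes and returns the minimum of the locked queue ($\infty$ if that queue is empty) and unlocks it. All draws are independent. Each thread has a given finite sequence of operations to perform one after the other. The threads run asynchronously: an arbitrary sequence of threads (the schedule), fixed in advance independently of the random draws, says which thread makes the next elementary step. The time of an operation is the total time of the steps its thread makes for it (in case the schedule ends before the operation does: made so far), where a step takes one time unit, except that a step writing a shared machine word for which $k$ threads currently contend (i.e. whose next step is to write that word) takes $k$ time units. An access to a locked local queue takes as many steps as the sequential algorithm needs, up to a constant factor. **Claim.** For every $c>1$ there is a constant $C$, depending only on $c$, such that for all $p\ge 1$ with $m=cp$ an integer and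 for all schedules the following hold. 1. (Binary heaps, average insertion time.) Let the local queues be binary heaps over a linearly ordered set, let the threads perform $N$ insertions in total, divided among the threads in an arbitrary way, and let $N$ given elements be assigned to these insertions in uniformly random order, independently of the random draws. Then the expected total time of the $N$ insertions is at most $C\,N$, i.e. the average insertion time is at most $C$. 2. (Binary heaps, worst-case operation sequences.) Let the local queues be binary heaps over a linearly ordered set. For arbitrary sequences of insert and deleteMin operations of the threads, every single operation has expected time at most $C\cdot\mathbb{E}[\log_2(n+2)]$, where $n$ is the number of elements in the whole MultiQueue at the moment when the operation acquires its lock ($n=0$ if the schedule ends before that). 3. (Van Emde Boas trees.) Let the keys be integers in $\{0,\dots,U\}$ and let the local queues be van Emde Boas trees for this universe. For arbitrary sequences of insert and deleteMin operations of the threads, every single operation has expected time at most $C\cdot\log_2\log_2(U+4)$. -/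

import Mathlib

open scoped ENNReal NNReal

namespace MultiQueue

/-! ### Sequential priority queues -/

/-- The interface of a sequential priority queue with elements of `α`.  `insert` and `deleteMin`
return, in their last component, the number of time units the call takes.  An empty queue has
`⊤` (infinity) as its minimum, and `deleteMin` returns `⊤` on it. -/
structure SeqPQ (α : Type*) where
  State : Type*
  empty : State
  insert : α → State → State × ℕ
  deleteMin : State → WithTop α × State × ℕ
  min : State → WithTop α
  /-- the number of elements stored -/
  size : State → ℕ

/-! ### Binary heaps -/

/-- An array-based binary heap: the elements are in the cells `1, …, size`, the children of
cell `i` are the cells `2 * i` and `2 * i + 1`, unused cells contain `⊤`. -/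
structure BinHeap (α : Type*) where
  size : ℕ
  cell : ℕ → WithTop α

namespace BinHeap

variable {α : Type*} [LinearOrder α]

def empty : BinHeap α := ⟨0, fun _ => ⊤⟩

def set (h : BinHeap α) (i : ℕ) (x : WithTop α) : BinHeap α :=
  { h with cell := Function.update h.cell i x }

def swap (h : BinHeap α) (i j : ℕ) : BinHeap α :=
  (h.set i (h.cell j)).set j (h.cell i)

/-- Move the element of cell `i` up until its parent is not larger.  One time unit is charged
per iteration (a bounded number of array accesses, index computations and comparisons). -/
def siftUp (h : BinHeap α) (i : ℕ) : BinHeap α × ℕ :=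
  if 1 < i ∧ h.cell i < h.cell (i / 2) then
    let r := siftUp (h.swap i (i / 2)) (i / 2)
    (r.1, r.2 + 1)
  else (h, 1)
termination_by i
decreasing_by omega

/-- The child of cell `i` with the smaller element (the left child if there is only one). -/
def minChild (h : BinHeap α) (i : ℕ) : ℕ :=
  if 2 * i + 1 ≤ h.size ∧ h.cell (2 * i + 1) < h.cell (2 * i) then 2 * i + 1 else 2 * i

/-- Move the element of cell `i` down until no child is smaller; one time unit per iteration. -/
def siftDown (h : BinHeap α) (i : ℕ) : BinHeap α × ℕ :=
  if 1 ≤ i ∧ 2 * i ≤ h.size ∧ h.cell (h.minChild i) < h.cell i then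
    let r := siftDown (h.swap i (h.minChild i)) (h.minChild i)
    (r.1, r.2 + 1)
  else (h, 1)
termination_by h.size - i
decreasing_by
  have h1 : (h.swap i (h.minChild i)).size = h.size := rfl
  have h2 : i < h.minChild i := by unfold minChild; split_ifs <;> omega
  omega

def insert (a : α) (h : BinHeap α) : BinHeap α × ℕ :=
  let h' : BinHeap α := { h.set (h.size + 1) a with size := h.size + 1 }
  let r := h'.siftUp (h.size + 1)
  (r.1, r.2 + 1)

/-- Remove the root, move the last element to the root and sift it down. -/
def deleteMin (h : BinHeap α) : WithTop α × BinHeap α × ℕ :=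
  if h.size = 0 then (⊤, h, 1)
  else
    let h' : BinHeap α :=
      { (h.set 1 (h.cell h.size)).set h.size ⊤ with size := h.size - 1 }
    let r := h'.siftDown 1
    (h.cell 1, r.1, r.2 + 1)

end BinHeap

/-- Binary heaps as sequential priority queues. -/
def binaryHeap (α : Type*) [LinearOrder α] : SeqPQ α where
  State := BinHeap α
  empty := BinHeap.empty
  insert := BinHeap.insert
  deleteMin := BinHeap.deleteMin
  min h := h.cell 1
  size := BinHeap.size

/-! ### van Emde Boas trees -/

/-- A van Emde Boas tree of level `k` for keys in `{0, …, 2 ^ 2 ^ k - 1}`.  A node of level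
`k + 1` stores its minimum and its maximum, has a cluster of level `k` for each possible upper
half `x / 2 ^ 2 ^ k` of a key `x`, and a summary of level `k` that contains the indices of the
nonempty clusters.  The minimum of a node is not stored in its clusters. -/
inductive VEB : ℕ → Type
  | leaf (min max : Option ℕ) : VEB 0
  | node {k : ℕ} (min max : Option ℕ) (summary : VEB k) (cluster : ℕ → VEB k) : VEB (k + 1)

namespace VEB

def empty : (k : ℕ) → VEB k
  | 0 => .leaf none none
  | k + 1 => .node none none (empty k) (fun _ => empty k)

def min : {k : ℕ} → VEB k → Option ℕ
  | _, .leaf mn _ => mn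
  | _, .node mn _ _ _ => mn

/-- Insert a key.  One time unit is charged per call, recursive calls included.  (If the cluster
of the key is empty, inserting into that cluster takes constant time, and the only other
recursive call is the one on the summary.) -/
def insert : {k : ℕ} → ℕ → VEB k → VEB k × ℕ
  | _, x, .leaf none _ => (.leaf (some x) (some x), 1)
  | _, x, .leaf (some a) mx =>
      (.leaf (some (Nat.min a x)) (mx.map fun b => Nat.max b x), 1)
  | _, x, .node none _ s cl => (.node (some x) (some x) s cl, 1)
  | _, x, .node (k := k) (some a) mx s cl =>
      if x = a then (.node (some a) mx s cl, 1)
      else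
        -- the smaller of `x` and `a` becomes the minimum, the larger one, `y`, goes to a cluster
        let y := Nat.max a x
        let hi := y / 2 ^ 2 ^ k
        let lo := y % 2 ^ 2 ^ k
        let mn := some (Nat.min a x)
        let mx' := mx.map fun b => Nat.max b y
        let r := insert lo (cl hi)
        if (cl hi).min = none then
          let r' := insert hi s
          (.node mn mx' r'.1 (Function.update cl hi r.1), r.2 + r'.2 + 1)
        else
          (.node mn mx' s (Function.update cl hi r.1), r.2 + 1)

/-- Delete the minimum (nothing happens to an empty tree).  One time unit is charged per call,
recursive calls included. -/
def deleteMin : {k : ℕ} → VEB k → VEB k × ℕ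
  | _, .leaf mn mx => if mn = mx then (.leaf none none, 1) else (.leaf mx mx, 1)
  | _, .node (k := k) mn mx s cl =>
      if mn = mx then (.node none none s cl, 1)
      else
        match s.min with
        | none => (.node none none s cl, 1)
        | some hi =>
            -- the new minimum is the minimum of the first nonempty cluster
            let mn' := some (hi * 2 ^ 2 ^ k + ((cl hi).min).getD 0)
            let r := deleteMin (cl hi)
            if r.1.min = none then
              let r' := deleteMin s
              (.node mn' mx r'.1 (Function.update cl hi r.1), r.2 + r'.2 + 1)
            else
              (.node mn' mx s (Function.update cl hi r.1), r.2 + 1)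

/-- The smallest level `k` with `U < 2 ^ 2 ^ k`. -/
def level (U : ℕ) : ℕ := Nat.clog 2 (Nat.clog 2 (U + 1))

end VEB

/-- A priority queue for keys in `{0, …, 2 ^ 2 ^ k - 1}`: a van Emde Boas tree of the distinct
keys that are present and an array with their multiplicities. -/
structure VEBQueue (k : ℕ) where
  tree : VEB k
  count : ℕ → ℕ
  size : ℕ

namespace VEBQueue

variable {k : ℕ}

def empty (k : ℕ) : VEBQueue k := ⟨VEB.empty k, fun _ => 0, 0⟩

def insert (x : ℕ) (q : VEBQueue k) : VEBQueue k × ℕ :=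
  let count' := Function.update q.count x (q.count x + 1)
  if q.count x = 0 then
    let r := q.tree.insert x
    (⟨r.1, count', q.size + 1⟩, r.2 + 1)
  else (⟨q.tree, count', q.size + 1⟩, 1)

def deleteMin (q : VEBQueue k) : WithTop ℕ × VEBQueue k × ℕ :=
  match q.tree.min with
  | none => (⊤, q, 1)
  | some x =>
      let count' := Function.update q.count x (q.count x - 1)
      if q.count x = 1 then
        let r := q.tree.deleteMin
        (x, ⟨r.1, count', q.size - 1⟩, r.2 + 1)
      else (x, ⟨q.tree, count', q.size - 1⟩, 1)

/-- The minimum, `⊤` if the queue is empty. -/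
def min (q : VEBQueue k) : WithTop ℕ :=
  match q.tree.min with
  | none => ⊤
  | some x => x

end VEBQueue

/-- van Emde Boas trees for integer keys in `{0, …, U}` as sequential priority queues. -/
def vanEmdeBoas (U : ℕ) : SeqPQ ℕ where
  State := VEBQueue (VEB.level U)
  empty := VEBQueue.empty _
  insert := VEBQueue.insert
  deleteMin := VEBQueue.deleteMin
  min := VEBQueue.min
  size := VEBQueue.size

/-! ### The MultiQueue on an asynchronous shared-memory machine -/

/-- The operations of a MultiQueue. -/
inductive Op (α : Type*)
  | insert (a : α)
  | deleteMin

/-- Where a thread is in the execution of its current operation, with `m` local queues whose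
states are in `S`.
* `start`: about to draw the random queue index (`insert`) or the two indices (`deleteMin`);
* `readFirst i j`, `readSecond i j x`: (`deleteMin` only) about to read `Q[i].min`, respectively
  about to read `Q[j].min` after having read `x` as `Q[i].min`;
* `tryLock i`: about to try to lock `Q[i]`;
* `access i r q e`: holding the lock of `Q[i]`, with `r` time units of the sequential operation
  still to do; this operation leaves the queue in state `q` and returns `e`;
* `unlock i e`: about to release the lock of `Q[i]` and to return `e`. -/
inductive Phase (S α : Type*) (m : ℕ)
  | start
  | readFirst (i j : Fin m)
  | readSecond (i j : Fin m) (x : WithTop α)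
  | tryLock (i : Fin m)
  | access (i : Fin m) (r : ℕ) (q : S) (e : WithTop α)
  | unlock (i : Fin m) (e : WithTop α)

/-- The shared machine words that several threads may want to write: the lock flag of a local
queue and the word that stores the minimum of a local queue. -/
inductive Word (m : ℕ)
  | lock (i : Fin m)
  | minKey (i : Fin m)
  deriving DecidableEq

/-- The word that a thread in the given phase writes in its next step, if there is one. -/
def Phase.writes {S α : Type*} {m : ℕ} : Phase S α m → Option (Word m)
  | .tryLock i => some (.lock i)
  | .access i 0 _ _ => some (.minKey i)
  | .unlock i _ => some (.lock i)
  | _ => none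

/-- A configuration of `p` threads working on a MultiQueue with `m` local queues.  The last two
fields are bookkeeping that does not influence the execution. -/
structure Config {α : Type*} (Q : SeqPQ α) (p m : ℕ) where
  /-- the local queues -/
  queue : Fin m → Q.State
  /-- the words that store the minima of the local queues -/
  minKey : Fin m → WithTop α
  /-- the lock flags -/
  locked : Fin m → Bool
  phase : Fin p → Phase Q.State α m
  /-- the number of operations that a thread has completed -/
  pos : Fin p → ℕ
  /-- the values returned to a thread, the latest first -/
  out : Fin p → List (WithTop α)
  /-- `time t k`: the time that thread `t` has spent on its operation number `k` so far -/
  time : Fin p → ℕ → ℕ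
  /-- `sizeAtLock t k`: the number of elements in the whole MultiQueue when thread `t` has acquired
  a lock for its operation number `k` (`0` before that) -/
  sizeAtLock : Fin p → ℕ → ℕ

section Execution

variable {α : Type*} [LinearOrder α] {Q : SeqPQ α} {p m : ℕ}

/-- Initially all local queues are empty and unlocked. -/
def Config.init (Q : SeqPQ α) (p m : ℕ) : Config Q p m where
  queue _ := Q.empty
  minKey _ := Q.min Q.empty
  locked _ := false
  phase _ := .start
  pos _ := 0
  out _ := []
  time _ _ := 0
  sizeAtLock _ _ := 0

/-- The number of elements in the MultiQueue. -/
def Config.size (s : Config Q p m) : ℕ := ∑ i, Q.size (s.queue i)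

/-- The number of threads that contend to write the word `w`. -/
def Config.contention (s : Config Q p m) (w : Word m) : ℕ :=
  (Finset.univ.filter fun u : Fin p => (s.phase u).writes = some w).card

/-- The time of the next step of thread `t`: if it writes a shared word for which `k` threads
(`t` included) contend then it is `k`, otherwise it is `1`. -/
def Config.stepCost (s : Config Q p m) (t : Fin p) : ℕ :=
  match (s.phase t).writes with
  | some w => s.contention w
  | none => 1

def Config.setPhase (s : Config Q p m) (t : Fin p) (ph : Phase Q.State α m) : Config Q p m :=
  { s with phase := Function.update s.phase t ph }

/-- Charge the next step of thread `t` to its current operation. -/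
def Config.charge (s : Config Q p m) (t : Fin p) : Config Q p m :=
  { s with
    time := Function.update s.time t
      (Function.update (s.time t) (s.pos t) (s.time t (s.pos t) + s.stepCost t)) }

/-- The sequential operation on a local queue: returned value, new state, time. -/
def runOp (Q : SeqPQ α) : Op α → Q.State → WithTop α × Q.State × ℕ
  | .insert a, q => (⊤, Q.insert a q)
  | .deleteMin, q => Q.deleteMin q

/-- The effect of the next step of thread `t`, which executes `op`.  The pair `d` consists of
the random queue indices that are drawn if the step draws any. -/
def Config.exec (s : Config Q p m) (t : Fin p) (op : Op α) (d : Fin m × Fin m) : Config Q p m :=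
  match s.phase t with
  | .start =>
      match op with
      | .insert _ => s.setPhase t (.tryLock d.1)
      | .deleteMin => s.setPhase t (.readFirst d.1 d.2)
  | .readFirst i j => s.setPhase t (.readSecond i j (s.minKey i))
  | .readSecond i j x => s.setPhase t (.tryLock (if s.minKey j < x then j else i))
  | .tryLock i =>
      if s.locked i then s.setPhase t .start
      else
        let r := runOp Q op (s.queue i)
        { s.setPhase t (.access i r.2.2 r.2.1 r.1) with
          locked := Function.update s.locked i true
          sizeAtLock := Function.update s.sizeAtLock t
            (Function.update (s.sizeAtLock t) (s.pos t) s.size) }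
  | .access i (r + 1) q e => s.setPhase t (.access i r q e)
  | .access i 0 q e =>
      { s.setPhase t (.unlock i e) with
        queue := Function.update s.queue i q
        minKey := Function.update s.minKey i (Q.min q) }
  | .unlock i e =>
      { s.setPhase t .start with
        locked := Function.update s.locked i false
        pos := Function.update s.pos t (s.pos t + 1)
        out := Function.update s.out t (e :: s.out t) }

/-- The step of thread `t`, where thread `u` has to perform the operations `prog u` one after
the other; a thread that has completed its operations does nothing. -/
def Config.next (prog : Fin p → List (Op α)) (t : Fin p) (d : Fin m × Fin m)
    (s : Config Q p m) : Config Q p m :=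
  match (prog t)[s.pos t]? with
  | none => s
  | some op => (s.charge t).exec t op d

/-- The distribution of the configuration after the threads have made steps in the order given
by `sched`, the random draws of all steps being uniform and independent. -/
noncomputable def run [NeZero m] (Q : SeqPQ α) (prog : Fin p → List (Op α))
    (sched : List (Fin p)) : PMF (Config Q p m) :=
  sched.foldl
    (fun μ t => μ.bind fun s =>
      (PMF.uniformOfFintype (Fin m × Fin m)).map fun d => s.next prog t d)
    (PMF.pure (Config.init Q p m))

end Execution

/-- The expectation of `f` under `μ`. -/
noncomputable def expect {β : Type*} (μ : PMF β) (f : β → ℝ≥0∞) : ℝ≥0∞ := ∑' b, μ b * f b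

/-- The distribution of the configuration when thread `t` performs `len t` insertions (for all
`t`), the elements `key` being assigned to the insertions in uniformly random order. -/
noncomputable def runRandomInsertions {α : Type*} [LinearOrder α] {p m : ℕ} [NeZero m]
    (Q : SeqPQ α) (len : Fin p → ℕ) (key : (Σ t, Fin (len t)) → α) (sched : List (Fin p)) :
    PMF (Config Q p m) :=
  (PMF.uniformOfFintype (Equiv.Perm (Σ t, Fin (len t)))).bind fun π =>
    run Q (fun t => List.ofFn fun k => Op.insert (key (π ⟨t, k⟩))) sched

end MultiQueue

/-! The time of an operation has three sources: the contention paid per step, the number of attempts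
to lock, and the sequential work done while holding the lock.

The first two are handled by deferred decisions. A draw is invisible to the other threads until the
drawing thread tries to lock, so it may as well be made at the moment of the attempt. `evol_init`
makes this precise: the execution, with the time forgotten, is the `Lazy` one whose open draws are
filled with independent uniform values. In a lazy state the target of a thread that is about to lock
is therefore still random and hits any given queue with probability at most `2 / m`. Hence a step
costs on average at most `1 + p * (2 / m) ≤ 3` (`Inv.expect_stepCost_le`). At most `p` of the `m`
queues are locked, so an attempt succeeds with probability at least `(1 - p / m) ^ 2`
(`Inv.le_expect_unlocked`). A potential argument (`Inv.expect_potential_le`) bounds the expected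
number of steps by a constant plus the expected sequential work `dur`. For worst-case operation
sequences the deterministic bounds for heaps and van Emde Boas trees finish the proof.

For random insertions, constant average sequential work remains to be shown. There are three
ingredients.

In a heap built in random order an insertion costs `O(1)` on average (`expect_lastCost_le`). The new
element `x` passes the ancestor `j + 1` levels up only if, for some `r`, at most one element of a
certain block of `2 ^ (j + r)` earlier insertions is at most `x`. By exchangeability this has
probability at most `2 / (2 ^ (j + r) + 1)`, which is summable over `j` and `r`.

The elements influence how long locks are held, and thereby which operations reach which queue, so
it is not obvious that a queue sees a random order. For fixed draws, however, deal the elements that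
reach queue `i` from the front of a deck and all others from its back. The execution can be replayed
from the deck, so the deck is a bijective function of the permutation (`exists_deck`). Thus the
elements of queue `i` form an initial part of a uniformly random sequence.

The length of that part may depend on the elements. The cost is therefore cut at a multiple of `N /
m` insertions: each one below the cut costs `O(1)` on average, and longer queues are paid for by a
crude quadratic bound together with an exponential moment of the length (`evol_pow_length_le`). Each
queue contributes `O(N / m)`, all of them together `O(N)`. -/

set_option linter.unusedSectionVars false

namespace MultiQueue

open scoped BigOperators

/-! ### Averages over finitely many draws -/

section Averages

variable {S ι D : Type*} [Fintype D]

/-- The average of `f` over the states reached from `s` when the steps `l` are made with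
independent uniform draws from `D`. -/
noncomputable def evol (step : ι → D → S → S) : List ι → S → (S → ℝ) → ℝ
  | [], s, f => f s
  | u :: l, s, f => 𝔼 d, evol step l (step u d s) f

variable (step : ι → D → S → S)

theorem evol_append (l l' : List ι) (s : S) (f : S → ℝ) :
    evol step (l ++ l') s f = evol step l s (fun s' => evol step l' s' f) := by
  induction l generalizing s with
  | nil => rfl
  | cons u l ih => simp only [List.cons_append, evol, ih]

theorem evol_concat (l : List ι) (u : ι) (s : S) (f : S → ℝ) :
    evol step (l ++ [u]) s f = evol step l s (fun s' => 𝔼 d, f (step u d s')) :=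
  evol_append step l [u] s f

theorem evol_add (l : List ι) (s : S) (f g : S → ℝ) :
    evol step l s (fun x => f x + g x) = evol step l s f + evol step l s g := by
  induction l generalizing s with
  | nil => rfl
  | cons u l ih => simp only [evol, ih, Finset.expect_add_distrib]

theorem evol_const_mul (l : List ι) (s : S) (c : ℝ) (f : S → ℝ) :
    evol step l s (fun x => c * f x) = c * evol step l s f := by
  induction l generalizing s with
  | nil => rfl
  | cons u l ih => simp only [evol, ih, Finset.mul_expect]

theorem evol_const [Nonempty D] (l : List ι) (s : S) (c : ℝ) :
    evol step l s (fun _ => c) = c := by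
  induction l generalizing s with
  | nil => rfl
  | cons u l ih => simp only [evol, ih, Fintype.expect_const]

theorem evol_sum {κ : Type*} (t : Finset κ) (l : List ι) (s : S) (f : κ → S → ℝ) :
    evol step l s (fun x => ∑ k ∈ t, f k x) = ∑ k ∈ t, evol step l s (f k) := by
  induction l generalizing s with
  | nil => rfl
  | cons u l ih => simp only [evol, ih, Finset.expect_sum_comm]

theorem evol_le_of_invariant {I : S → Prop} (hI : ∀ u d s, I s → I (step u d s))
    {f g : S → ℝ} (hfg : ∀ s, I s → f s ≤ g s) (l : List ι) {s : S} (hs : I s) :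
    evol step l s f ≤ evol step l s g := by
  induction l generalizing s with
  | nil => exact hfg s hs
  | cons u l ih => exact Finset.expect_le_expect fun d _ => ih (hI u d s hs)

theorem evol_nonneg {f : S → ℝ} (hf : ∀ s, 0 ≤ f s) (l : List ι) (s : S) :
    0 ≤ evol step l s f := by
  induction l generalizing s with
  | nil => exact hf s
  | cons u l ih => exact Finset.expect_nonneg fun d _ => ih _

/-- A function that does not increase on average along the steps. -/
theorem evol_le_of_supermartingale {I : S → Prop} (hI : ∀ u d s, I s → I (step u d s))
    {f : S → ℝ} (hf : ∀ u s, I s → 𝔼 d, f (step u d s) ≤ f s) (l : List ι) {s : S}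
    (hs : I s) : evol step l s f ≤ f s := by
  induction l generalizing s with
  | nil => exact le_rfl
  | cons u l ih =>
    exact (Finset.expect_le_expect fun d _ => ih (hI u d s hs)).trans (hf u s hs)

/-- All draws can be made in advance: the average is one over a finite set of tapes. -/
theorem exists_tape {S ι : Type*} {D : Type} [Fintype D] [Nonempty D] (l : List ι) :
    ∃ (Ω : Type) (_ : Fintype Ω) (_ : Nonempty Ω) (tape : Ω → List (ι × D)),
      ∀ (step : ι → D → S → S) (s : S) (f : S → ℝ),
        evol step l s f = 𝔼 ω, f ((tape ω).foldl (fun x a => step a.1 a.2 x) s) := by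
  induction l with
  | nil => exact ⟨PUnit, inferInstance, inferInstance, fun _ => [], fun step s f => by simp [evol]⟩
  | cons u l ih =>
    obtain ⟨Ω, _, _, tape, h⟩ := ih
    refine ⟨D × Ω, inferInstance, inferInstance, fun x => (u, x.1) :: tape x.2, fun step s f => ?_⟩
    simp only [evol, h, List.foldl_cons]
    rw [← Finset.univ_product_univ, Finset.expect_product]

end Averages

/-- Redrawing one coordinate does not change the average over all coordinates. -/
theorem expect_expect_update {κ D : Type*} [Fintype κ] [DecidableEq κ] [Fintype D] [Nonempty D]
    (v : κ) (f : (κ → D) → ℝ) :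
    𝔼 δ : κ → D, 𝔼 d, f (Function.update δ v d) = 𝔼 δ : κ → D, f δ := by
  -- Exchanging the new value with the one it replaces is an involution of all pairs, so the updated
  -- function is again uniform.
  let e : (κ → D) × D ≃ (κ → D) × D :=
    { toFun := fun x => (Function.update x.1 v x.2, x.1 v)
      invFun := fun x => (Function.update x.1 v x.2, x.1 v)
      left_inv := fun x => by simp
      right_inv := fun x => by simp }
  calc 𝔼 δ : κ → D, 𝔼 d, f (Function.update δ v d)
      = 𝔼 x : (κ → D) × D, f (e x).1 := by
        rw [← Finset.univ_product_univ, Finset.expect_product]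
        rfl
    _ = 𝔼 x : (κ → D) × D, f x.1 := Fintype.expect_equiv e _ _ fun _ => rfl
    _ = _ := by
        rw [← Finset.univ_product_univ, Finset.expect_product]
        simp

/-! ### Expectations with respect to probability mass functions -/

theorem expect_pure {β : Type*} (b : β) (f : β → ℝ≥0∞) : expect (PMF.pure b) f = f b := by
  unfold expect
  rw [tsum_eq_single b]
  · simp
  · intro b' hb'
    simp [hb']

theorem expect_bind {β γ : Type*} (μ : PMF β) (ν : β → PMF γ) (f : γ → ℝ≥0∞) :
    expect (μ.bind ν) f = expect μ fun b => expect (ν b) f := by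
  unfold expect
  simp only [PMF.bind_apply, ← ENNReal.tsum_mul_right, ← ENNReal.tsum_mul_left]
  rw [ENNReal.tsum_comm]
  simp only [mul_assoc]

theorem expect_map {β γ : Type*} (μ : PMF β) (g : β → γ) (f : γ → ℝ≥0∞) :
    expect (μ.map g) f = expect μ fun b => f (g b) := by
  rw [← PMF.bind_pure_comp, expect_bind]
  simp only [Function.comp, expect_pure]

theorem expect_uniform {β : Type*} [Fintype β] [Nonempty β] (f : β → ℝ) (hf : ∀ b, 0 ≤ f b) :
    expect (PMF.uniformOfFintype β) (fun b => ENNReal.ofReal (f b)) =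
      ENNReal.ofReal (𝔼 b, f b) := by
  unfold expect
  rw [tsum_fintype, Finset.expect_eq_sum_div_card]
  have hc : (0 : ℝ) < Fintype.card β := by exact_mod_cast Fintype.card_pos
  simp only [PMF.uniformOfFintype_apply, Finset.card_univ]
  rw [← Finset.mul_sum, div_eq_inv_mul, ENNReal.ofReal_mul (by positivity),
    ENNReal.ofReal_inv_of_pos hc, ENNReal.ofReal_natCast,
    ENNReal.ofReal_sum_of_nonneg fun b _ => hf b]

theorem expect_run {α : Type*} [LinearOrder α] {p m : ℕ} [NeZero m] (Q : SeqPQ α)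
    (prog : Fin p → List (Op α)) (sched : List (Fin p)) (f : Config Q p m → ℝ)
    (hf : ∀ s, 0 ≤ f s) :
    expect (run (m := m) Q prog sched) (fun s => ENNReal.ofReal (f s)) =
      ENNReal.ofReal (evol (fun t (d : Fin m × Fin m) s => Config.next prog t d s) sched
        (Config.init Q p m) f) := by
  -- The start distribution is arbitrary because `run` accumulates a distribution from the left,
  -- while `evol` peels off the first step.
  have key : ∀ (l : List (Fin p)) (μ : PMF (Config Q p m)),
      expect (l.foldl (fun μ t => μ.bind fun s =>
        (PMF.uniformOfFintype (Fin m × Fin m)).map fun d => s.next prog t d) μ)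
        (fun s => ENNReal.ofReal (f s)) =
      expect μ fun s => ENNReal.ofReal
        (evol (fun t (d : Fin m × Fin m) s => Config.next prog t d s) l s f) := by
    intro l
    induction l with
    | nil => intro μ; rfl
    | cons u l ih =>
      intro μ
      rw [List.foldl_cons, ih, expect_bind]
      congr 1
      funext s
      rw [expect_map]
      exact expect_uniform (fun d => evol _ l (Config.next prog u d s) f)
        fun d => evol_nonneg _ hf _ _
  unfold run
  rw [key, expect_pure]

end MultiQueue

namespace MultiQueue

/-! ### The time of the sequential operations -/

namespace BinHeap

theorem size_swap {α : Type*} (h : BinHeap α) (i j : ℕ) : (h.swap i j).size = h.size := rfl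

variable {α : Type*} [LinearOrder α]

theorem siftUp_time_le (i : ℕ) : ∀ h : BinHeap α, (h.siftUp i).2 ≤ Nat.log 2 i + 1 := by
  induction i using Nat.strong_induction_on with
  | _ i ih =>
    intro h
    rw [siftUp]
    split_ifs with hc
    · have := ih (i / 2) (by omega) (h.swap i (i / 2))
      have hl : Nat.log 2 i = Nat.log 2 (i / 2) + 1 :=
        Nat.log_of_one_lt_of_le (by norm_num) (by omega)
      simp only
      omega
    · simp

/-- A child of cell `i` has index at least `2 * i`, so `h.size / i` is at least halved in every
iteration. The parameter `n` only drives the induction. -/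
theorem siftDown_time_le (n : ℕ) : ∀ (h : BinHeap α) (i : ℕ), h.size - i ≤ n → 1 ≤ i →
    (h.siftDown i).2 ≤ Nat.log 2 (h.size / i) + 1 := by
  induction n with
  | zero =>
    intro h i hn hi
    rw [siftDown, if_neg (by omega)]
    simp
  | succ n ih =>
    intro h i hn hi
    rw [siftDown]
    split_ifs with hc
    · have h2 : 2 * i ≤ h.minChild i := by unfold minChild; split_ifs <;> omega
      have := ih (h.swap i (h.minChild i)) (h.minChild i) (by rw [size_swap]; omega) (by omega)
      rw [size_swap] at this
      have h3 : 2 ≤ h.size / i := (Nat.le_div_iff_mul_le (by omega)).2 (by omega)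
      have hl : Nat.log 2 (h.size / i) = Nat.log 2 (h.size / i / 2) + 1 :=
        Nat.log_of_one_lt_of_le (by norm_num) h3
      have h4 : Nat.log 2 (h.size / h.minChild i) ≤ Nat.log 2 (h.size / i / 2) := by
        apply Nat.log_mono_right
        rw [Nat.div_div_eq_div_mul]
        exact Nat.div_le_div_left (by omega) (by omega)
      simp only
      omega
    · simp

theorem insert_time_le (a : α) (h : BinHeap α) :
    (h.insert a).2 ≤ Nat.log 2 (h.size + 1) + 2 := by
  exact Nat.add_le_add_right (siftUp_time_le (h.size + 1) _) 1

theorem deleteMin_time_le (h : BinHeap α) : h.deleteMin.2.2 ≤ Nat.log 2 (h.size + 1) + 2 := by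
  simp only [deleteMin]
  split_ifs with h0
  · simp
  · have := siftDown_time_le _
      ({ (h.set 1 (h.cell h.size)).set h.size ⊤ with size := h.size - 1 } : BinHeap α) 1
      le_rfl le_rfl
    simp only [Nat.div_one] at this
    have h4 : Nat.log 2 (h.size - 1) ≤ Nat.log 2 (h.size + 1) := Nat.log_mono_right (by omega)
    simp only
    omega

end BinHeap

theorem runOp_binaryHeap_time_le {α : Type*} [LinearOrder α] (op : Op α)
    (q : (binaryHeap α).State) :
    (runOp (binaryHeap α) op q).2.2 ≤ Nat.log 2 ((binaryHeap α).size q + 1) + 2 := by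
  cases op with
  | insert a => exact BinHeap.insert_time_le a q
  | deleteMin => exact BinHeap.deleteMin_time_le q

namespace VEB

theorem insert_time_of_min_eq_none {k : ℕ} (x : ℕ) (v : VEB k) (hv : v.min = none) :
    (v.insert x).2 = 1 := by
  cases v with
  | leaf mn mx =>
    obtain rfl : mn = none := hv
    rw [insert]
  | node mn mx s cl =>
    obtain rfl : mn = none := hv
    rw [insert]

/-- Two recursive calls occur only if the cluster is empty, and then the call on the cluster takes
one unit. So a level adds at most two units to a single deep call. -/
theorem insert_time_le {k : ℕ} (x : ℕ) (v : VEB k) : (v.insert x).2 ≤ 2 * k + 1 := by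
  induction k generalizing x with
  | zero =>
    cases v with
    | leaf mn mx => cases mn <;> simp [insert]
  | succ k ih =>
    cases v with
    | node mn mx s cl =>
      cases mn with
      | none => simp [insert]
      | some a =>
        rw [insert]
        split_ifs with h1
        · simp
        · simp only
          split_ifs with h2
          · have e1 := insert_time_of_min_eq_none (Nat.max a x % 2 ^ 2 ^ k) _ h2
            have e2 := ih (Nat.max a x / 2 ^ 2 ^ k) s
            simp only
            omega
          · have e2 := ih (Nat.max a x % 2 ^ 2 ^ k) (cl (Nat.max a x / 2 ^ 2 ^ k))
            simp only
            omega

/-- Every branch with a recursive call stores a new minimum. A tree that becomes empty was therefore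
treated in constant time, which makes the first of two recursive calls in `deleteMin` cheap. -/
theorem deleteMin_time_of_min_eq_none {k : ℕ} (v : VEB k) (hv : v.deleteMin.1.min = none) :
    v.deleteMin.2 = 1 := by
  cases v with
  | leaf mn mx => rw [deleteMin]; split_ifs <;> rfl
  | node mn mx s cl =>
    rw [deleteMin] at hv ⊢
    split_ifs at hv ⊢ with h1
    · rfl
    · cases hs : s.min with
      | none => rfl
      | some hi =>
        rw [hs] at hv
        simp only at hv
        split_ifs at hv <;> simp [min] at hv

theorem deleteMin_time_le {k : ℕ} (v : VEB k) : v.deleteMin.2 ≤ 2 * k + 1 := by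
  induction k with
  | zero =>
    cases v with
    | leaf mn mx => rw [deleteMin]; split_ifs <;> simp
  | succ k ih =>
    cases v with
    | node mn mx s cl =>
      rw [deleteMin]
      split_ifs with h1
      · simp
      · cases hs : s.min with
        | none => simp
        | some hi =>
          simp only
          split_ifs with h2
          · have e1 := deleteMin_time_of_min_eq_none _ h2
            have e2 := ih s
            simp only
            omega
          · have e2 := ih (cl hi)
            simp only
            omega

theorem clog_two_le (n : ℕ) (hn : 1 ≤ n) : (Nat.clog 2 n : ℝ) ≤ Real.logb 2 n + 1 := by
  rw [← Real.natCeil_logb_natCast]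
  refine (Nat.ceil_lt_add_one ?_).le
  exact Real.logb_nonneg (by norm_num) (by exact_mod_cast hn)

theorem one_le_logb_logb (U : ℕ) : 1 ≤ Real.logb 2 (Real.logb 2 ((U : ℝ) + 4)) := by
  have hU : (0 : ℝ) ≤ U := Nat.cast_nonneg U
  have h1 : (2 : ℝ) ≤ Real.logb 2 ((U : ℝ) + 4) := by
    rw [Real.le_logb_iff_rpow_le (by norm_num) (by linarith)]
    norm_num
  rw [Real.le_logb_iff_rpow_le (by norm_num) (by linarith)]
  simpa using h1

theorem level_le (U : ℕ) : (level U : ℝ) ≤ 3 * Real.logb 2 (Real.logb 2 ((U : ℝ) + 4)) := by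
  have hU : (0 : ℝ) ≤ U := Nat.cast_nonneg U
  have h0 := one_le_logb_logb U
  have h1 : (2 : ℝ) ≤ Real.logb 2 ((U : ℝ) + 4) := by
    rw [Real.le_logb_iff_rpow_le (by norm_num) (by linarith)]
    norm_num
  have h2 := clog_two_le (U + 1) (by omega)
  have h3 : Real.logb 2 ((U + 1 : ℕ) : ℝ) ≤ Real.logb 2 ((U : ℝ) + 4) := by
    apply Real.logb_le_logb_of_le (by norm_num)
    · positivity
    · push_cast; linarith
  unfold level
  set N := Nat.clog 2 (U + 1)
  rcases Nat.eq_zero_or_pos N with hN | hN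
  · rw [hN]; simp; linarith
  · have h4 := clog_two_le N hN
    -- Rounding up adds at most one, and `1 ≤ logb 2 (U + 4)`. The second rounding and the factor
    -- `2` then give at most `2` on top of the iterated logarithm, which is itself at least `1`.
    have h5 : (N : ℝ) ≤ Real.logb 2 ((U : ℝ) + 4) * 2 := by linarith
    have h6 : Real.logb 2 (N : ℝ) ≤ Real.logb 2 (Real.logb 2 ((U : ℝ) + 4) * 2) :=
      Real.logb_le_logb_of_le (by norm_num) (by exact_mod_cast hN) h5
    rw [Real.logb_mul (by linarith) (by norm_num), Real.logb_self_eq_one (by norm_num)] at h6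
    linarith

end VEB

theorem runOp_vanEmdeBoas_time_le (U : ℕ) (op : Op ℕ) (q : (vanEmdeBoas U).State) :
    (runOp (vanEmdeBoas U) op q).2.2 ≤ 2 * VEB.level U + 2 := by
  cases op with
  | insert a =>
    change (VEBQueue.insert a q).2 ≤ _
    unfold VEBQueue.insert
    simp only
    split_ifs
    · have := VEB.insert_time_le a q.tree
      simp only
      omega
    · simp
  | deleteMin =>
    change (VEBQueue.deleteMin q).2.2 ≤ _
    unfold VEBQueue.deleteMin
    split
    · simp
    · simp only
      split_ifs
      · have := VEB.deleteMin_time_le q.tree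
        simp only
        omega
      · simp

end MultiQueue

namespace MultiQueue

open scoped BigOperators

/-! ### Deferring the random draws

A draw of a thread has no influence on the other threads before the thread tries to lock.  A lazy
configuration leaves the draws of the threads that have drawn but not yet tried to lock open. -/

/-- The local queue whose lock a thread holds, if any. -/
def Phase.held {S α : Type*} {m : ℕ} : Phase S α m → Option (Fin m)
  | .access i _ _ _ => some i
  | .unlock i _ => some i
  | _ => none

/-- Replace the indices in a phase by those determined by the draw `d`, where `mem` are the minima
at the time of the first read and `sel` is the resulting choice of a queue. -/
def Phase.fill {S α : Type*} {m : ℕ} (mem : Fin m → WithTop α) (sel : Fin m × Fin m → Fin m)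
    (d : Fin m × Fin m) : Phase S α m → Phase S α m
  | .readFirst _ _ => .readFirst d.1 d.2
  | .readSecond _ _ _ => .readSecond d.1 d.2 (mem d.1)
  | .tryLock _ => .tryLock (sel d)
  | ph => ph

/-- A configuration with open draws.  The indices in the phases `readFirst`, `readSecond` and
`tryLock` of `base` are irrelevant.  `cnt` counts the steps of the operations, `dur` is the number
of steps of an operation from the acquisition of the lock on, and `log` lists the acquisitions
(local queue, thread, number of the operation), the latest last. -/
structure Lazy {α : Type*} (Q : SeqPQ α) (p m : ℕ) where
  base : Config Q p m
  mem : Fin p → Fin m → WithTop α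
  sel : Fin p → Fin m × Fin m → Fin m
  cnt : Fin p → ℕ → ℕ
  dur : Fin p → ℕ → ℕ
  log : List (Fin m × Fin p × ℕ)

namespace Lazy

variable {α : Type*} [LinearOrder α] {Q : SeqPQ α} {p m : ℕ}

def init (Q : SeqPQ α) (p m : ℕ) : Lazy Q p m where
  base := Config.init Q p m
  mem _ _ := ⊤
  sel _ := Prod.fst
  cnt _ _ := 0
  dur _ _ := 0
  log := []

/-- The configuration for given values of the open draws. -/
def fill (L : Lazy Q p m) (δ : Fin p → Fin m × Fin m) : Config Q p m :=
  { L.base with phase := fun v => (L.base.phase v).fill (L.mem v) (L.sel v) (δ v) }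

/-- The step of thread `t`, which executes `op`; the draw `d` matters only in an attempt to lock. -/
def exec (L : Lazy Q p m) (t : Fin p) (op : Op α) (d : Fin m × Fin m) : Lazy Q p m :=
  { base := (L.fill fun _ => d).exec t op d
    mem :=
      match L.base.phase t with
      | .readFirst _ _ => Function.update L.mem t L.base.minKey
      | _ => L.mem
    sel :=
      match L.base.phase t with
      | .start => Function.update L.sel t Prod.fst
      | .readSecond _ _ _ => Function.update L.sel t
          fun d => if L.base.minKey d.2 < L.mem t d.1 then d.2 else d.1
      | _ => L.sel
    cnt := Function.update L.cnt t
      (Function.update (L.cnt t) (L.base.pos t) (L.cnt t (L.base.pos t) + 1))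
    dur :=
      match L.base.phase t with
      | .tryLock _ => if L.base.locked (L.sel t d) then L.dur else
          Function.update L.dur t (Function.update (L.dur t) (L.base.pos t)
            ((runOp Q op (L.base.queue (L.sel t d))).2.2 + 2))
      | _ => L.dur
    log :=
      match L.base.phase t with
      | .tryLock _ => if L.base.locked (L.sel t d) then L.log else
          L.log ++ [(L.sel t d, t, L.base.pos t)]
      | _ => L.log }

def next (prog : Fin p → List (Op α)) (t : Fin p) (d : Fin m × Fin m) (L : Lazy Q p m) :
    Lazy Q p m :=
  match (prog t)[L.base.pos t]? with
  | none => L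
  | some op => L.exec t op d

theorem fill_fill {S α : Type*} {m : ℕ} (mem : Fin m → WithTop α) (sel : Fin m × Fin m → Fin m)
    (d d' : Fin m × Fin m) (ph : Phase S α m) :
    (ph.fill mem sel d).fill mem sel d' = ph.fill mem sel d' := by
  cases ph <;> rfl

/-- Forget the time. -/
def _root_.MultiQueue.Config.untimed (s : Config Q p m) : Config Q p m :=
  { s with time := fun _ _ => 0 }

theorem _root_.MultiQueue.Config.untimed_exec_congr {s s' : Config Q p m}
    (h : s.untimed = s'.untimed)
    (t : Fin p) (op : Op α) (d : Fin m × Fin m) :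
    (s.exec t op d).untimed = (s'.exec t op d).untimed := by
  obtain ⟨q, mk, lk, ph, ps, o, ti, sz⟩ := s
  obtain ⟨q', mk', lk', ph', ps', o', ti', sz'⟩ := s'
  simp only [Config.untimed, Config.mk.injEq] at h
  obtain ⟨rfl, rfl, rfl, rfl, rfl, rfl, -, rfl⟩ := h
  simp only [Config.exec]
  rcases ph t with _ | _ | _ | i | ⟨i, _ | r, q, e⟩ | _ <;> try rfl
  · cases op <;> rfl
  · simp only
    split_ifs <;> rfl

theorem _root_.MultiQueue.Config.untimed_next_congr {s s' : Config Q p m}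
    (h : s.untimed = s'.untimed)
    (prog : Fin p → List (Op α)) (t : Fin p) (d : Fin m × Fin m) :
    (s.next prog t d).untimed = (s'.next prog t d).untimed := by
  have hp : s.pos = s'.pos := (Config.mk.injEq .. ▸ h : _ ∧ _).2.2.2.2.1
  unfold Config.next
  rw [hp]
  cases (prog t)[s'.pos t]? with
  | none => exact h
  | some op => exact Config.untimed_exec_congr (s := s.charge t) (s' := s'.charge t) h t op d

/-- A real draw merely becomes the open draw of `t`; the draw `d'` offered to the lazy step is
discarded. -/
theorem exec_fill_of_start {L : Lazy Q p m} {t : Fin p} (ht : L.base.phase t = .start)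
    (op : Op α) (δ : Fin p → Fin m × Fin m) (d d' : Fin m × Fin m) :
    (L.fill δ).exec t op d = (L.exec t op d').fill (Function.update δ t d) := by
  have h1 : ∀ δ', (L.fill δ').phase t = .start := fun δ' => by simp [fill, ht, Phase.fill]
  cases op <;>
  · simp only [exec, Config.exec, h1, ht, Config.setPhase]
    simp only [fill, Config.mk.injEq, true_and, and_true]
    funext v
    by_cases hv : v = t
    · subst hv; simp [Phase.fill]
    · simp [hv, fill_fill]

/-- The open draw of `t` is consumed here. Afterwards `t` is in phase `start` or `access`, which
have no open draw, so the entry of `t` may be overwritten by any `d'`. -/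
theorem exec_fill_of_tryLock {L : Lazy Q p m} {t : Fin p} {i : Fin m}
    (ht : L.base.phase t = .tryLock i) (op : Op α) (δ : Fin p → Fin m × Fin m)
    (d d' : Fin m × Fin m) :
    (L.fill δ).exec t op d = (L.exec t op (δ t)).fill (Function.update δ t d') := by
  have h1 : ∀ δ', (L.fill δ').phase t = .tryLock (L.sel t (δ' t)) :=
    fun δ' => by simp [fill, ht, Phase.fill]
  have h2 : ∀ δ', (L.fill δ').locked = L.base.locked := fun _ => rfl
  simp only [exec, Config.exec, h1, ht, h2]
  split_ifs with hl
  all_goals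
    simp only [fill, Config.setPhase, Config.mk.injEq, true_and, and_true]
    try refine ⟨?_, rfl⟩
    funext v
    by_cases hv : v = t
    · subst hv; simp [Phase.fill]
    · simp [hv, fill_fill]

theorem exec_fill_of_not_draw {L : Lazy Q p m} {t : Fin p} (h1 : L.base.phase t ≠ .start)
    (h2 : ∀ i, L.base.phase t ≠ .tryLock i) (op : Op α) (δ : Fin p → Fin m × Fin m)
    (d d' : Fin m × Fin m) :
    (L.fill δ).exec t op d = (L.exec t op d').fill δ := by
  have h3 : ∀ δ', (L.fill δ').phase t = (L.base.phase t).fill (L.mem t) (L.sel t) (δ' t) :=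
    fun δ' => rfl
  rcases ht : L.base.phase t with _ | ⟨i, j⟩ | ⟨i, j, x⟩ | i | ⟨i, _ | r, q, e⟩ | ⟨i, e⟩
  · exact absurd ht h1
  all_goals try exact absurd ht (h2 i)
  all_goals
    simp only [exec, Config.exec, h3, ht, Config.setPhase, Phase.fill]
    simp only [fill, Config.mk.injEq, true_and, and_true]
    funext v
    by_cases hv : v = t
    · subst hv
      simp [Phase.fill]
      try rfl
    · simp [hv, fill_fill]

end Lazy

open Lazy

variable {α : Type*} [LinearOrder α] {Q : SeqPQ α} {p m : ℕ}

/-- One step of the deferral. At `start` the real draw overwrites a coordinate of `δ`; at `tryLock`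
the fresh draw of the lazy step takes the role of `δ t`. Both are instances of
`expect_expect_update`; otherwise no draw matters. `G` must ignore the time because lazy steps do
not charge any. -/
theorem expect_next_fill [NeZero m] (prog : Fin p → List (Op α)) (t : Fin p) (L : Lazy Q p m)
    (G : Config Q p m → ℝ) (hG : ∀ s s', s.untimed = s'.untimed → G s = G s') :
    𝔼 δ : Fin p → Fin m × Fin m, 𝔼 d, G ((L.fill δ).next prog t d) =
      𝔼 d, 𝔼 δ : Fin p → Fin m × Fin m, G ((L.next prog t d).fill δ) := by
  have hpos : ∀ δ, (L.fill δ).pos t = L.base.pos t := fun _ => rfl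
  simp only [Config.next, Lazy.next, hpos]
  cases (prog t)[L.base.pos t]? with
  | none => simp
  | some op =>
    have hc : ∀ δ d, G (((L.fill δ).charge t).exec t op d) = G ((L.fill δ).exec t op d) :=
      fun δ d => hG _ _ (Config.untimed_exec_congr (s := (L.fill δ).charge t)
        (s' := L.fill δ) rfl t op d)
    simp only [hc]
    by_cases h1 : L.base.phase t = .start
    · let d₀ : Fin m × Fin m := 0
      have e1 : ∀ δ d, (L.fill δ).exec t op d = (L.exec t op d₀).fill (Function.update δ t d) :=
        fun δ d => exec_fill_of_start h1 op δ d d₀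
      have e2 : ∀ δ d, (L.exec t op d).fill δ = (L.exec t op d₀).fill δ := fun δ d => by
        have := (exec_fill_of_start h1 op δ (δ t) d).symm.trans (e1 δ (δ t))
        simpa using this
      simp only [e1, e2, Fintype.expect_const]
      exact expect_expect_update t fun δ => G ((L.exec t op d₀).fill δ)
    · by_cases h2 : ∃ i, L.base.phase t = .tryLock i
      · obtain ⟨i, hi⟩ := h2
        have e1 : ∀ δ d, (L.fill δ).exec t op d = (L.exec t op (δ t)).fill δ := fun δ d => by
          simpa using exec_fill_of_tryLock hi op δ d (δ t)
        have e2 : ∀ δ d, (L.exec t op d).fill (Function.update δ t d) = (L.exec t op d).fill δ := by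
          intro δ d
          have f1 := exec_fill_of_tryLock hi op (Function.update δ t d) d (δ t)
          have f2 := exec_fill_of_tryLock hi op (Function.update δ t d) d d
          simp only [Function.update_self, Function.update_idem, Function.update_eq_self] at f1 f2
          exact f2.symm.trans f1
        simp only [e1, Fintype.expect_const]
        rw [← expect_expect_update t, Finset.expect_comm]
        simp only [Function.update_self, e2]
      · have e1 : ∀ δ d d', (L.fill δ).exec t op d = (L.exec t op d').fill δ := fun δ d d' =>
          exec_fill_of_not_draw h1 (fun i hi => h2 ⟨i, hi⟩) op δ d d'
        rw [Finset.expect_comm]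
        exact Finset.expect_congr rfl fun d _ => Finset.expect_congr rfl fun δ _ => by rw [e1 δ d d]

/-- The configurations arise from the lazy ones by drawing the open draws. -/
theorem evol_fill [NeZero m] (prog : Fin p → List (Op α)) (l : List (Fin p)) (L : Lazy Q p m)
    (G : Config Q p m → ℝ) (hG : ∀ s s', s.untimed = s'.untimed → G s = G s') :
    𝔼 δ : Fin p → Fin m × Fin m,
        evol (fun t (d : Fin m × Fin m) s => Config.next prog t d s) l (L.fill δ) G =
      evol (fun t d L => Lazy.next prog t d L) l L
        (fun L' => 𝔼 δ : Fin p → Fin m × Fin m, G (L'.fill δ)) := by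
  induction l generalizing L with
  | nil => rfl
  | cons t l ih =>
    have hG' : ∀ s s' : Config Q p m, s.untimed = s'.untimed →
        evol (fun t (d : Fin m × Fin m) s => Config.next prog t d s) l s G =
        evol (fun t (d : Fin m × Fin m) s => Config.next prog t d s) l s' G := by
      clear ih L
      induction l with
      | nil => exact hG
      | cons t l ih =>
        intro s s' h
        simp only [evol]
        exact Finset.expect_congr rfl fun d _ => ih _ _ (Config.untimed_next_congr h prog t d)
    exact (expect_next_fill prog t L (fun s => evol (fun t (d : Fin m × Fin m) s =>
      Config.next prog t d s) l s G) hG').trans (Finset.expect_congr rfl fun d _ => ih _)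

theorem evol_init [NeZero m] (prog : Fin p → List (Op α)) (l : List (Fin p))
    (G : Config Q p m → ℝ) (hG : ∀ s s', s.untimed = s'.untimed → G s = G s') :
    evol (fun t (d : Fin m × Fin m) s => Config.next prog t d s) l (Config.init Q p m) G =
      evol (fun t d L => Lazy.next prog t d L) l (Lazy.init Q p m)
        (fun L' => 𝔼 δ : Fin p → Fin m × Fin m, G (L'.fill δ)) := by
  rw [← evol_fill prog l _ G hG]
  have : ∀ δ, (Lazy.init Q p m).fill δ = Config.init Q p m := fun δ => rfl
  simp only [this, Fintype.expect_const]

end MultiQueue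

/-! ### Invariants of the lazy execution -/

namespace MultiQueue

open scoped BigOperators

namespace Lazy

theorem held_fill {S α : Type*} {m : ℕ} (mem : Fin m → WithTop α) (sel : Fin m × Fin m → Fin m)
    (d : Fin m × Fin m) (ph : Phase S α m) : (ph.fill mem sel d).held = ph.held := by
  cases ph <;> rfl

variable {α : Type*} [LinearOrder α] {Q : SeqPQ α} {p m : ℕ}

/-- The three kinds of steps: those that leave all locks alone, the acquisition of a lock and the
release of a lock. -/
theorem exec_cases (L : Lazy Q p m) (t : Fin p) (op : Op α) (d : Fin m × Fin m) :
    ((∀ v, ((L.exec t op d).base.phase v).held = (L.base.phase v).held) ∧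
      (L.exec t op d).base.locked = L.base.locked ∧ (L.exec t op d).base.pos = L.base.pos ∧
      (L.exec t op d).dur = L.dur ∧ (L.exec t op d).base.sizeAtLock = L.base.sizeAtLock ∧
      (L.exec t op d).log = L.log) ∨
    (∃ i, L.sel t d = i ∧ (L.base.phase t).held = none ∧ L.base.locked i = false ∧
      ((∀ v, ((L.exec t op d).base.phase v).held =
        if v = t then some i else (L.base.phase v).held) ∧
      (L.exec t op d).base.locked = Function.update L.base.locked i true ∧
      (L.exec t op d).base.pos = L.base.pos ∧
      (L.exec t op d).dur = Function.update L.dur t (Function.update (L.dur t) (L.base.pos t)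
            ((runOp Q op (L.base.queue i)).2.2 + 2)) ∧
      (L.exec t op d).base.sizeAtLock = Function.update L.base.sizeAtLock t
            (Function.update (L.base.sizeAtLock t) (L.base.pos t) L.base.size) ∧
      (L.exec t op d).log = L.log ++ [(i, t, L.base.pos t)])) ∨
    (∃ i, (L.base.phase t).held = some i ∧
      ((∀ v, ((L.exec t op d).base.phase v).held =
        if v = t then none else (L.base.phase v).held) ∧
      (L.exec t op d).base.locked = Function.update L.base.locked i false ∧
      (L.exec t op d).base.pos = Function.update L.base.pos t (L.base.pos t + 1) ∧
      (L.exec t op d).dur = L.dur ∧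
      (L.exec t op d).base.sizeAtLock = L.base.sizeAtLock ∧
      (L.exec t op d).log = L.log)) := by
  have h3 : ∀ δ', (L.fill δ').phase t = (L.base.phase t).fill (L.mem t) (L.sel t) (δ' t) :=
    fun δ' => rfl
  have hv : ∀ (ph : Phase Q.State α m) (δ : Fin p → Fin m × Fin m) (v : Fin p),
      (Function.update (L.fill δ).phase t ph v).held =
        if v = t then ph.held else (L.base.phase v).held := by
    intro ph δ v
    by_cases h : v = t
    · subst h; simp
    · simp [h, fill, held_fill]
  rcases ht : L.base.phase t with _ | ⟨i, j⟩ | ⟨i, j, x⟩ | i | ⟨i, _ | r, q, e⟩ | ⟨i, e⟩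
  · left
    cases op <;>
    · refine ⟨fun v => ?_, ?_, ?_, ?_, ?_, ?_⟩ <;>
        simp only [exec, Config.exec, h3, ht, Phase.fill, Config.setPhase, hv] <;> try rfl
      by_cases h : v = t
      · subst h; simp [ht, Phase.held]
      · simp [h]
  · left
    refine ⟨fun v => ?_, ?_, ?_, ?_, ?_, ?_⟩ <;>
      simp only [exec, Config.exec, h3, ht, Phase.fill, Config.setPhase, hv] <;> try rfl
    by_cases h : v = t
    · subst h; simp [ht, Phase.held]
    · simp [h]
  · left
    refine ⟨fun v => ?_, ?_, ?_, ?_, ?_, ?_⟩ <;>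
      simp only [exec, Config.exec, h3, ht, Phase.fill, Config.setPhase, hv] <;> try rfl
    by_cases h : v = t
    · subst h; simp [ht, Phase.held]
    · simp [h]
  · by_cases hl : L.base.locked (L.sel t d) = true
    · left
      have hl' : (L.fill fun _ => d).locked (L.sel t d) = true := hl
      refine ⟨fun v => ?_, ?_, ?_, ?_, ?_, ?_⟩ <;>
        simp only [exec, Config.exec, h3, ht, Phase.fill, Config.setPhase, hl, hl', if_true, hv] <;>
        try rfl
      by_cases h : v = t
      · subst h; simp [ht, Phase.held]
      · simp [h]
    · right; left
      have hl' : ¬ (L.fill fun _ => d).locked (L.sel t d) = true := hl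
      refine ⟨_, rfl, rfl, by simpa using hl, fun v => ?_, ?_, ?_, ?_, ?_, ?_⟩ <;>
        simp only [exec, Config.exec, h3, ht, Phase.fill, Config.setPhase, hl, hl',
          Bool.false_eq_true, if_false, hv] <;>
        rfl
  · left
    refine ⟨fun v => ?_, ?_, ?_, ?_, ?_, ?_⟩ <;>
      simp only [exec, Config.exec, h3, ht, Phase.fill, Config.setPhase, hv] <;> try rfl
    by_cases h : v = t
    · subst h; simp [ht, Phase.held]
    · simp [h]
  · left
    refine ⟨fun v => ?_, ?_, ?_, ?_, ?_, ?_⟩ <;>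
      simp only [exec, Config.exec, h3, ht, Phase.fill, Config.setPhase, hv] <;> try rfl
    by_cases h : v = t
    · subst h; simp [ht, Phase.held]
    · simp [h]
  · right; right
    refine ⟨i, rfl, fun v => ?_, ?_, ?_, ?_, ?_, ?_⟩ <;>
      simp only [exec, Config.exec, h3, ht, Phase.fill, Config.setPhase, hv] <;> rfl

/-- The invariants of the lazy execution. -/
structure Inv (L : Lazy Q p m) : Prop where
  unique : ∀ u v i, (L.base.phase u).held = some i → (L.base.phase v).held = some i → u = v
  locked : ∀ i, L.base.locked i = true ↔ ∃ u, (L.base.phase u).held = some i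
  sel : ∀ u d, L.sel u d = d.1 ∨ L.sel u d = d.2
  dur : ∀ u k, (L.base.pos u < k ∨ (k = L.base.pos u ∧ (L.base.phase u).held = none)) →
    L.dur u k = 0
  dur_le : ∀ u k, L.dur u k = 0 ∨ ∃ op q, L.dur u k = (runOp Q op q).2.2 + 2 ∧
    Q.size q ≤ L.base.sizeAtLock u k
  nodup : (L.log.map Prod.snd).Nodup
  log : ∀ x ∈ L.log, x.2.2 < L.base.pos x.2.1 ∨
    (x.2.2 = L.base.pos x.2.1 ∧ (L.base.phase x.2.1).held ≠ none)

theorem Inv.init : (Lazy.init Q p m).Inv where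
  unique u v i h := by simp [Lazy.init, Config.init, Phase.held] at h
  locked i := by simp [Lazy.init, Config.init, Phase.held]
  sel u d := Or.inl rfl
  dur _ _ _ := rfl
  dur_le _ _ := Or.inl rfl
  nodup := List.nodup_nil
  log x hx := by simp [Lazy.init] at hx

/-- Apart from `sel`, the invariants involve only data tracked by `exec_cases`, so only acquisitions
and releases of locks need an argument. -/
theorem Inv.exec {L : Lazy Q p m} (h : L.Inv) (t : Fin p) (op : Op α) (d : Fin m × Fin m) :
    (L.exec t op d).Inv := by
  have hsel : ∀ u d', (L.exec t op d).sel u d' = d'.1 ∨ (L.exec t op d).sel u d' = d'.2 := by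
    intro u d'
    by_cases hu : u = t
    · subst hu
      rcases hu : L.base.phase u with _ | _ | _ | _ | _ | _ <;> simp only [Lazy.exec, hu]
      case start => simp
      case readSecond =>
        simp only [Function.update_self]
        split_ifs <;> simp
      all_goals exact h.sel u d'
    · rcases ht : L.base.phase t with _ | _ | _ | _ | _ | _ <;>
        simpa [Lazy.exec, ht, hu] using h.sel u d'
  rcases L.exec_cases t op d with ⟨e1, e2, e3, e4, e5, e6⟩ |
    ⟨i, hi, h0, hl, e1, e2, e3, e4, e5, e6⟩ | ⟨i, h0, e1, e2, e3, e4, e5, e6⟩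
  · refine ⟨?_, ?_, hsel, ?_, ?_, ?_, ?_⟩ <;> simp only [e1, e2, e3, e4, e5, e6]
    exacts [h.unique, h.locked, h.dur, h.dur_le, h.nodup, h.log]
  · have hfree : ∀ u, (L.base.phase u).held ≠ some i := fun u hu => by
      have := (h.locked i).2 ⟨u, hu⟩
      simp [hl] at this
    refine ⟨?_, ?_, hsel, ?_, ?_, ?_, ?_⟩ <;> simp only [e1, e2, e3, e4, e5, e6]
    · intro u v j hu hv
      by_cases hut : u = t <;> by_cases hvt : v = t
      · rw [hut, hvt]
      · simp only [hut, hvt, if_true, if_false, Option.some.injEq] at hu hv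
        exact absurd hv (hu ▸ hfree v)
      · simp only [hut, hvt, if_true, if_false, Option.some.injEq] at hu hv
        exact absurd hu (hv ▸ hfree u)
      · simp only [hut, hvt, if_false] at hu hv
        exact h.unique u v j hu hv
    · intro j
      by_cases hj : j = i
      · subst hj
        simp only [Function.update_self, true_iff]
        exact ⟨t, by simp⟩
      · rw [Function.update_of_ne hj, h.locked j]
        constructor
        · rintro ⟨u, hu⟩
          refine ⟨u, ?_⟩
          rw [if_neg]
          · exact hu
          · rintro rfl
            simp [h0] at hu
        · rintro ⟨u, hu⟩
          by_cases hut : u = t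
          · simp only [hut, if_true, Option.some.injEq] at hu
            exact absurd hu.symm hj
          · exact ⟨u, by simpa [hut] using hu⟩
    · intro u k hk
      by_cases hut : u = t
      · subst hut
        simp only [if_true, reduceCtorEq, and_false, or_false] at hk
        simp only [Function.update_self]
        rw [Function.update_of_ne (by omega)]
        exact h.dur u k (Or.inl hk)
      · simp only [hut, if_false] at hk
        rw [Function.update_of_ne hut]
        exact h.dur u k hk
    · intro u k
      by_cases hut : u = t
      · subst hut
        by_cases hk : k = L.base.pos u
        · subst hk
          simp only [Function.update_self]
          exact Or.inr ⟨op, _, rfl,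
            Finset.single_le_sum (f := fun i => Q.size (L.base.queue i)) (fun _ _ => Nat.zero_le _)
              (Finset.mem_univ i)⟩
        · simpa [hk] using h.dur_le u k
      · simpa [hut] using h.dur_le u k
    · rw [List.map_append, List.nodup_append]
      refine ⟨h.nodup, by simp, ?_⟩
      intro a ha b hb hab
      simp only [List.map_cons, List.map_nil, List.mem_singleton] at hb
      obtain ⟨x, hx, rfl⟩ := List.mem_map.1 ha
      -- An earlier log entry for the current operation would mean that `t` already holds a lock.
      have := h.log x hx
      rw [hab, hb] at this
      simp [h0] at this
    · intro x hx
      rw [List.mem_append, List.mem_singleton] at hx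
      rcases hx with hx | rfl
      · rcases h.log x hx with h1 | ⟨h1, h2⟩
        · exact Or.inl h1
        · refine Or.inr ⟨h1, ?_⟩
          split_ifs
          · simp
          · exact h2
      · right; simp
  · refine ⟨?_, ?_, hsel, ?_, ?_, ?_, ?_⟩ <;> simp only [e1, e2, e3, e4, e5, e6]
    · intro u v j hu hv
      by_cases hut : u = t
      · simp [hut] at hu
      by_cases hvt : v = t
      · simp [hvt] at hv
      simp only [hut, hvt, if_false] at hu hv
      exact h.unique u v j hu hv
    · intro j
      by_cases hj : j = i
      · subst hj
        simp only [Function.update_self, Bool.false_eq_true, false_iff, not_exists]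
        intro u hu
        by_cases hut : u = t
        · simp [hut] at hu
        · simp only [hut, if_false] at hu
          exact hut (h.unique u t j hu h0)
      · rw [Function.update_of_ne hj, h.locked j]
        constructor
        · rintro ⟨u, hu⟩
          refine ⟨u, ?_⟩
          rw [if_neg]
          · exact hu
          · rintro rfl
            rw [h0] at hu
            exact hj (Option.some.inj hu).symm
        · rintro ⟨u, hu⟩
          by_cases hut : u = t
          · simp [hut] at hu
          · exact ⟨u, by simpa [hut] using hu⟩
    · intro u k hk
      by_cases hut : u = t
      · subst hut
        simp only [Function.update_self] at hk
        exact h.dur u k (Or.inl (by omega))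
      · simp only [Function.update_of_ne hut, hut, if_false] at hk
        exact h.dur u k hk
    · exact h.dur_le
    · exact h.nodup
    · intro x hx
      by_cases hut : x.2.1 = t
      · left
        rw [hut, Function.update_self]
        rcases h.log x hx with h1 | ⟨h1, h2⟩ <;> rw [hut] at h1 <;> omega
      · simpa [hut] using h.log x hx

theorem Inv.next {L : Lazy Q p m} (h : L.Inv) (prog : Fin p → List (Op α)) (t : Fin p)
    (d : Fin m × Fin m) : (L.next prog t d).Inv := by
  unfold Lazy.next
  split
  · exact h
  · exact h.exec t _ d

end Lazy

end MultiQueue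

/-! ### Success probability of an attempt to lock and expected contention -/

namespace MultiQueue

open scoped BigOperators

theorem expect_fst_eq {m : ℕ} [NeZero m] (x : Fin m) :
    𝔼 d : Fin m × Fin m, (if d.1 = x then (1 : ℝ) else 0) = 1 / m := by
  rw [← Finset.univ_product_univ, Finset.expect_product]
  refine (Finset.expect_congr rfl fun a _ =>
    Fintype.expect_const (if a = x then (1 : ℝ) else 0)).trans ?_
  simp [Finset.expect_eq_sum_div_card]

theorem expect_snd_eq {m : ℕ} [NeZero m] (x : Fin m) :
    𝔼 d : Fin m × Fin m, (if d.2 = x then (1 : ℝ) else 0) = 1 / m := by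
  rw [← Finset.univ_product_univ, Finset.expect_product]
  simp [Finset.expect_eq_sum_div_card]

namespace Lazy

variable {α : Type*} [LinearOrder α] {Q : SeqPQ α} {p m : ℕ}

/-- Every locked queue is held by some thread, and a phase names at most one held queue; so choosing
a holder is injective. -/
theorem Inv.card_locked_le {L : Lazy Q p m} (h : L.Inv) :
    (Finset.univ.filter fun i => L.base.locked i = true).card ≤ p := by
  have hex : ∀ i, L.base.locked i = true → ∃ u, (L.base.phase u).held = some i :=
    fun i => (h.locked i).1
  rcases isEmpty_or_nonempty (Fin p) with hp | hp
  · rw [Finset.filter_false_of_mem]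
    · simp
    · intro i _ hi
      exact hp.elim (hex i hi).choose
  · choose! f hf using hex
    have := Finset.card_le_card_of_injOn (s := Finset.univ.filter fun i => L.base.locked i = true)
      (t := (Finset.univ : Finset (Fin p))) f (fun _ _ => Finset.mem_univ _) (by
        intro i hi j hj hij
        have h1 := hf i (by simpa using hi)
        have h2 := hf j (by simpa using hj)
        rw [hij, h2] at h1
        exact (Option.some.inj h1).symm)
    simpa using this

/-- However the minima determine the choice, the chosen queue is one of two uniformly drawn ones,
and a union bound applies. -/
theorem Inv.expect_sel_le [NeZero m] {L : Lazy Q p m} (h : L.Inv) (t : Fin p) (x : Fin m) :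
    𝔼 d, (if L.sel t d = x then (1 : ℝ) else 0) ≤ 2 / m := by
  calc 𝔼 d, (if L.sel t d = x then (1 : ℝ) else 0)
      ≤ 𝔼 d : Fin m × Fin m, ((if d.1 = x then (1 : ℝ) else 0) + if d.2 = x then 1 else 0) := by
        refine Finset.expect_le_expect fun d _ => ?_
        rcases h.sel t d with e | e <;> rw [e] <;> split_ifs <;> norm_num
    _ = 2 / m := by
        rw [Finset.expect_add_distrib, expect_fst_eq, expect_snd_eq]
        ring

/-- An attempt to lock succeeds with at least constant probability. -/
theorem Inv.le_expect_unlocked [NeZero m] {L : Lazy Q p m} (h : L.Inv) (t : Fin p)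
    (hpm : p ≤ m) :
    (1 - (p : ℝ) / m) ^ 2 ≤ 𝔼 d, (if L.base.locked (L.sel t d) = true then (0 : ℝ) else 1) := by
  have hm : (0 : ℝ) < m := by exact_mod_cast Nat.pos_of_neZero m
  have hpm' : (p : ℝ) ≤ m := by exact_mod_cast hpm
  have h1 : 1 - (p : ℝ) / m ≤ 𝔼 i, (if L.base.locked i = true then (0 : ℝ) else 1) := by
    have e : ∀ i, (if L.base.locked i = true then (0 : ℝ) else 1) =
        1 - (if L.base.locked i = true then 1 else 0) := fun i => by split_ifs <;> norm_num
    simp only [e, Finset.expect_sub_distrib, Fintype.expect_const]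
    rw [Finset.expect_eq_sum_div_card, Finset.sum_boole]
    have := h.card_locked_le
    have h2 : ((Finset.univ.filter fun i => L.base.locked i = true).card : ℝ) ≤ p := by
      exact_mod_cast this
    simp only [Finset.card_univ, Fintype.card_fin]
    gcongr
  have h0 : 0 ≤ 1 - (p : ℝ) / m := by
    rw [sub_nonneg, div_le_one hm]
    exact hpm'
  -- If both drawn queues are unlocked then so is the selected one, whichever it is; independence of
  -- the two draws gives the square.
  calc (1 - (p : ℝ) / m) ^ 2
      ≤ (𝔼 i, (if L.base.locked i = true then (0 : ℝ) else 1)) ^ 2 := by gcongr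
    _ = 𝔼 d : Fin m × Fin m, (if L.base.locked d.1 = true then (0 : ℝ) else 1) *
          (if L.base.locked d.2 = true then (0 : ℝ) else 1) := by
        rw [sq, Finset.expect_mul_expect, ← Finset.univ_product_univ, Finset.expect_product]
    _ ≤ _ := by
        refine Finset.expect_le_expect fun d _ => ?_
        rcases h.sel t d with e | e <;> rw [e] <;> split_ifs <;> norm_num

/-- Two threads are about to write the same word. -/
def Contend (s : Config Q p m) (t v : Fin p) : Prop :=
  ∃ w, (s.phase t).writes = some w ∧ (s.phase v).writes = some w

theorem Contend.symm {s : Config Q p m} {t v : Fin p} (h : Contend s t v) : Contend s v t := by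
  obtain ⟨w, h1, h2⟩ := h
  exact ⟨w, h2, h1⟩

open Classical in
theorem stepCost_le (s : Config Q p m) (t : Fin p) :
    (s.stepCost t : ℝ) ≤ 1 + ∑ v ∈ Finset.univ.erase t, if Contend s t v then (1 : ℝ) else 0 := by
  unfold Config.stepCost
  cases hw : (s.phase t).writes with
  | none =>
    simp only [Nat.cast_one, le_add_iff_nonneg_right]
    exact Finset.sum_nonneg fun v _ => by split_ifs <;> norm_num
  | some w =>
    have e : ∀ v, Contend s t v ↔ (s.phase v).writes = some w := by
      intro v
      simp only [Contend, hw, Option.some.injEq]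
      exact ⟨fun ⟨w', h1, h2⟩ => h1 ▸ h2, fun h => ⟨w, rfl, h⟩⟩
    simp only [e, Config.contention]
    rw [Finset.card_filter, Nat.cast_sum, ← Finset.add_sum_erase _ _ (Finset.mem_univ t)]
    simp [hw]

-- Fix all draws except that of `v`. The word that `t` is about to write is then determined, and the
-- selected queue of `v` has to hit it.
open Classical in
theorem Inv.expect_contend_le_of_tryLock [NeZero m] {L : Lazy Q p m} (h : L.Inv) {t v : Fin p}
    (htv : t ≠ v) {i : Fin m} (hv : L.base.phase v = .tryLock i) :
    𝔼 δ : Fin p → Fin m × Fin m, (if Contend (L.fill δ) t v then (1 : ℝ) else 0) ≤ 2 / m := by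
  rw [← expect_expect_update v]
  have hm : (0 : ℝ) ≤ 2 / m := by positivity
  calc _ ≤ 𝔼 δ : Fin p → Fin m × Fin m, (2 / m : ℝ) := by
        refine Finset.expect_le_expect fun δ _ => ?_
        have e : ∀ d, Contend (L.fill (Function.update δ v d)) t v ↔
            ((L.fill δ).phase t).writes = some (.lock (L.sel v d)) := by
          intro d
          have h1 : (L.fill (Function.update δ v d)).phase t = (L.fill δ).phase t := by
            simp [fill, htv]
          have h2 : ((L.fill (Function.update δ v d)).phase v).writes =
              some (.lock (L.sel v d)) := by
            simp [fill, hv, Phase.fill, Phase.writes]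
          simp only [Contend, h1, h2, Option.some.injEq]
          exact ⟨fun ⟨w, h3, h4⟩ => by rw [h3, h4], fun h => ⟨_, h, rfl⟩⟩
        simp only [e]
        by_cases hx : ∃ x, ((L.fill δ).phase t).writes = some (.lock x)
        · obtain ⟨x, hx⟩ := hx
          simp only [hx, Option.some.injEq, Word.lock.injEq]
          refine le_trans (le_of_eq ?_) (h.expect_sel_le v x)
          refine Finset.expect_congr rfl fun d _ => ?_
          simp only [eq_comm]
        · rw [Finset.expect_eq_zero]
          · exact hm
          · intro d _
            rw [if_neg]
            exact fun h => hx ⟨_, h⟩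
    _ = 2 / m := Fintype.expect_const _

-- If neither thread is trying to lock, each can only be about to write a word of a queue whose lock
-- it holds, and no lock is held by two threads. So contention always involves an open draw.
open Classical in
theorem Inv.expect_contend_le [NeZero m] {L : Lazy Q p m} (h : L.Inv) {t v : Fin p}
    (htv : t ≠ v) :
    𝔼 δ : Fin p → Fin m × Fin m, (if Contend (L.fill δ) t v then (1 : ℝ) else 0) ≤ 2 / m := by
  by_cases hv : ∃ i, L.base.phase v = .tryLock i
  · exact h.expect_contend_le_of_tryLock htv hv.choose_spec
  by_cases ht : ∃ i, L.base.phase t = .tryLock i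
  · have := h.expect_contend_le_of_tryLock htv.symm ht.choose_spec
    refine le_trans (le_of_eq ?_) this
    refine Finset.expect_congr rfl fun δ _ => ?_
    have e : Contend (L.fill δ) t v ↔ Contend (L.fill δ) v t := ⟨.symm, .symm⟩
    simp only [e]
  · have key : ∀ u, (¬ ∃ i, L.base.phase u = .tryLock i) → ∀ δ w,
        ((L.fill δ).phase u).writes = some w → ∃ i, (w = .lock i ∨ w = .minKey i) ∧
          (L.base.phase u).held = some i := by
      intro u hu δ w hw
      rcases hu' : L.base.phase u with _ | ⟨i, j⟩ | ⟨i, j, x⟩ | i | ⟨i, _ | r, q, e⟩ | ⟨i, e⟩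
      case tryLock => exact absurd ⟨i, hu'⟩ hu
      all_goals simp only [fill, hu', Phase.fill, Phase.writes, reduceCtorEq,
        Option.some.injEq] at hw
      all_goals subst hw; exact ⟨i, by simp, rfl⟩
    rw [Finset.expect_eq_zero]
    · positivity
    · rintro δ -
      rw [if_neg]
      rintro ⟨w, h1, h2⟩
      obtain ⟨i, hi, hi'⟩ := key t ht δ w h1
      obtain ⟨j, hj, hj'⟩ := key v hv δ w h2
      have : i = j := by
        rcases hi with rfl | rfl <;> rcases hj with hj | hj <;> simp_all
      subst this
      exact htv (h.unique t v i hi' hj')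

/-- One unit for `t` itself and at most `2 / m` for each of the other threads, of which there are
fewer than `m`. -/
theorem Inv.expect_stepCost_le [NeZero m] {L : Lazy Q p m} (h : L.Inv) (t : Fin p)
    (hpm : p ≤ m) :
    𝔼 δ : Fin p → Fin m × Fin m, ((L.fill δ).stepCost t : ℝ) ≤ 3 := by
  classical
  have hm : (0 : ℝ) < m := by exact_mod_cast Nat.pos_of_neZero m
  have hpm' : (p : ℝ) ≤ m := by exact_mod_cast hpm
  calc _ ≤ 𝔼 δ : Fin p → Fin m × Fin m, ((1 : ℝ) + ∑ v ∈ Finset.univ.erase t,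
          if Contend (L.fill δ) t v then (1 : ℝ) else 0) :=
        Finset.expect_le_expect fun δ _ => stepCost_le _ t
    _ = 1 + ∑ v ∈ Finset.univ.erase t, 𝔼 δ : Fin p → Fin m × Fin m,
          (if Contend (L.fill δ) t v then (1 : ℝ) else 0) := by
        rw [Finset.expect_add_distrib, Fintype.expect_const, Finset.expect_sum_comm]
    _ ≤ 1 + ∑ v ∈ Finset.univ.erase t, (2 / m : ℝ) := by
        gcongr with v hv
        exact h.expect_contend_le (Finset.ne_of_mem_erase hv).symm
    _ ≤ 1 + ∑ v : Fin p, (2 / m : ℝ) := by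
        gcongr
        exact Finset.subset_univ _
    _ ≤ 3 := by
        simp only [Finset.sum_const, Finset.card_univ, Fintype.card_fin, nsmul_eq_mul]
        have : (p : ℝ) * (2 / m) ≤ 2 := by
          rw [mul_div_assoc', div_le_iff₀ hm]
          linarith
        linarith

end Lazy

end MultiQueue

/-! ### From time to steps, and from steps to sequential work -/

namespace MultiQueue

open scoped BigOperators

variable {α : Type*} [LinearOrder α] {Q : SeqPQ α} {p m : ℕ}

/-- Thread `t` spends its step on its operation number `k`. -/
abbrev Config.Works (prog : Fin p → List (Op α)) (u t : Fin p) (k : ℕ) (s : Config Q p m) : Prop :=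
  u = t ∧ s.pos t = k ∧ k < (prog t).length

theorem Config.time_exec (s : Config Q p m) (t : Fin p) (op : Op α) (d : Fin m × Fin m) :
    (s.exec t op d).time = s.time := by
  unfold Config.exec
  split
  · split <;> rfl
  · rfl
  · rfl
  · split_ifs <;> rfl
  · rfl
  · rfl
  · rfl

theorem Config.time_next (prog : Fin p → List (Op α)) (u t : Fin p) (k : ℕ) (d : Fin m × Fin m)
    (s : Config Q p m) :
    (s.next prog u d).time t k = s.time t k + if s.Works prog u t k then s.stepCost u else 0 := by
  unfold Config.next Config.Works
  cases hop : (prog u)[s.pos u]? with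
  | none =>
    rw [List.getElem?_eq_none_iff] at hop
    rw [if_neg]
    · simp
    · rintro ⟨rfl, rfl, h⟩
      omega
  | some op =>
    simp only [Config.time_exec, Config.charge]
    have hlt := (List.getElem?_eq_some_iff.1 hop).1
    by_cases hu : u = t
    · subst hu
      by_cases hk : s.pos u = k
      · subst hk
        simp [hlt]
      · simp [hk, Function.update_of_ne (Ne.symm hk)]
    · simp [hu, Function.update_of_ne (Ne.symm hu)]

theorem Lazy.cnt_next (prog : Fin p → List (Op α)) (u t : Fin p) (k : ℕ) (d : Fin m × Fin m)
    (L : Lazy Q p m) :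
    (L.next prog u d).cnt t k = L.cnt t k + if L.base.Works prog u t k then 1 else 0 := by
  unfold Lazy.next Config.Works
  cases hop : (prog u)[L.base.pos u]? with
  | none =>
    rw [List.getElem?_eq_none_iff] at hop
    rw [if_neg]
    · simp
    · rintro ⟨rfl, rfl, h⟩
      omega
  | some op =>
    simp only [Lazy.exec]
    have hlt := (List.getElem?_eq_some_iff.1 hop).1
    by_cases hu : u = t
    · subst hu
      by_cases hk : L.base.pos u = k
      · subst hk
        simp [hlt]
      · simp [hk, Function.update_of_ne (Ne.symm hk)]
    · simp [hu, Function.update_of_ne (Ne.symm hu)]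

theorem Config.stepCost_congr {s s' : Config Q p m} (h : s.untimed = s'.untimed) (t : Fin p) :
    s.stepCost t = s'.stepCost t := by
  have hp : s.untimed.phase = s'.untimed.phase := congrArg Config.phase h
  change s.phase = s'.phase at hp
  simp only [Config.stepCost, Config.contention, hp]

/-- The expected time of an operation is at most three times its expected number of steps. -/
theorem evol_time_le [NeZero m] (hpm : p ≤ m) (prog : Fin p → List (Op α)) (l : List (Fin p))
    (t : Fin p) (k : ℕ) :
    evol (fun t (d : Fin m × Fin m) s => Config.next prog t d s) l (Config.init Q p m)
        (fun s => (s.time t k : ℝ)) ≤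
      3 * evol (fun t d L => Lazy.next prog t d L) l (Lazy.init Q p m)
        (fun L => (L.cnt t k : ℝ)) := by
  induction l using List.reverseRecOn with
  | nil => simp [evol, Config.init, Lazy.init]
  | append_singleton l u ih =>
    rw [evol_concat, evol_concat]
    simp only [Config.time_next, Lazy.cnt_next, Fintype.expect_const, Nat.cast_add, evol_add,
      mul_add]
    refine add_le_add ih ?_
    -- The cost of the last step depends on the open draws of the contending threads. It is
    -- therefore averaged over the fillings of the lazy state before that step; whether thread `u`
    -- works on operation `k` is the same for all fillings.
    rw [evol_init]
    · rw [← evol_const_mul]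
      refine evol_le_of_invariant _ (I := Lazy.Inv) (fun u d L h => h.next prog u d) ?_ l
        Lazy.Inv.init
      intro L hL
      have e : ∀ δ, (L.fill δ).Works prog u t k ↔ L.base.Works prog u t k := fun δ => Iff.rfl
      simp only [e]
      split_ifs with hw
      · simpa using hL.expect_stepCost_le u hpm
      · simp
    · intro s s' h
      have hp : s.untimed.pos = s'.untimed.pos := congrArg Config.pos h
      change s.pos = s'.pos at hp
      simp only [Config.Works, hp, Config.stepCost_congr h]

/-- A bound for the expected number of further steps before the acquisition of a lock plus the
number of further steps after it. -/
noncomputable def Phase.potential {S : Type*} (B : ℝ) : Phase S α m → ℝ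
  | .start => B
  | .readFirst _ _ => B - 1
  | .readSecond _ _ _ => B - 2
  | .tryLock _ => B - 3
  | .access _ r _ _ => r + 2
  | .unlock _ _ => 1

/-- An operation that has not begun carries the full potential `B`, a completed one carries none. -/
noncomputable def Lazy.potential (B : ℝ) (t : Fin p) (k : ℕ) (L : Lazy Q p m) : ℝ :=
  if L.base.pos t < k then B else if L.base.pos t = k then (L.base.phase t).potential B else 0

theorem Lazy.potential_nonneg {B : ℝ} (hB : 4 ≤ B) (t : Fin p) (k : ℕ) (L : Lazy Q p m) :
    0 ≤ L.potential B t k := by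
  unfold Lazy.potential
  split_ifs
  · linarith
  · cases L.base.phase t <;> simp only [Phase.potential]
    case access => positivity
    all_goals linarith
  · exact le_rfl

theorem Phase.potential_fill {S : Type*} (B : ℝ) (mem : Fin m → WithTop α)
    (sel : Fin m × Fin m → Fin m) (d : Fin m × Fin m) (ph : Phase S α m) :
    (ph.fill mem sel d).potential B = ph.potential B := by
  cases ph <;> rfl

theorem Lazy.exec_of_ne (L : Lazy Q p m) {t u : Fin p} (h : t ≠ u) (op : Op α)
    (d : Fin m × Fin m) :
    (L.exec u op d).base.pos t = L.base.pos t ∧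
    (∀ B, ((L.exec u op d).base.phase t).potential B = (L.base.phase t).potential B) ∧
    (L.exec u op d).dur t = L.dur t := by
  have h3 : ∀ δ', (L.fill δ').phase u = (L.base.phase u).fill (L.mem u) (L.sel u) (δ' u) :=
    fun δ' => rfl
  have h4 : ∀ δ B, ((L.fill δ).phase t).potential B = (L.base.phase t).potential B :=
    fun δ B => Phase.potential_fill B _ _ _ _
  rcases hu : L.base.phase u with _ | ⟨i, j⟩ | ⟨i, j, x⟩ | i | ⟨i, _ | r, q, e⟩ | ⟨i, e⟩
  · cases op <;> simp [exec, Config.exec, h3, hu, Phase.fill, Config.setPhase, h, h4] <;> rfl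
  case tryLock =>
    by_cases hl : L.base.locked (L.sel u d) = true
    · have hl' : (L.fill fun _ => d).locked (L.sel u d) = true := hl
      simp [exec, Config.exec, h3, hu, Phase.fill, Config.setPhase, h, h4, hl, hl']; rfl
    · have hl' : (L.fill fun _ => d).locked (L.sel u d) = false :=
        Bool.eq_false_iff.2 hl
      simp [exec, Config.exec, h3, hu, Phase.fill, Config.setPhase, h, h4, hl, hl']; rfl
  all_goals simp [exec, Config.exec, h3, hu, Phase.fill, Config.setPhase, h, h4]; rfl

/-- Each step adds one to `cnt`, which the potential has to pay for. Before an attempt and after an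
acquisition it drops by at least one per step. An attempt that succeeds with probability `u` needs
`1 + B - B * u ≤ B - 3`, that is `4 ≤ B * u`; this is where the hypothesis `hB'` comes from. -/
theorem Lazy.Inv.expect_potential_le [NeZero m] {L : Lazy Q p m} (h : L.Inv) (hpm : p ≤ m)
    {B : ℝ} (hB : 4 ≤ B) (hB' : 4 ≤ B * (1 - (p : ℝ) / m) ^ 2) (prog : Fin p → List (Op α))
    (u t : Fin p) (k : ℕ) :
    𝔼 d, ((L.next prog u d).cnt t k + (L.next prog u d).potential B t k -
        (L.next prog u d).dur t k : ℝ) ≤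
      L.cnt t k + L.potential B t k - L.dur t k := by
  simp only [Lazy.cnt_next]
  by_cases hw : L.base.Works prog u t k
  · obtain ⟨rfl, hk, hlen⟩ := id hw
    subst hk
    simp only [if_pos hw, Lazy.next]
    rw [List.getElem?_eq_getElem hlen]
    generalize (prog u)[L.base.pos u] = op
    simp only
    have h3 : ∀ δ', (L.fill δ').phase u = (L.base.phase u).fill (L.mem u) (L.sel u) (δ' u) :=
      fun δ' => rfl
    have hpos : ∀ δ, (L.fill δ).pos u = L.base.pos u := fun _ => rfl
    have const : ∀ x : ℝ, (∀ d, (((L.cnt u (L.base.pos u) + 1 : ℕ) : ℝ) +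
        (L.exec u op d).potential B u (L.base.pos u) -
        ((L.exec u op d).dur u (L.base.pos u) : ℝ)) ≤ x) →
        𝔼 d, (((L.cnt u (L.base.pos u) + 1 : ℕ) : ℝ) +
        (L.exec u op d).potential B u (L.base.pos u) -
        ((L.exec u op d).dur u (L.base.pos u) : ℝ)) ≤ x := fun x hx =>
      (Finset.expect_le_expect fun d _ => hx d).trans (Fintype.expect_const x).le
    rcases hu : L.base.phase u with _ | ⟨i, j⟩ | ⟨i, j, x⟩ | i | ⟨i, _ | r, q, e⟩ | ⟨i, e⟩
    case tryLock =>
      have hd : L.dur u (L.base.pos u) = 0 := h.dur u _ (Or.inr ⟨rfl, by rw [hu]; rfl⟩)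
      -- A failure restores the potential `B`. After a success the potential of the phase `access`
      -- equals the new value of `dur`, so the two cancel.
      have hstep : ∀ d, (((L.cnt u (L.base.pos u) + 1 : ℕ) : ℝ) +
        (L.exec u op d).potential B u (L.base.pos u) -
        ((L.exec u op d).dur u (L.base.pos u) : ℝ)) = (L.cnt u (L.base.pos u) + 1 + B) +
          (-B) * (if L.base.locked (L.sel u d) = true then (0 : ℝ) else 1) := by
        intro d
        by_cases hl : L.base.locked (L.sel u d) = true
        · have hl' : (L.fill fun _ => d).locked (L.sel u d) = true := hl
          simp [Lazy.exec, Config.exec, h3, hu, Phase.fill, Config.setPhase, hl, hl',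
            Lazy.potential, hpos, hd, Phase.potential]
        · have hl' : (L.fill fun _ => d).locked (L.sel u d) = false :=
        Bool.eq_false_iff.2 hl
          have hq : (L.fill fun _ => d).queue = L.base.queue := rfl
          simp [Lazy.exec, Config.exec, h3, hu, Phase.fill, Config.setPhase, hl, hl',
            Lazy.potential, hpos, Phase.potential, hq]
      simp only [hstep, Finset.expect_add_distrib, Fintype.expect_const, ← Finset.mul_expect]
      have h5 := h.le_expect_unlocked u hpm
      have h6 : B * (1 - (p : ℝ) / m) ^ 2 ≤
          B * 𝔼 d, (if L.base.locked (L.sel u d) = true then (0 : ℝ) else 1) :=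
        mul_le_mul_of_nonneg_left h5 (by linarith)
      simp only [Lazy.potential, lt_irrefl, if_false, if_true, hu, Phase.potential, hd]
      push_cast
      linarith
    · apply const
      intro d
      cases op <;>
      · simp [Lazy.exec, Config.exec, h3, hu, Phase.fill, Config.setPhase,
            Lazy.potential, hpos, Phase.potential]
        try linarith
    all_goals
      apply const
      intro d
      simp [Lazy.exec, Config.exec, h3, hu, Phase.fill, Config.setPhase,
            Lazy.potential, hpos, Phase.potential]
      try linarith
  · simp only [if_neg hw, add_zero]
    have : ∀ d, (L.cnt t k + (L.next prog u d).potential B t k - (L.next prog u d).dur t k : ℝ) ≤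
        L.cnt t k + L.potential B t k - L.dur t k := by
      intro d
      unfold Lazy.next
      cases hop : (prog u)[L.base.pos u]? with
      | none => exact le_rfl
      | some op =>
        have hlt := (List.getElem?_eq_some_iff.1 hop).1
        simp only
        by_cases hut : t = u
        · subst hut
          have hk : L.base.pos t ≠ k := fun hk => hw ⟨rfl, hk, hk ▸ hlt⟩
          rcases L.exec_cases t op d with ⟨e1, e2, e3, e4, e5, e6⟩ |
            ⟨i, hi, h0, hl, e1, e2, e3, e4, e5, e6⟩ | ⟨i, h0, e1, e2, e3, e4, e5, e6⟩
          · simp [Lazy.potential, e3, e4, hk]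
          · simp [Lazy.potential, e3, e4, hk, Function.update_of_ne (Ne.symm hk)]
          · simp only [Lazy.potential, e3, e4, hk, Function.update_self, if_false]
            by_cases hlt' : L.base.pos t < k
            · by_cases hk' : L.base.pos t + 1 = k
              -- Releasing the lock of the preceding operation starts operation `k` in phase
              -- `start`, whose potential is the `B` it had before.
              · have : ((L.exec t op d).base.phase t).potential B ≤ B := by
                  have h3 : ∀ δ', (L.fill δ').phase t =
                    (L.base.phase t).fill (L.mem t) (L.sel t) (δ' t) := fun δ' => rfl
                  have hh := e1 t
                  have hp := congrFun e3 t
                  rcases hu : L.base.phase t with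
                    _ | ⟨i, j⟩ | ⟨i, j, x⟩ | i | ⟨i, _ | r, q, e⟩ | ⟨i, e⟩
                  case unlock =>
                    simp [Lazy.exec, Config.exec, h3, hu, Phase.fill, Config.setPhase,
                      Phase.potential]
                  all_goals
                    exfalso
                    first
                    | (rw [hu] at h0; simp [Phase.held] at h0; done)
                    | (simp [Lazy.exec, Config.exec, h3, hu, Phase.fill, Config.setPhase,
                        Phase.held] at hh)
                simp only [hlt', if_true, hk', lt_irrefl, if_false]
                linarith
              · have : L.base.pos t + 1 < k := by omega
                simp [this, hlt']
            · have h1 : ¬ L.base.pos t + 1 < k := by omega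
              have h2 : L.base.pos t + 1 ≠ k := by omega
              simp [h1, h2, hlt']
        · obtain ⟨e1, e2, e3⟩ := L.exec_of_ne hut op d
          simp only [Lazy.potential, e1, e2, e3, le_refl]
    exact (Finset.expect_le_expect fun d _ => this d).trans (Fintype.expect_const _).le

/-- The expected number of steps of an operation exceeds that of its steps after the acquisition of
the lock by at most a constant. -/
theorem evol_cnt_le [NeZero m] (hpm : p ≤ m) {B : ℝ} (hB : 4 ≤ B)
    (hB' : 4 ≤ B * (1 - (p : ℝ) / m) ^ 2) (prog : Fin p → List (Op α)) (l : List (Fin p))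
    (t : Fin p) (k : ℕ) :
    evol (fun t d L => Lazy.next prog t d L) l (Lazy.init Q p m) (fun L => (L.cnt t k : ℝ)) ≤
      B + evol (fun t d L => Lazy.next prog t d L) l (Lazy.init Q p m)
        (fun L => (L.dur t k : ℝ)) := by
  have h1 := evol_le_of_supermartingale (fun t d L => Lazy.next prog t d L) (I := Lazy.Inv)
    (fun u d L h => h.next prog u d)
    (f := fun L : Lazy Q p m => (L.cnt t k + L.potential B t k - L.dur t k : ℝ))
    (fun u L h => h.expect_potential_le hpm hB hB' prog u t k) l Lazy.Inv.init
  have h2 : ((Lazy.init Q p m).cnt t k + (Lazy.init Q p m).potential B t k -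
      (Lazy.init Q p m).dur t k : ℝ) = B := by
    rcases Nat.eq_zero_or_pos k with rfl | hk
    · simp [Lazy.init, Lazy.potential, Config.init, Phase.potential]
    · simp [Lazy.init, Lazy.potential, Config.init, hk]
  rw [h2] at h1
  have h3 := evol_le_of_invariant (fun t d L => Lazy.next prog t d L) (I := fun _ => True)
    (fun _ _ _ _ => trivial)
    (f := fun L : Lazy Q p m => (L.cnt t k : ℝ))
    (g := fun L : Lazy Q p m => (L.cnt t k + L.potential B t k - L.dur t k : ℝ) + L.dur t k)
    (fun L _ => by have := L.potential_nonneg hB t k; linarith) l (s := Lazy.init Q p m) trivial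
  rw [evol_add] at h3
  linarith

theorem evol_time_le_dur [NeZero m] (hpm : p ≤ m) {B : ℝ} (hB : 4 ≤ B)
    (hB' : 4 ≤ B * (1 - (p : ℝ) / m) ^ 2) (prog : Fin p → List (Op α)) (l : List (Fin p))
    (t : Fin p) (k : ℕ) :
    evol (fun t (d : Fin m × Fin m) s => Config.next prog t d s) l (Config.init Q p m)
        (fun s => (s.time t k : ℝ)) ≤
      3 * B + 3 * evol (fun t d L => Lazy.next prog t d L) l (Lazy.init Q p m)
        (fun L => (L.dur t k : ℝ)) := by
  have h1 := evol_time_le (Q := Q) hpm prog l t k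
  have h2 := evol_cnt_le (Q := Q) hpm hB hB' prog l t k
  linarith

end MultiQueue

/-! ### Worst-case operation sequences for binary heaps and van Emde Boas trees -/

namespace MultiQueue

open scoped BigOperators

/-- A bound for the expected number of steps before the acquisition of a lock. -/
noncomputable def attemptBound (c : ℝ) : ℝ := 4 / (1 - 1 / c) ^ 2

theorem four_le_attemptBound {c : ℝ} (hc : 1 < c) : 4 ≤ attemptBound c := by
  have h1 : 0 < 1 / c := by positivity
  have h2 : 1 / c < 1 := by rw [div_lt_one] <;> linarith
  unfold attemptBound
  rw [le_div_iff₀ (by have : 0 < 1 - 1 / c := by linarith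
                      positivity)]
  nlinarith

theorem four_le_attemptBound_mul {c : ℝ} (hc : 1 < c) {p m : ℕ} [NeZero m]
    (hm : (m : ℝ) = c * p) : 4 ≤ attemptBound c * (1 - (p : ℝ) / m) ^ 2 := by
  have hm0 : (m : ℝ) ≠ 0 := by exact_mod_cast NeZero.ne m
  have hp : (p : ℝ) ≠ 0 := by
    rintro hp
    rw [hp, mul_zero] at hm
    exact hm0 hm
  have h2 : 1 / c < 1 := by rw [div_lt_one] <;> linarith
  have h3 : (p : ℝ) / m = 1 / c := by
    rw [hm]
    field_simp
  have h4 : (1 - 1 / c) ^ 2 ≠ 0 := by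
    have : 0 < 1 - 1 / c := by linarith
    positivity
  unfold attemptBound
  rw [h3, div_mul_cancel₀ _ h4]

theorem le_of_eq_mul {c : ℝ} (hc : 1 < c) {p m : ℕ} (hm : (m : ℝ) = c * p) : p ≤ m := by
  have : (p : ℝ) ≤ m := by
    rw [hm]
    have : (0 : ℝ) ≤ p := Nat.cast_nonneg p
    nlinarith
  exact_mod_cast this

theorem expect_natCast_run {α : Type*} [LinearOrder α] {p m : ℕ} [NeZero m] (Q : SeqPQ α)
    (prog : Fin p → List (Op α)) (sched : List (Fin p)) (f : Config Q p m → ℕ) :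
    expect (run (m := m) Q prog sched) (fun s => (f s : ℝ≥0∞)) =
      ENNReal.ofReal (evol (fun t (d : Fin m × Fin m) s => Config.next prog t d s) sched
        (Config.init Q p m) (fun s => (f s : ℝ))) := by
  rw [← expect_run Q prog sched (fun s => (f s : ℝ)) fun s => Nat.cast_nonneg _]
  simp only [ENNReal.ofReal_natCast]

theorem one_le_logb_add_two (n : ℕ) : 1 ≤ Real.logb 2 ((n : ℝ) + 2) := by
  have hn : (0 : ℝ) ≤ n := Nat.cast_nonneg n
  rw [Real.le_logb_iff_rpow_le (by norm_num) (by linarith)]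
  simp

/-- The additive `4` (two units in the heap bound, two in `dur`) is absorbed because the logarithm
is at least `1`; the local size is at most the total one. -/
theorem Lazy.Inv.dur_binaryHeap_le {α : Type*} [LinearOrder α] {p m : ℕ}
    {L : Lazy (binaryHeap α) p m} (h : L.Inv) (t : Fin p) (k : ℕ) :
    (L.dur t k : ℝ) ≤ 5 * Real.logb 2 (L.base.sizeAtLock t k + 2) := by
  have h1 := one_le_logb_add_two (L.base.sizeAtLock t k)
  rcases h.dur_le t k with h0 | ⟨op, q, h2, h3⟩
  · rw [h0, Nat.cast_zero]
    linarith
  · have h4 := runOp_binaryHeap_time_le op q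
    have h5 : (Nat.log 2 ((binaryHeap α).size q + 1) : ℝ) ≤
        Real.logb 2 (L.base.sizeAtLock t k + 2) := by
      refine (Real.natLog_le_logb _ _).trans ?_
      apply Real.logb_le_logb_of_le (by norm_num)
      · positivity
      · have : ((binaryHeap α).size q : ℝ) ≤ L.base.sizeAtLock t k := by exact_mod_cast h3
        push_cast
        linarith
    have h6 : (L.dur t k : ℝ) ≤ Nat.log 2 ((binaryHeap α).size q + 1) + 4 := by
      rw [h2]
      have : ((runOp (binaryHeap α) op q).2.2 : ℝ) ≤
          ((Nat.log 2 ((binaryHeap α).size q + 1) + 2 : ℕ) : ℝ) := by exact_mod_cast h4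
      push_cast at this ⊢
      linarith
    linarith

theorem binaryHeap_worst_case {c : ℝ} (hc : 1 < c) {α : Type*} [LinearOrder α] {p m : ℕ}
    [NeZero m] (hm : (m : ℝ) = c * p) (prog : Fin p → List (Op α)) (sched : List (Fin p))
    (t : Fin p) (k : ℕ) :
    expect (run (m := m) (binaryHeap α) prog sched) (fun s => (s.time t k : ℝ≥0∞)) ≤
      ((3 * attemptBound c + 15).toNNReal : ℝ≥0∞) *
        expect (run (m := m) (binaryHeap α) prog sched)
          (fun s => ENNReal.ofReal (Real.logb 2 (s.sizeAtLock t k + 2))) := by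
  have hB := four_le_attemptBound hc
  have hlog : ∀ s : Config (binaryHeap α) p m, 0 ≤ Real.logb 2 (s.sizeAtLock t k + 2) :=
    fun s => zero_le_one.trans (one_le_logb_add_two _)
  rw [expect_natCast_run _ _ _ fun s => s.time t k, expect_run _ _ _ _ hlog,
    ← ENNReal.ofReal.eq_1, ← ENNReal.ofReal_mul (by linarith)]
  apply ENNReal.ofReal_le_ofReal
  refine (evol_time_le_dur (le_of_eq_mul hc hm) hB (four_le_attemptBound_mul hc hm) prog sched t
    k).trans ?_
  rw [evol_init]
  · have e : ∀ (L : Lazy (binaryHeap α) p m) (δ : Fin p → Fin m × Fin m),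
        (L.fill δ).sizeAtLock = L.base.sizeAtLock := fun _ _ => rfl
    simp only [e, Fintype.expect_const]
    set E := evol (fun t d L => Lazy.next prog t d L) sched (Lazy.init (binaryHeap α) p m)
      (fun L => Real.logb 2 (L.base.sizeAtLock t k + 2))
    have h1 : evol (fun t d L => Lazy.next prog t d L) sched (Lazy.init (binaryHeap α) p m)
        (fun L => (L.dur t k : ℝ)) ≤ 5 * E := by
      rw [← evol_const_mul]
      exact evol_le_of_invariant _ (I := Lazy.Inv) (fun u d L h => h.next prog u d)
        (fun L hL => hL.dur_binaryHeap_le t k) sched Lazy.Inv.init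
    -- Turns the additive constant `3 * attemptBound c` into a factor.
    have h2 : 1 ≤ E := by
      rw [← evol_const (fun t d L => Lazy.next prog t d L) sched
        (Lazy.init (binaryHeap α) p m) 1]
      exact evol_le_of_invariant _ (I := fun _ => True) (fun _ _ _ _ => trivial)
        (fun L _ => one_le_logb_add_two _) sched trivial
    nlinarith
  · intro s s' h
    have hp : s.untimed.sizeAtLock = s'.untimed.sizeAtLock := congrArg Config.sizeAtLock h
    change s.sizeAtLock = s'.sizeAtLock at hp
    rw [hp]

theorem vanEmdeBoas_worst_case {c : ℝ} (hc : 1 < c) (U : ℕ) {p m : ℕ}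
    [NeZero m] (hm : (m : ℝ) = c * p) (prog : Fin p → List (Op ℕ)) (sched : List (Fin p))
    (t : Fin p) (k : ℕ) :
    expect (run (m := m) (vanEmdeBoas U) prog sched) (fun s => (s.time t k : ℝ≥0∞)) ≤
      ((3 * attemptBound c + 30).toNNReal : ℝ≥0∞) *
        ENNReal.ofReal (Real.logb 2 (Real.logb 2 ((U : ℝ) + 4))) := by
  have hB := four_le_attemptBound hc
  rw [expect_natCast_run _ _ _ fun s => s.time t k, ← ENNReal.ofReal.eq_1,
    ← ENNReal.ofReal_mul (by linarith)]
  apply ENNReal.ofReal_le_ofReal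
  refine (evol_time_le_dur (le_of_eq_mul hc hm) hB (four_le_attemptBound_mul hc hm) prog sched t
    k).trans ?_
  have h0 := VEB.one_le_logb_logb U
  have h1 := VEB.level_le U
  set E := Real.logb 2 (Real.logb 2 ((U : ℝ) + 4))
  -- Here `dur` is at most `2 * level U + 4`, with `level U ≤ 3 * E` and `1 ≤ E`.
  have h2 : evol (fun t d L => Lazy.next prog t d L) sched (Lazy.init (vanEmdeBoas U) p m)
      (fun L => (L.dur t k : ℝ)) ≤ 10 * E := by
    rw [← evol_const (fun t d L => Lazy.next prog t d L) sched
      (Lazy.init (vanEmdeBoas U) p m) (10 * E)]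
    refine evol_le_of_invariant _ (I := Lazy.Inv) (fun u d L h => h.next prog u d)
      (fun L hL => ?_) sched Lazy.Inv.init
    rcases hL.dur_le t k with h3 | ⟨op, q, h3, -⟩
    · rw [h3, Nat.cast_zero]
      linarith
    · rw [h3]
      have h4 : ((runOp (vanEmdeBoas U) op q).2.2 : ℝ) ≤ ((2 * VEB.level U + 2 : ℕ) : ℝ) := by
        exact_mod_cast runOp_vanEmdeBoas_time_le U op q
      push_cast at h4 ⊢
      linarith
  nlinarith

end MultiQueue

namespace MultiQueue

open scoped BigOperators

/-! ### Insertions into a binary heap -/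

namespace BinHeap

variable {α : Type*} [LinearOrder α]

theorem cell_swap (h : BinHeap α) (i j a : ℕ) :
    (h.swap i j).cell a = if a = j then h.cell i else if a = i then h.cell j else h.cell a := by
  simp only [swap, set, Function.update_apply]

/-- The heap property, except that the element of cell `i` may be too small for its place. -/
def HeapAbove (h : BinHeap α) (i : ℕ) : Prop :=
  (∀ a, 2 ≤ a → a ≠ i → h.cell (a / 2) ≤ h.cell a) ∧
    ∀ a, a / 2 = i → 2 ≤ i → h.cell (i / 2) ≤ h.cell a

theorem size_siftUp (i : ℕ) : ∀ h : BinHeap α, (h.siftUp i).1.size = h.size := by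
  induction i using Nat.strong_induction_on with
  | _ i ih =>
    intro h
    rw [siftUp]
    split_ifs with hc
    · exact ih (i / 2) (by omega) _
    · rfl

theorem HeapAbove.swap {h : BinHeap α} {i : ℕ} (hh : h.HeapAbove i) (hi : 1 < i)
    (hlt : h.cell i < h.cell (i / 2)) : (h.swap i (i / 2)).HeapAbove (i / 2) := by
  refine ⟨fun a ha hai => ?_, fun a ha hi2 => ?_⟩
  · rw [cell_swap, cell_swap, if_neg hai]
    by_cases h1 : a = i
    · subst h1
      simp only [if_true]
      exact hlt.le
    · rw [if_neg h1]
      by_cases h2 : a / 2 = i / 2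
      · rw [if_pos h2]
        exact hlt.le.trans (h2 ▸ hh.1 a ha h1)
      · rw [if_neg h2]
        split_ifs with h3
        · exact hh.2 a h3 (by omega)
        · exact hh.1 a ha h1
  · have h4 : h.cell (i / 2 / 2) ≤ h.cell (i / 2) := hh.1 (i / 2) hi2 (by omega)
    rw [cell_swap, cell_swap, if_neg (by omega), if_neg (by omega), if_neg (by omega : a ≠ i / 2)]
    split_ifs with h3
    · exact h4
    · exact h4.trans (ha ▸ hh.1 a (by omega) h3)

theorem HeapAbove.le_ancestor {h : BinHeap α} {i : ℕ} (hh : h.HeapAbove i) {b : ℕ} (hb : b < i)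
    (k : ℕ) (hk : 1 ≤ b / 2 ^ k) : h.cell (b / 2 ^ k) ≤ h.cell b := by
  induction k with
  | zero => simp
  | succ k ih =>
    rw [pow_succ, ← Nat.div_div_eq_div_mul] at hk ⊢
    have h1 : b / 2 ^ k ≤ b := Nat.div_le_self _ _
    exact (hh.1 _ (by omega) (by omega)).trans (ih (by omega))

/-- Sifting up moves the larger elements on the path to the root down by one place. So a cell on the
path ends with the sifted element, with the old element of its parent, or with something that was
already no larger than the sifted element. The fourth part records this and is what the analysis of
random insertions uses. -/
theorem siftUp_spec (i : ℕ) : ∀ h : BinHeap α, 1 ≤ i → h.HeapAbove i →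
    (∀ a, 2 ≤ a → (h.siftUp i).1.cell (a / 2) ≤ (h.siftUp i).1.cell a) ∧
    (∀ a, a ≠ i → (h.siftUp i).1.cell a ≤ h.cell a) ∧
    ((h.siftUp i).1.cell i ≤ h.cell i ∨ (2 ≤ i ∧ (h.siftUp i).1.cell i ≤ h.cell (i / 2))) ∧
    (∀ k, 1 ≤ i / 2 ^ k → (h.siftUp i).1.cell (i / 2 ^ k) ≤ h.cell i ∨
      (2 ≤ i / 2 ^ k ∧ (h.siftUp i).1.cell (i / 2 ^ k) ≤ h.cell (i / 2 ^ k / 2))) ∧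
    (∀ a, i < a → (h.siftUp i).1.cell a = h.cell a) := by
  induction i using Nat.strong_induction_on with
  | _ i ih =>
    intro h hi hh
    by_cases hc : 1 < i ∧ h.cell i < h.cell (i / 2)
    · obtain ⟨i1, i2, i3, i4, i5⟩ := ih (i / 2) (by omega) (h.swap i (i / 2)) (by omega)
        (hh.swap hc.1 hc.2)
      have hr : (h.siftUp i).1 = ((h.swap i (i / 2)).siftUp (i / 2)).1 := by
        rw [siftUp, if_pos hc]
      rw [hr]
      have hri : ((h.swap i (i / 2)).siftUp (i / 2)).1.cell i ≤ h.cell (i / 2) := by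
        refine (i2 i (by omega)).trans ?_
        rw [cell_swap, if_neg (by omega), if_pos rfl]
      refine ⟨i1, fun a ha => ?_, Or.inr ⟨by omega, hri⟩, fun k hk => ?_, fun a ha => ?_⟩
      · by_cases ha2 : a = i / 2
        · subst ha2
          rcases i3 with h3 | ⟨h3, h4⟩
          · rw [cell_swap, if_pos rfl] at h3
            exact h3.trans hc.2.le
          · rw [cell_swap, if_neg (by omega), if_neg (by omega)] at h4
            exact h4.trans (hh.1 _ h3 (by omega))
        · refine (i2 a ha2).trans ?_
          rw [cell_swap, if_neg ha2, if_neg ha]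
      · cases k with
        | zero => simp only [pow_zero, Nat.div_one]; exact Or.inr ⟨by omega, hri⟩
        | succ k =>
          have e : i / 2 ^ (k + 1) = i / 2 / 2 ^ k := by
            rw [pow_succ', Nat.div_div_eq_div_mul]
          rw [e] at hk ⊢
          have hle : i / 2 / 2 ^ k ≤ i / 2 := Nat.div_le_self _ _
          rcases i4 k hk with h3 | ⟨h3, h4⟩
          · rw [cell_swap, if_pos rfl] at h3
            exact Or.inl h3
          · rw [cell_swap, if_neg (by omega), if_neg (by omega)] at h4
            exact Or.inr ⟨h3, h4⟩
      · rw [i5 a (by omega), cell_swap, if_neg (by omega), if_neg (by omega)]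
    · have hr : (h.siftUp i).1 = h := by rw [siftUp, if_neg hc]
      have hi' : 2 ≤ i → h.cell (i / 2) ≤ h.cell i := fun h2 =>
        not_lt.1 fun h3 => hc ⟨h2, h3⟩
      rw [hr]
      refine ⟨fun a ha => ?_, fun a _ => le_rfl, Or.inl le_rfl, fun k hk => ?_, fun _ _ => rfl⟩
      · by_cases h1 : a = i
        · subst h1; exact hi' ha
        · exact hh.1 a ha h1
      · left
        cases k with
        | zero => simp
        | succ k =>
          have e : i / 2 ^ (k + 1) = i / 2 / 2 ^ k := by
            rw [pow_succ', Nat.div_div_eq_div_mul]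
          rw [e] at hk ⊢
          have h2 : i / 2 / 2 ^ k ≤ i / 2 := Nat.div_le_self _ _
          exact (hh.le_ancestor (by omega) k hk).trans (hi' (by omega))

/-- The number of iterations is at most the number of ancestors with larger elements. -/
theorem siftUp_time_le_sum (i : ℕ) : ∀ h : BinHeap α, (h.siftUp i).2 ≤
    1 + ∑ j ∈ Finset.range (Nat.log 2 i), if h.cell i < h.cell (i / 2 ^ (j + 1)) then 1 else 0 := by
  induction i using Nat.strong_induction_on with
  | _ i ih =>
    intro h
    rw [siftUp]
    split_ifs with hc
    · have hl : Nat.log 2 i = Nat.log 2 (i / 2) + 1 :=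
        Nat.log_of_one_lt_of_le (by norm_num) (by omega)
      rw [hl, Finset.sum_range_succ']
      simp only [zero_add, pow_one, if_pos hc.2]
      have h1 := ih (i / 2) (by omega) (h.swap i (i / 2))
      have h2 : ∀ j ∈ Finset.range (Nat.log 2 (i / 2)),
          (if (h.swap i (i / 2)).cell (i / 2) < (h.swap i (i / 2)).cell (i / 2 / 2 ^ (j + 1))
            then 1 else 0) =
          if h.cell i < h.cell (i / 2 ^ (j + 1 + 1)) then 1 else 0 := by
        intro j hj
        have e : i / 2 ^ (j + 1 + 1) = i / 2 / 2 ^ (j + 1) := by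
          rw [pow_succ' 2 (j + 1), Nat.div_div_eq_div_mul]
        have h3 : i / 2 / 2 ^ (j + 1) < i / 2 := Nat.div_lt_self (by omega) (by simp)
        have h4 : i / 2 < i := by omega
        rw [e, cell_swap, cell_swap, if_pos rfl, if_neg h3.ne, if_neg (h3.trans h4).ne]
      rw [Finset.sum_congr rfl h2] at h1
      omega
    · simp

/-- The heap property. -/
structure WF (h : BinHeap α) : Prop where
  le : ∀ a, 2 ≤ a → h.cell (a / 2) ≤ h.cell a
  top : ∀ a, h.size < a → h.cell a = ⊤

theorem WF.empty : (BinHeap.empty : BinHeap α).WF := ⟨fun _ _ => le_rfl, fun _ _ => rfl⟩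

/-- The heap to which `x` has been appended but not sifted up. -/
def push (x : α) (h : BinHeap α) : BinHeap α :=
  { h.set (h.size + 1) x with size := h.size + 1 }

theorem insert_eq_push (x : α) (h : BinHeap α) :
    h.insert x = (((h.push x).siftUp (h.size + 1)).1, ((h.push x).siftUp (h.size + 1)).2 + 1) := rfl

theorem cell_push (x : α) (h : BinHeap α) (a : ℕ) :
    (h.push x).cell a = if a = h.size + 1 then (x : WithTop α) else h.cell a := by
  simp only [push, set, Function.update_apply]

theorem size_insert (x : α) (h : BinHeap α) : (h.insert x).1.size = h.size + 1 := by
  rw [insert_eq_push, size_siftUp]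
  rfl

theorem WF.heapAbove_push {h : BinHeap α} (hh : h.WF) (x : α) :
    (h.push x).HeapAbove (h.size + 1) := by
  refine ⟨fun a ha hai => ?_, fun a ha hi => ?_⟩
  · rw [cell_push, cell_push, if_neg hai]
    split_ifs with h1
    · rw [hh.top a (by omega)]
      exact le_top
    · exact hh.le a ha
  · rw [cell_push, cell_push, if_neg (by omega), if_neg (by omega), hh.top a (by omega)]
    exact le_top

theorem WF.insert {h : BinHeap α} (hh : h.WF) (x : α) : (h.insert x).1.WF := by
  obtain ⟨i1, -, -, -, i5⟩ := siftUp_spec _ _ (by omega) (hh.heapAbove_push x)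
  refine ⟨i1, fun a ha => ?_⟩
  rw [size_insert] at ha
  rw [insert_eq_push]
  simp only
  rw [i5 a ha, cell_push, if_neg (by omega), hh.top a (by omega)]

theorem WF.cell_insert_le {h : BinHeap α} (hh : h.WF) (x : α) (a : ℕ) :
    (h.insert x).1.cell a ≤ h.cell a := by
  obtain ⟨-, i2, -, -, -⟩ := siftUp_spec _ _ (by omega) (hh.heapAbove_push x)
  by_cases ha : a = h.size + 1
  · rw [hh.top a (by omega)]
    exact le_top
  · refine (i2 a ha).trans ?_
    rw [cell_push, if_neg ha]

/-- If the parent of a cell on the path to the root has an element of at most `v`, then after the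
insertion of an element of at most `v` so has the cell. -/
theorem WF.cell_insert_le_of_le {h : BinHeap α} (hh : h.WF) {x v : α} (hx : x ≤ v) (k : ℕ)
    (hk : 1 ≤ (h.size + 1) / 2 ^ k)
    (hp : 2 ≤ (h.size + 1) / 2 ^ k → h.cell ((h.size + 1) / 2 ^ k / 2) ≤ v) :
    (h.insert x).1.cell ((h.size + 1) / 2 ^ k) ≤ v := by
  obtain ⟨-, -, -, i4, -⟩ := siftUp_spec _ _ (by omega) (hh.heapAbove_push x)
  have hx' : (x : WithTop α) ≤ v := WithTop.coe_le_coe.2 hx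
  rcases i4 k hk with h1 | ⟨h1, h2⟩
  · rw [cell_push, if_pos rfl] at h1
    exact h1.trans hx'
  · have h3 : (h.size + 1) / 2 ^ k ≤ h.size + 1 := Nat.div_le_self _ _
    rw [cell_push, if_neg (by omega)] at h2
    exact h2.trans (hp h1)

/-- The heap after the insertion of the elements of a list. -/
def ofList (l : List α) : BinHeap α := l.foldl (fun h x => (h.insert x).1) BinHeap.empty

theorem ofList_concat (l : List α) (x : α) : ofList (l ++ [x]) = ((ofList l).insert x).1 := by
  simp [ofList]

theorem size_ofList (l : List α) : (ofList l).size = l.length := by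
  induction l using List.reverseRecOn with
  | nil => rfl
  | append_singleton l x ih => rw [ofList_concat, size_insert, ih]; simp

theorem wf_ofList (l : List α) : (ofList l).WF := by
  induction l using List.reverseRecOn with
  | nil => exact WF.empty
  | append_singleton l x ih => rw [ofList_concat]; exact ih.insert x

theorem ofList_take_succ (l : List α) {n : ℕ} (hn : n < l.length) :
    ofList (l.take (n + 1)) = ((ofList (l.take n)).insert l[n]).1 := by
  rw [← List.take_concat_get' l n hn, ofList_concat]

/-- This includes cells that are not yet in use, since these contain `⊤`. -/
theorem cell_ofList_take_anti (l : List α) (a : ℕ) :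
    Antitone fun n => (ofList (l.take n)).cell a := by
  refine antitone_nat_of_succ_le fun n => ?_
  by_cases hn : n < l.length
  · rw [ofList_take_succ l hn]
    exact (wf_ofList _).cell_insert_le _ a
  · rw [List.take_of_length_le (by omega), List.take_of_length_le (by omega)]

/-- The positions `n` with `b * 2 ^ h ≤ n + 1 < (b + 1) * 2 ^ h`, that is, those of the elements
that were appended at the cells `h` levels below cell `b`. -/
def block (b h : ℕ) : Finset ℕ := Finset.Ico (b * 2 ^ h - 1) ((b + 1) * 2 ^ h - 1)

theorem card_block {b : ℕ} (hb : 1 ≤ b) (h : ℕ) : (block b h).card = 2 ^ h := by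
  have h1 : 1 ≤ 2 ^ h := Nat.one_le_two_pow
  have h2 : 1 * 2 ^ h ≤ b * 2 ^ h := Nat.mul_le_mul_right _ hb
  rw [block, Nat.card_Ico, add_mul]
  omega

theorem succ_div_of_mem_block {b h n : ℕ} (hb : 1 ≤ b) (hn : n ∈ block b h) :
    (n + 1) / 2 ^ h = b := by
  have h1 : 1 ≤ 2 ^ h := Nat.one_le_two_pow
  have h2 : 1 * 2 ^ h ≤ b * 2 ^ h := Nat.mul_le_mul_right _ hb
  rw [block, Finset.mem_Ico] at hn
  apply Nat.div_eq_of_lt_le <;> omega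

/-- The indices in `s` of elements of at most `v`. -/
def indicesLe (l : List α) (v : α) (s : Finset ℕ) : Finset ℕ :=
  s.filter fun n => ∃ x, l[n]? = some x ∧ x ≤ v

/-- If there are two elements of at most `v` in certain blocks then the cell contains one. -/
theorem cell_le_of_two_le_card (l : List α) (v : α) (b : ℕ) : ∀ h, 1 ≤ b →
    (∀ r, 1 ≤ b / 4 ^ r → 2 ≤ (indicesLe l v (block (b / 4 ^ r) (h + r))).card) →
    (ofList (l.take ((b + 1) * 2 ^ h - 1))).cell b ≤ v := by
  induction b using Nat.strong_induction_on with
  | _ b ih =>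
    intro h hb hr
    have h0 : 2 ≤ (indicesLe l v (block b h)).card := by simpa using hr 0 (by simpa using hb)
    obtain ⟨n₁, n₂, hn₁, hn₂, hlt⟩ : ∃ n₁ n₂, n₁ ∈ indicesLe l v (block b h) ∧
        n₂ ∈ indicesLe l v (block b h) ∧ n₁ < n₂ := by
      obtain ⟨x, hx, y, hy, hxy⟩ := Finset.one_lt_card.1 h0
      rcases lt_or_gt_of_ne hxy with h | h
      exacts [⟨x, y, hx, hy, h⟩, ⟨y, x, hy, hx, h⟩]
    rw [indicesLe, Finset.mem_filter] at hn₁ hn₂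
    obtain ⟨hb₁, x₁, hx₁, hv₁⟩ := hn₁
    obtain ⟨hb₂, x₂, hx₂, hv₂⟩ := hn₂
    obtain ⟨hl₁, rfl⟩ := List.getElem?_eq_some_iff.1 hx₁
    obtain ⟨hl₂, rfl⟩ := List.getElem?_eq_some_iff.1 hx₂
    have hs : ∀ n, n < l.length → (ofList (l.take n)).size + 1 = n + 1 := fun n hn => by
      rw [size_ofList, List.length_take, min_eq_left hn.le]
    have hd₁ := succ_div_of_mem_block hb hb₁
    have hd₂ := succ_div_of_mem_block hb hb₂
    have hpos : 1 ≤ 2 ^ h := Nat.one_le_two_pow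
    have hbh : b * 2 ^ h ≤ n₁ + 1 := by
      rw [block, Finset.mem_Ico] at hb₁; omega
    have hup : n₂ + 1 ≤ (b + 1) * 2 ^ h - 1 := by
      rw [block, Finset.mem_Ico] at hb₂; omega
    -- The hypotheses for `r + 1` are those for the grandparent `b / 4`, whose block starts one
    -- level further down. Each small insertion below `b` pushes a small element one level further:
    -- `n₁` from the grandparent to the parent, `n₂` from the parent to `b`. This is why two
    -- elements per block suffice.
    have hgrand : 4 ≤ b → (ofList (l.take n₁)).cell (b / 2 / 2) ≤ v := by
      intro hb4
      have h1 := ih (b / 4) (by omega) (h + 1) (by omega) fun r hr' => by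
        have e : b / 4 / 4 ^ r = b / 4 ^ (r + 1) := by rw [pow_succ', Nat.div_div_eq_div_mul]
        rw [e] at hr' ⊢
        have := hr (r + 1) hr'
        rwa [show h + 1 + r = h + (r + 1) by ring]
      rw [show b / 2 / 2 = b / 4 by omega]
      refine (cell_ofList_take_anti l (b / 4) ?_).trans h1
      -- The block of the grandparent ends before the block of `b` begins.
      have h2 : (b / 4 + 1) * 2 ^ (h + 1) ≤ b * 2 ^ h := by
        rw [pow_succ', ← mul_assoc]
        exact Nat.mul_le_mul_right _ (by omega)
      omega
    have hparent : 2 ≤ b → (ofList (l.take (n₁ + 1))).cell (b / 2) ≤ v := by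
      intro hb2
      have e : (n₁ + 1) / 2 ^ (h + 1) = b / 2 := by
        rw [pow_succ, ← Nat.div_div_eq_div_mul, hd₁]
      have := (wf_ofList (l.take n₁)).cell_insert_le_of_le hv₁ (h + 1)
      rw [hs n₁ hl₁, e, ← ofList_take_succ l hl₁] at this
      exact this (by omega) fun h4 => hgrand (by omega)
    have := (wf_ofList (l.take n₂)).cell_insert_le_of_le hv₂ h
    rw [hs n₂ hl₂, hd₂, ← ofList_take_succ l hl₂] at this
    refine (cell_ofList_take_anti l b hup).trans (this hb fun h2 => ?_)
    exact (cell_ofList_take_anti l (b / 2) hlt).trans (hparent h2)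

/-- An element that passes an ancestor is small compared to the elements of one of the blocks. -/
theorem exists_card_le_one_of_lt (l : List α) (v : α) (j : ℕ)
    (hj : 1 ≤ (l.length + 1) / 2 ^ (j + 1))
    (h : (v : WithTop α) < (ofList l).cell ((l.length + 1) / 2 ^ (j + 1))) :
    ∃ r, 1 ≤ (l.length + 1) / 2 ^ (j + 1) / 4 ^ r ∧
      (indicesLe l v (block ((l.length + 1) / 2 ^ (j + 1) / 4 ^ r) (j + r))).card ≤ 1 := by
  by_contra! hc
  refine absurd h (not_lt.2 ?_)
  have h1 := cell_le_of_two_le_card l v _ j hj fun r hr => hc r hr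
  refine le_trans ?_ h1
  set b := (l.length + 1) / 2 ^ (j + 1)
  have h2 : b * 2 ^ (j + 1) ≤ l.length + 1 := Nat.div_mul_le_self _ _
  -- The new cell is `j + 1` levels below `b`; taking the block only `j` levels below makes all of
  -- its positions precede the current insertion.
  have h3 : (b + 1) * 2 ^ j ≤ b * 2 ^ (j + 1) := by
    rw [pow_succ', ← mul_assoc]
    exact Nat.mul_le_mul_right _ (by omega)
  have := cell_ofList_take_anti l b (show (b + 1) * 2 ^ j - 1 ≤ l.length by omega)
  simpa using this

end BinHeap

end MultiQueue

namespace MultiQueue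

open scoped BigOperators

/-! ### Insertions in random order -/

section RandomOrder

variable {α : Type*} [LinearOrder α] {S : Type*} [Fintype S] [DecidableEq S] {N : ℕ}

/-- At most two elements of a finite family have at most one other element below them. -/
theorem card_filter_card_le_one_le {κ : Type*} [DecidableEq κ] (V : Finset κ) (f : κ → α) :
    (V.filter fun v => ((V.erase v).filter fun w => f w ≤ f v).card ≤ 1).card ≤ 2 := by
  set T := V.filter fun v => ((V.erase v).filter fun w => f w ≤ f v).card ≤ 1 with hT
  rcases T.eq_empty_or_nonempty with h0 | h0
  · simp [h0]
  -- All other members of `T` are below its largest one, which may have at most one element below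
  -- it.
  · obtain ⟨v, hv, hmax⟩ := T.exists_max_image f h0
    have h1 : T.erase v ⊆ (V.erase v).filter fun w => f w ≤ f v := by
      intro w hw
      rw [Finset.mem_erase] at hw
      rw [Finset.mem_filter, Finset.mem_erase]
      exact ⟨⟨hw.1, (Finset.mem_filter.1 hw.2).1⟩, hmax w hw.2⟩
    have h2 := (Finset.card_le_card h1).trans (Finset.mem_filter.1 hv).2
    rw [Finset.card_erase_of_mem hv] at h2
    omega

/-- In a random order, it is unlikely that an element has at most one element of a given set of
positions below it. -/
theorem expect_card_le_one_le [Nonempty (Fin N ≃ S)] (key : S → α) (s : Fin N)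
    (W : Finset (Fin N)) (hs : s ∉ W) :
    𝔼 e : Fin N ≃ S, (if (W.filter fun w => key (e w) ≤ key (e s)).card ≤ 1 then (1 : ℝ) else 0) ≤
      2 / (W.card + 1) := by
  set V := insert s W with hV
  have hVs : V.erase s = W := Finset.erase_insert hs
  have hcard : (V.card : ℝ) = W.card + 1 := by
    rw [hV, Finset.card_insert_of_notMem hs]
    push_cast
    rfl
  let P : Fin N → (Fin N ≃ S) → ℝ := fun v e =>
    if ((V.erase v).filter fun w => key (e w) ≤ key (e v)).card ≤ 1 then 1 else 0
  -- Exchangeability: swapping two positions of `V` preserves the uniform distribution. In every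
  -- order at most two positions of `V` have the property, so each has it with probability at most
  -- `2 / V.card`.
  have hP : ∀ v ∈ V, 𝔼 e, P v e = 𝔼 e, P s e := by
    intro v hv
    refine Fintype.expect_equiv ((Equiv.swap v s).equivCongr (Equiv.refl S)) _ _ fun e => ?_
    have hsw : ∀ w, Equiv.swap v s w ∈ V ↔ w ∈ V := by
      intro w
      have hsV : s ∈ V := Finset.mem_insert_self _ _
      rcases eq_or_ne w v with rfl | h1
      · simp [hv, hsV]
      · rcases eq_or_ne w s with rfl | h2
        · simp [hv, hsV]
        · rw [Equiv.swap_apply_of_ne_of_ne h1 h2]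
    have hc : ((V.erase v).filter fun w => key (e w) ≤ key (e v)).card =
        ((V.erase s).filter fun w => key (((Equiv.swap v s).equivCongr (Equiv.refl S)) e w) ≤
          key (((Equiv.swap v s).equivCongr (Equiv.refl S)) e s)).card := by
      refine Finset.card_bij (fun w _ => Equiv.swap v s w) ?_
        (fun _ _ _ _ h => (Equiv.swap v s).injective h) ?_
      · intro w hw
        simp only [Finset.mem_filter, Finset.mem_erase, Equiv.equivCongr_apply_apply,
          Equiv.refl_apply, Equiv.symm_swap, Equiv.swap_apply_self, Equiv.swap_apply_right] at hw ⊢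
        refine ⟨⟨?_, (hsw w).2 hw.1.2⟩, hw.2⟩
        intro h
        apply hw.1.1
        exact (Equiv.swap v s).injective (h.trans (Equiv.swap_apply_left v s).symm)
      · intro w hw
        refine ⟨Equiv.swap v s w, ?_, Equiv.swap_apply_self _ _ _⟩
        simp only [Finset.mem_filter, Finset.mem_erase, Equiv.equivCongr_apply_apply,
          Equiv.refl_apply, Equiv.symm_swap, Equiv.swap_apply_right] at hw ⊢
        refine ⟨⟨?_, (hsw w).2 hw.1.2⟩, hw.2⟩
        intro h
        apply hw.1.1
        exact (Equiv.swap v s).injective (h.trans (Equiv.swap_apply_right v s).symm)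
    simp only [P, hc]
  have hsum : ∑ v ∈ V, 𝔼 e, P v e ≤ 2 := by
    rw [← Finset.expect_sum_comm]
    refine (Finset.expect_le_expect fun e _ => ?_).trans (Fintype.expect_const (2 : ℝ)).le
    simp only [P]
    rw [Finset.sum_boole]
    exact_mod_cast card_filter_card_le_one_le V fun v => key (e v)
  rw [Finset.sum_congr rfl hP, Finset.sum_const, nsmul_eq_mul, hcard] at hsum
  rw [le_div_iff₀ (by positivity), mul_comm]
  simpa only [P, hVs] using hsum

/-- The number of steps of the last insertion from the acquisition of the lock on, if the elements
of `l` are inserted into a heap. -/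
def lastCost (l : List α) : ℕ :=
  if h : l = [] then 0 else ((BinHeap.ofList l.dropLast).insert (l.getLast h)).2 + 2

/-- The number of steps of all insertions from the acquisition of the lock on, if the elements of
`l` are inserted into a heap. -/
def totalCost (l : List α) : ℕ := ∑ n ∈ Finset.range l.length, lastCost (l.take (n + 1))

theorem lastCost_concat (l : List α) (x : α) :
    lastCost (l ++ [x]) = ((BinHeap.ofList l).insert x).2 + 2 := by
  simp [lastCost]

theorem totalCost_concat (l : List α) (x : α) :
    totalCost (l ++ [x]) = totalCost l + (((BinHeap.ofList l).insert x).2 + 2) := by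
  unfold totalCost
  rw [List.length_append, List.length_singleton, Finset.sum_range_succ]
  congr 1
  · refine Finset.sum_congr rfl fun n hn => ?_
    rw [Finset.mem_range] at hn
    rw [List.take_append_of_le_length (by omega)]
  · rw [List.take_of_length_le (by simp), lastCost_concat]

theorem lastCost_take_le (l : List α) {n : ℕ} (hn : n < l.length) :
    lastCost (l.take (n + 1)) ≤ n + 4 := by
  rw [← List.take_concat_get' l n hn, lastCost_concat]
  have h1 := BinHeap.insert_time_le l[n] (BinHeap.ofList (l.take n))
  rw [BinHeap.size_ofList, List.length_take, min_eq_left hn.le] at h1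
  have h2 : Nat.log 2 (n + 1) < n + 1 := Nat.log_lt_self 2 (by omega)
  omega

/-- A crude bound, used only when a queue is exceptionally long. -/
theorem totalCost_le (l : List α) : totalCost l ≤ 4 * l.length ^ 2 := by
  calc totalCost l ≤ ∑ n ∈ Finset.range l.length, 4 * l.length :=
        Finset.sum_le_sum fun n hn => by
          rw [Finset.mem_range] at hn
          have := lastCost_take_le l hn
          omega
    _ = 4 * l.length ^ 2 := by
        rw [Finset.sum_const, Finset.card_range, smul_eq_mul]
        ring

/-- Every ancestor passed while sifting up is charged to some `r` whose block has at most one small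
element. The `4` collects the final iteration of `siftUp`, one unit of `insert` and the two of
`lastCost`. The range of `r` suffices since `4 ^ r` cannot exceed the index of the ancestor. -/
theorem lastCost_concat_le (l : List α) (x : α) :
    lastCost (l ++ [x]) ≤ 4 + ∑ j ∈ Finset.range (Nat.log 2 (l.length + 1)),
      ∑ r ∈ Finset.range (l.length + 1),
        if 1 ≤ (l.length + 1) / 2 ^ (j + 1) / 4 ^ r ∧ (BinHeap.indicesLe l x
          (BinHeap.block ((l.length + 1) / 2 ^ (j + 1) / 4 ^ r) (j + r))).card ≤ 1
        then 1 else 0 := by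
  rw [lastCost_concat, BinHeap.insert_eq_push]
  have h1 := BinHeap.siftUp_time_le_sum (l.length + 1) ((BinHeap.ofList l).push x)
  have h2 : ∀ j ∈ Finset.range (Nat.log 2 (l.length + 1)),
      (if ((BinHeap.ofList l).push x).cell (l.length + 1) <
        ((BinHeap.ofList l).push x).cell ((l.length + 1) / 2 ^ (j + 1)) then 1 else 0) ≤
      ∑ r ∈ Finset.range (l.length + 1),
        if 1 ≤ (l.length + 1) / 2 ^ (j + 1) / 4 ^ r ∧ (BinHeap.indicesLe l x
          (BinHeap.block ((l.length + 1) / 2 ^ (j + 1) / 4 ^ r) (j + r))).card ≤ 1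
        then 1 else 0 := by
    intro j hj
    split_ifs with hlt
    · have h3 : (l.length + 1) / 2 ^ (j + 1) < l.length + 1 :=
        Nat.div_lt_self (by omega) (by simp)
      rw [BinHeap.cell_push, BinHeap.cell_push, BinHeap.size_ofList, if_pos rfl,
        if_neg h3.ne] at hlt
      have hj' : 1 ≤ (l.length + 1) / 2 ^ (j + 1) := by
        rw [Finset.mem_range] at hj
        rw [Nat.le_div_iff_mul_le (by positivity), one_mul]
        exact Nat.pow_le_of_le_log (by omega) hj
      obtain ⟨r, hr1, hr2⟩ := BinHeap.exists_card_le_one_of_lt l x j hj' hlt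
      have hr : r < l.length + 1 := by
        have h4 : 4 ^ r ≤ (l.length + 1) / 2 ^ (j + 1) := by
          rw [Nat.le_div_iff_mul_le (by positivity), one_mul] at hr1
          exact hr1
        have h5 : r < 4 ^ r := Nat.lt_pow_self (by norm_num)
        exact h5.trans_le (h4.trans h3.le)
      refine le_trans ?_ (Finset.single_le_sum (fun _ _ => Nat.zero_le _) (Finset.mem_range.2 hr))
      rw [if_pos ⟨hr1, hr2⟩]
    · exact Nat.zero_le _
  have h3 := Finset.sum_le_sum h2
  rw [BinHeap.size_ofList]
  simp only
  omega

/-- In a random order, an insertion has constant expected cost. -/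
theorem expect_lastCost_le [Nonempty (Fin N ≃ S)] (key : S → α) {n : ℕ} (hn : n < N) :
    𝔼 e : Fin N ≃ S, (lastCost (((List.ofFn e).map key).take (n + 1)) : ℝ) ≤ 12 := by
  set s : Fin N := ⟨n, hn⟩
  let bad : ℕ → ℕ → (Fin N ≃ S) → ℝ := fun j r e =>
    if 1 ≤ (n + 1) / 2 ^ (j + 1) / 4 ^ r ∧ (BinHeap.indicesLe (((List.ofFn e).map key).take n)
      (key (e s)) (BinHeap.block ((n + 1) / 2 ^ (j + 1) / 4 ^ r) (j + r))).card ≤ 1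
    then 1 else 0
  have h1 : ∀ e : Fin N ≃ S, (lastCost (((List.ofFn e).map key).take (n + 1)) : ℝ) ≤
      4 + ∑ j ∈ Finset.range (Nat.log 2 (n + 1)), ∑ r ∈ Finset.range (n + 1), bad j r e := by
    intro e
    have hl : n < ((List.ofFn e).map key).length := by simpa using hn
    have h2 := lastCost_concat_le (((List.ofFn e).map key).take n) ((List.ofFn e).map key)[n]
    rw [List.take_concat_get' _ n hl, List.length_take, min_eq_left hl.le] at h2
    have h3 : ((List.ofFn e).map key)[n] = key (e s) := by simp [s]
    rw [h3] at h2
    simp only [bad]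
    exact_mod_cast h2
  -- The block has `2 ^ (j + r)` positions, all before `n`, so `expect_card_le_one_le` applies. The
  -- double geometric sum of these bounds is at most `8`, which added to `4` gives `12`.
  have h2 : ∀ j r, 𝔼 e, bad j r e ≤ 2 * ((1 / 2) ^ j * (1 / 2) ^ r) := by
    intro j r
    by_cases hb : 1 ≤ (n + 1) / 2 ^ (j + 1) / 4 ^ r
    · set b := (n + 1) / 2 ^ (j + 1) / 4 ^ r with hbdef
      have hub : (b + 1) * 2 ^ (j + r) - 1 ≤ n := by
        have h3 : b * 4 ^ r * 2 ^ (j + 1) ≤ n + 1 :=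
          (Nat.mul_le_mul_right _ (Nat.div_mul_le_self _ _)).trans (Nat.div_mul_le_self _ _)
        have h4 : (b + 1) * 2 ^ (j + r) ≤ b * 4 ^ r * 2 ^ (j + 1) := by
          have h5 : 2 ^ r ≤ 4 ^ r := Nat.pow_le_pow_left (by norm_num) r
          calc (b + 1) * 2 ^ (j + r) ≤ (2 * b) * 2 ^ (j + r) := Nat.mul_le_mul_right _ (by omega)
            _ = (b * 2 ^ (j + 1)) * 2 ^ r := by ring
            _ ≤ (b * 2 ^ (j + 1)) * 4 ^ r := Nat.mul_le_mul_left _ h5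
            _ = _ := by ring
        omega
      let W : Finset (Fin N) := Finset.univ.filter fun w => (w : ℕ) ∈ BinHeap.block b (j + r)
      have hW : W.map Fin.valEmbedding = BinHeap.block b (j + r) := by
        ext w
        simp only [W, Finset.mem_map, Finset.mem_filter, Finset.mem_univ, true_and,
          Fin.valEmbedding_apply]
        constructor
        · rintro ⟨w, hw, rfl⟩
          exact hw
        · intro hw
          have : w < N := by
            have h5 := hw
            rw [BinHeap.block, Finset.mem_Ico] at h5
            omega
          exact ⟨⟨w, this⟩, hw, rfl⟩
      have hWc : W.card = 2 ^ (j + r) := by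
        rw [← BinHeap.card_block hb, ← hW, Finset.card_map]
      have hs : s ∉ W := by
        simp only [W, Finset.mem_filter, Finset.mem_univ, true_and, s, BinHeap.block,
          Finset.mem_Ico]
        omega
      have h3 := expect_card_le_one_le key s W hs
      calc 𝔼 e, bad j r e ≤ 𝔼 e : Fin N ≃ S,
            (if (W.filter fun w => key (e w) ≤ key (e s)).card ≤ 1 then (1 : ℝ) else 0) := by
            refine Finset.expect_le_expect fun e _ => ?_
            have h4 : (BinHeap.indicesLe (((List.ofFn e).map key).take n) (key (e s))
                (BinHeap.block b (j + r))).card =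
                (W.filter fun w => key (e w) ≤ key (e s)).card := by
              rw [BinHeap.indicesLe, ← hW, Finset.filter_map, Finset.card_map]
              congr 1
              refine Finset.filter_congr fun w hw => ?_
              have hwn : (w : ℕ) < n := by
                simp only [W, Finset.mem_filter, Finset.mem_univ, true_and, BinHeap.block,
                  Finset.mem_Ico] at hw
                omega
              simp [List.getElem?_take, hwn]
            simp only [bad, ← hbdef, h4]
            split_ifs with h5 h6
            · exact le_rfl
            · exact absurd h5.2 h6
            · exact zero_le_one
            · exact le_rfl
        _ ≤ 2 / (W.card + 1) := h3
        _ ≤ 2 * ((1 / 2) ^ j * (1 / 2) ^ r) := by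
            rw [hWc, ← pow_add, one_div_pow, mul_one_div]
            push_cast
            gcongr
            linarith
    · have : ∀ e, bad j r e = 0 := fun e => if_neg fun h => hb h.1
      simp only [this, Finset.expect_const_zero]
      positivity
  calc _ ≤ 𝔼 e : Fin N ≃ S, ((4 : ℝ) + ∑ j ∈ Finset.range (Nat.log 2 (n + 1)),
          ∑ r ∈ Finset.range (n + 1), bad j r e) := Finset.expect_le_expect fun e _ => h1 e
    _ = 4 + ∑ j ∈ Finset.range (Nat.log 2 (n + 1)), ∑ r ∈ Finset.range (n + 1),
          𝔼 e, bad j r e := by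
        rw [Finset.expect_add_distrib, Fintype.expect_const, Finset.expect_sum_comm]
        simp only [Finset.expect_sum_comm]
    _ ≤ 4 + ∑ j ∈ Finset.range (Nat.log 2 (n + 1)), ∑ r ∈ Finset.range (n + 1),
          2 * ((1 / 2 : ℝ) ^ j * (1 / 2) ^ r) := by
        gcongr with j _ r _
        exact h2 j r
    _ = 4 + 2 * ((∑ j ∈ Finset.range (Nat.log 2 (n + 1)), (1 / 2 : ℝ) ^ j) *
          ∑ r ∈ Finset.range (n + 1), (1 / 2 : ℝ) ^ r) := by
        rw [Finset.sum_mul_sum, Finset.mul_sum]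
        simp only [Finset.mul_sum]
    _ ≤ 4 + 2 * (2 * 2) := by
        gcongr <;> exact sum_geometric_two_le _
    _ = 12 := by norm_num

end RandomOrder

end MultiQueue

namespace MultiQueue

open scoped BigOperators

/-! ### Dealing from both ends of a random deck -/

theorem getElem?_map_append_of_prefix {S T : Type*} {a c : List S} {σ : S} (h : a ++ [σ] <+: c)
    (d : List S) (f : S → T) : ((c ++ d).map f)[a.length]? = some (f σ) := by
  obtain ⟨e, rfl⟩ := h
  simp

/-- Consider a process that reveals the values `π σ` of a permutation at places `σ` that depend on
the values revealed before; the places are collected in two lists, and to which of them a place is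
added is determined before its value is revealed.  The values at the places of the first list are
an initial part of a sequence that is a bijective function of `π`. -/
theorem exists_deck {S X : Type*} [Fintype S] [DecidableEq S] (T : ℕ)
    (x : Equiv.Perm S → ℕ → X) (A O : X → List S) (h0 : ∀ π π', x π 0 = x π' 0)
    (hA : ∀ π n, n < T → A (x π n) <+: A (x π (n + 1)))
    (hO : ∀ π n, n < T → O (x π n) <+: O (x π (n + 1)))
    (hstep : ∀ π π' n, n < T → x π n = x π' n → x π (n + 1) = x π' (n + 1) ∨
      ∃ σ, (π σ = π' σ → x π (n + 1) = x π' (n + 1)) ∧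
        ((A (x π (n + 1)) = A (x π n) ++ [σ] ∧ A (x π' (n + 1)) = A (x π' n) ++ [σ]) ∨
          (O (x π (n + 1)) = O (x π n) ++ [σ] ∧ O (x π' (n + 1)) = O (x π' n) ++ [σ])))
    (hnd : ∀ π, (A (x π T) ++ O (x π T)).Nodup) :
    ∃ Φ : Equiv.Perm S → (Fin (Fintype.card S) ≃ S), Function.Bijective Φ ∧
      ∀ π, (A (x π T)).map π <+: List.ofFn (Φ π) := by
  have mono : ∀ (B : X → List S), (∀ π n, n < T → B (x π n) <+: B (x π (n + 1))) →
      ∀ π n, n ≤ T → B (x π n) <+: B (x π T) := by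
    intro B hB π n hn
    have : ∀ k, n + k ≤ T → B (x π n) <+: B (x π (n + k)) := by
      intro k
      induction k with
      | zero => exact fun _ => List.prefix_rfl
      | succ k ih => exact fun hk => (ih (by omega)).trans (hB π (n + k) (by omega))
    have h1 := this (T - n) (by omega)
    rwa [Nat.add_sub_of_le hn] at h1
  let rest : X → List S := fun y => (Finset.univ.filter fun σ => σ ∉ A y ++ O y).toList
  -- The deck: places of the first list from the front, those of the second list from the back,
  -- places never revealed in between in an order that depends only on the state.
  let order : X → List S := fun y => A y ++ (rest y ++ (O y).reverse)
  have hmem : ∀ y σ, σ ∈ order y := by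
    intro y σ
    simp only [order, rest, List.mem_append, Finset.mem_toList, Finset.mem_filter,
      Finset.mem_univ, true_and, List.mem_reverse, not_or]
    tauto
  have hnodup : ∀ π, (order (x π T)).Nodup := by
    intro π
    have h1 := List.nodup_append.1 (hnd π)
    simp only [order]
    rw [List.nodup_append, List.nodup_append]
    refine ⟨h1.1, ⟨Finset.nodup_toList _, List.nodup_reverse.2 h1.2.1, ?_⟩, ?_⟩
    · intro a ha b hb hab
      simp only [rest, Finset.mem_toList, Finset.mem_filter, Finset.mem_univ, true_and,
        List.mem_append, not_or] at ha
      rw [List.mem_reverse] at hb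
      exact ha.2 (hab ▸ hb)
    · intro a ha b hb hab
      rw [List.mem_append, List.mem_reverse] at hb
      rcases hb with hb | hb
      · simp only [rest, Finset.mem_toList, Finset.mem_filter, Finset.mem_univ, true_and,
          List.mem_append, not_or] at hb
        exact hb.1 (hab ▸ ha)
      · exact h1.2.2 a ha b hb hab
  let deck : Equiv.Perm S → List S := fun π => (order (x π T)).map π
  have dnodup : ∀ π, (deck π).Nodup := fun π => (hnodup π).map π.injective
  have dmem : ∀ π σ, σ ∈ deck π := fun π σ =>
    List.mem_map.2 ⟨π.symm σ, hmem _ _, π.apply_symm_apply σ⟩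
  have dlen : ∀ π, Fintype.card S = (deck π).length := fun π => by
    rw [← Fintype.card_fin (deck π).length]
    exact (Fintype.card_congr ((dnodup π).getEquivOfForallMemList _ (dmem π))).symm
  let Φ : Equiv.Perm S → (Fin (Fintype.card S) ≃ S) := fun π =>
    (finCongr (dlen π)).trans ((dnodup π).getEquivOfForallMemList _ (dmem π))
  have hΦ : ∀ π, List.ofFn (Φ π) = deck π := by
    intro π
    apply List.ext_getElem
    · rw [List.length_ofFn, dlen π]
    · intro n h1 h2
      simp [Φ]
  have hinj : Function.Injective Φ := by
    intro π π' h
    have hd : deck π = deck π' := by rw [← hΦ, ← hΦ, h]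
    -- Equal decks force equal histories. The next revealed value is the next card from the front or
    -- from the back, and which end it is was fixed before the value is seen. Equal final states
    -- then list the places in the same order, so the permutations agree everywhere.
    have hx : ∀ n, n ≤ T → x π n = x π' n := by
      intro n
      induction n with
      | zero => exact fun _ => h0 π π'
      | succ n ih =>
        intro hn
        have hxn := ih (by omega)
        rcases hstep π π' n (by omega) hxn with h1 | ⟨σ, h1, ⟨h2, h3⟩ | ⟨h2, h3⟩⟩
        · exact h1
        · apply h1
          have e1 := mono A hA π (n + 1) hn
          have e2 := mono A hA π' (n + 1) hn
          rw [h2] at e1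
          rw [h3, ← hxn] at e2
          have f1 := getElem?_map_append_of_prefix e1 (rest (x π T) ++ (O (x π T)).reverse) π
          have f2 := getElem?_map_append_of_prefix e2 (rest (x π' T) ++ (O (x π' T)).reverse) π'
          exact Option.some.inj (f1.symm.trans ((congrArg (·[(A (x π n)).length]?) hd).trans f2))
        · apply h1
          have e1 := mono O hO π (n + 1) hn
          have e2 := mono O hO π' (n + 1) hn
          rw [h2] at e1
          rw [h3, ← hxn] at e2
          have f1 := getElem?_map_append_of_prefix e1 ((A (x π T) ++ rest (x π T)).reverse) π
          have f2 := getElem?_map_append_of_prefix e2 ((A (x π' T) ++ rest (x π' T)).reverse) π'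
          have hrev : ∀ π, (deck π).reverse =
              (O (x π T) ++ (A (x π T) ++ rest (x π T)).reverse).map π := by
            intro π
            simp only [deck, order, ← List.map_reverse]
            simp
          have hd' : (deck π).reverse = (deck π').reverse := by rw [hd]
          rw [hrev, hrev] at hd'
          exact Option.some.inj (f1.symm.trans ((congrArg (·[(O (x π n)).length]?) hd').trans f2))
    ext σ
    simp only [deck, hx T le_rfl] at hd
    exact List.map_inj_left.1 hd σ (hmem _ σ)
  refine ⟨Φ, (Fintype.bijective_iff_injective_and_card Φ).2 ⟨hinj, ?_⟩, fun π => ?_⟩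
  · exact Fintype.card_congr ((Fintype.equivFin S).equivCongr (Equiv.refl S))
  · rw [hΦ]
    exact ⟨(rest (x π T) ++ (O (x π T)).reverse).map π, by simp [deck, order]⟩

end MultiQueue

namespace MultiQueue

open scoped BigOperators

/-! ### The local queues under random insertions -/

section Insertions

variable {α : Type*} [LinearOrder α] {p m : ℕ} {len : Fin p → ℕ}

/-- The program of insertions in which thread `t` inserts the elements `a ⟨t, k⟩`. -/
def insertions (a : (Σ t, Fin (len t)) → α) (t : Fin p) : List (Op α) :=
  List.ofFn fun k => Op.insert (a ⟨t, k⟩)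

theorem getElem?_insertions (a : (Σ t, Fin (len t)) → α) (t : Fin p) {k : ℕ} (hk : k < len t) :
    (insertions a t)[k]? = some (.insert (a ⟨t, k, hk⟩)) := by
  simp [insertions, hk]

theorem getElem?_insertions_of_le (a : (Σ t, Fin (len t)) → α) (t : Fin p) {k : ℕ}
    (hk : len t ≤ k) : (insertions a t)[k]? = none := by
  simp [insertions, hk]

/-- The operation with a given number of a given thread. -/
def slot (len : Fin p → ℕ) (x : Fin p × ℕ) : Option (Σ t, Fin (len t)) :=
  if h : x.2 < len x.1 then some ⟨x.1, x.2, h⟩ else none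

theorem slot_of_lt {t : Fin p} {k : ℕ} (hk : k < len t) : slot len (t, k) = some ⟨t, k, hk⟩ :=
  dif_pos hk

theorem slot_injective (x y : Fin p × ℕ) (σ : Σ t, Fin (len t)) (hx : σ ∈ slot len x)
    (hy : σ ∈ slot len y) : x = y := by
  unfold slot at hx hy
  split_ifs at hx hy with h1 h2
  · simp only [Option.mem_def, Option.some.injEq] at hx hy
    rw [← hx] at hy
    simp only [Sigma.mk.injEq] at hy
    obtain ⟨x1, x2⟩ := x
    obtain ⟨y1, y2⟩ := y
    obtain ⟨h3, h4⟩ := hy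
    simp only at h3
    subst h3
    simp only [heq_eq_eq, Fin.mk.injEq] at h4
    rw [h4]
  all_goals simp at hx hy

namespace Lazy

/-- The operations that have acquired the lock of one of the queues `i` with `P i`, in this
order. -/
def acquired {Q : SeqPQ α} (len : Fin p → ℕ) (P : Fin m → Prop) [DecidablePred P]
    (L : Lazy Q p m) : List (Σ t, Fin (len t)) :=
  (L.log.filter fun x => P x.1).filterMap fun x => slot len x.2

theorem acquired_of_log_eq {Q : SeqPQ α} (P : Fin m → Prop) [DecidablePred P] {L L' : Lazy Q p m}
    (h : L'.log = L.log) : L'.acquired len P = L.acquired len P := by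
  simp only [acquired, h]

theorem acquired_of_log_concat {Q : SeqPQ α} (P : Fin m → Prop) [DecidablePred P]
    {L L' : Lazy Q p m} {i : Fin m} {t : Fin p} {k : ℕ} (hk : k < len t)
    (h : L'.log = L.log ++ [(i, t, k)]) :
    L'.acquired len P = L.acquired len P ++ if P i then [⟨t, k, hk⟩] else [] := by
  simp only [acquired, h, List.filter_append, List.filterMap_append]
  by_cases hP : P i
  · simp [hP, slot_of_lt hk]
  · simp [hP]

theorem Inv.nodup_acquired {Q : SeqPQ α} {L : Lazy Q p m} (h : L.Inv) (P : Fin m → Prop)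
    [DecidablePred P] : (L.acquired len P ++ L.acquired len fun i => ¬ P i).Nodup := by
  unfold acquired
  rw [← List.filterMap_append]
  have h1 : ((L.log.filter fun x => P x.1) ++ L.log.filter fun x => ¬ P x.1).Perm L.log := by
    simpa using List.filter_append_perm (fun x : Fin m × Fin p × ℕ => decide (P x.1)) L.log
  rw [(h1.filterMap _).nodup_iff]
  have h2 : L.log.filterMap (fun x => slot len x.2) =
      (L.log.map Prod.snd).filterMap (slot len) := by
    rw [List.filterMap_map]
    rfl
  rw [h2]
  exact h.nodup.filterMap slot_injective

variable {L : Lazy (binaryHeap α) p m}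

/-- The effect of a step of an insertion depends on the element only when a lock is acquired. -/
theorem exec_insert_congr (t : Fin p) (d : Fin m × Fin m) (a b : α) :
    L.exec t (.insert a) d = L.exec t (.insert b) d ∨
      ∀ c, (L.exec t (.insert c) d).log = L.log ++ [(L.sel t d, t, L.base.pos t)] := by
  have h3 : ∀ δ', (L.fill δ').phase t = (L.base.phase t).fill (L.mem t) (L.sel t) (δ' t) :=
    fun δ' => rfl
  rcases ht : L.base.phase t with _ | ⟨i, j⟩ | ⟨i, j, x⟩ | i | ⟨i, _ | r, q, e⟩ | ⟨i, e⟩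
  case tryLock =>
    by_cases hl : L.base.locked (L.sel t d) = true
    · left
      have hl' : (L.fill fun _ => d).locked (L.sel t d) = true := hl
      simp only [exec, Config.exec, h3, ht, Phase.fill, hl, hl', if_true]
    · right
      intro c
      simp only [exec, ht, hl]
      simp
  all_goals
    left
    simp only [exec, Config.exec, h3, ht, Phase.fill]

/-- The elements inserted into queue `i`, in the order of the acquisitions of its lock. -/
def elements (a : (Σ t, Fin (len t)) → α) (i : Fin m) (L : Lazy (binaryHeap α) p m) : List α :=
  (L.acquired len (· = i)).map a

theorem elements_of_log_eq (a : (Σ t, Fin (len t)) → α) (i : Fin m)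
    {L L' : Lazy (binaryHeap α) p m} (h : L'.log = L.log) : L'.elements a i = L.elements a i := by
  simp only [elements, acquired_of_log_eq _ h]

theorem elements_of_log_concat (a : (Σ t, Fin (len t)) → α) (j : Fin m)
    {L L' : Lazy (binaryHeap α) p m} {i : Fin m} {t : Fin p} {k : ℕ} (hk : k < len t)
    (h : L'.log = L.log ++ [(i, t, k)]) :
    L'.elements a j = L.elements a j ++ if i = j then [a ⟨t, k, hk⟩] else [] := by
  simp only [elements, acquired_of_log_concat _ hk h, List.map_append]
  split_ifs <;> simp

/-- The local queues are the heaps obtained by successive insertion of their elements. -/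
structure HeapInv (a : (Σ t, Fin (len t)) → α) (L : Lazy (binaryHeap α) p m) : Prop where
  inv : L.Inv
  queue : ∀ i, L.base.locked i = false → L.base.queue i = BinHeap.ofList (L.elements a i)
  access : ∀ u i r q e, L.base.phase u = .access i r q e → q = BinHeap.ofList (L.elements a i)
  unlock : ∀ u i e, L.base.phase u = .unlock i e →
    L.base.queue i = BinHeap.ofList (L.elements a i)
  log : ∀ x ∈ L.log, x.2.2 < len x.2.1
  dur : ∑ t, ∑ k : Fin (len t), L.dur t k ≤ ∑ i, totalCost (L.elements a i)

theorem HeapInv.init (a : (Σ t, Fin (len t)) → α) :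
    (Lazy.init (binaryHeap α) p m).HeapInv a where
  inv := Inv.init
  queue _ _ := rfl
  access u i r q e h := by simp [Lazy.init, Config.init] at h
  unlock u i e h := by simp [Lazy.init, Config.init] at h
  log x hx := by simp [Lazy.init] at hx
  dur := by simp [Lazy.init]

theorem fill_eq_access {S β : Type*} {mem : Fin m → WithTop β} {sel : Fin m × Fin m → Fin m}
    {d : Fin m × Fin m} {ph : Phase S β m} {i : Fin m} {r : ℕ} {q : S} {e : WithTop β}
    (h : ph.fill mem sel d = .access i r q e) : ph = .access i r q e := by
  cases ph <;> simp_all [Phase.fill]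

theorem fill_eq_unlock {S β : Type*} {mem : Fin m → WithTop β} {sel : Fin m × Fin m → Fin m}
    {d : Fin m × Fin m} {ph : Phase S β m} {i : Fin m} {e : WithTop β}
    (h : ph.fill mem sel d = .unlock i e) : ph = .unlock i e := by
  cases ph <;> simp_all [Phase.fill]

/-- Steps that change neither the queues nor the locks preserve the invariant. -/
theorem HeapInv.of_quiet {a : (Σ t, Fin (len t)) → α} (h : L.HeapInv a)
    {L' : Lazy (binaryHeap α) p m} (t : Fin p) (hinv : L'.Inv) (hlog : L'.log = L.log)
    (hdur : L'.dur = L.dur) (hlocked : L'.base.locked = L.base.locked)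
    (hqueue : L'.base.queue = L.base.queue)
    (hne : ∀ u, u ≠ t → ∃ mem sel d, L'.base.phase u = (L.base.phase u).fill mem sel d)
    (hacc : ∀ i r q e, L'.base.phase t = .access i r q e → ∃ r', L.base.phase t = .access i r' q e)
    (hunl : ∀ i e, L'.base.phase t ≠ .unlock i e) : L'.HeapInv a where
  inv := hinv
  queue i := by
    rw [hlocked, hqueue, elements_of_log_eq _ _ hlog]
    exact h.queue i
  access u i r q e hu := by
    rw [elements_of_log_eq _ _ hlog]
    by_cases hut : u = t
    · subst hut
      obtain ⟨r', hr'⟩ := hacc i r q e hu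
      exact h.access u i r' q e hr'
    · obtain ⟨mem, sel, d, e1⟩ := hne u hut
      exact h.access u i r q e (fill_eq_access (e1.symm.trans hu))
  unlock u i e hu := by
    rw [elements_of_log_eq _ _ hlog, hqueue]
    by_cases hut : u = t
    · subst hut
      exact absurd hu (hunl i e)
    · obtain ⟨mem, sel, d, e1⟩ := hne u hut
      exact h.unlock u i e (fill_eq_unlock (e1.symm.trans hu))
  log := by rw [hlog]; exact h.log
  dur := by
    simp only [hdur, elements_of_log_eq _ _ hlog]
    exact h.dur

theorem sum_sum_update_le (f : Fin p → ℕ → ℕ) (t : Fin p) {k : ℕ} (hk : k < len t) (n : ℕ)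
    (h0 : f t k = 0) :
    ∑ u, ∑ j : Fin (len u), Function.update f t (Function.update (f t) k n) u j ≤
      ∑ u, ∑ j : Fin (len u), f u j + n := by
  have h1 : ∀ u, ∑ j : Fin (len u), Function.update f t (Function.update (f t) k n) u j =
      ∑ j : Fin (len u), f u j + if u = t then n else 0 := by
    intro u
    by_cases hu : u = t
    · subst hu
      have h2 : ∀ j : Fin (len u), Function.update f u (Function.update (f u) k n) u j =
          f u j + if j = ⟨k, hk⟩ then n else 0 := by
        intro j
        by_cases hj : j = ⟨k, hk⟩
        · subst hj; simp [h0]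
        · have : (j : ℕ) ≠ k := fun e => hj (Fin.ext e)
          simp [hj, this]
      simp [h2, Finset.sum_add_distrib]
    · simp [hu]
  simp [h1, Finset.sum_add_distrib]

/-- `elements` grows as soon as the lock is acquired, but the queue is written only at the end of
the access. In between, the pending state in the phase `access` is the heap that matches `elements`;
in the phase `unlock` the stored queue matches again. `dur` is set at the acquisition to exactly the
increase of `totalCost`. -/
theorem HeapInv.exec {a : (Σ t, Fin (len t)) → α} (h : L.HeapInv a) (t : Fin p)
    (hk : L.base.pos t < len t) (d : Fin m × Fin m) :
    (L.exec t (.insert (a ⟨t, L.base.pos t, hk⟩)) d).HeapInv a := by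
  have hinv := h.inv.exec t (.insert (a ⟨t, L.base.pos t, hk⟩)) d
  have h3 : ∀ δ', (L.fill δ').phase t = (L.base.phase t).fill (L.mem t) (L.sel t) (δ' t) :=
    fun δ' => rfl
  rcases ht : L.base.phase t with _ | ⟨i, j⟩ | ⟨i, j, x⟩ | i | ⟨i, _ | r, q, e⟩ | ⟨i, e⟩
  case tryLock =>
    by_cases hl : L.base.locked (L.sel t d) = true
    · have hl' : (L.fill fun _ => d).locked (L.sel t d) = true := hl
      refine h.of_quiet t hinv ?_ ?_ ?_ ?_ (fun u hu => ⟨L.mem u, L.sel u, d, ?_⟩)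
        (fun i r q e => ?_) (fun i e => ?_)
      all_goals simp [Lazy.exec, Config.exec, h3, ht, Phase.fill, Config.setPhase, hl, hl'] <;>
        first | rfl | (simp [hu]; rfl)
    · have hl' : (L.fill fun _ => d).locked (L.sel t d) = false := Bool.eq_false_iff.2 hl
      set x := a ⟨t, L.base.pos t, hk⟩ with hx
      set i := L.sel t d with hi
      have elog : (L.exec t (.insert x) d).log = L.log ++ [(i, t, L.base.pos t)] := by
        simp [Lazy.exec, ht, hl, ← hi]
      have eque : (L.exec t (.insert x) d).base.queue = L.base.queue := by
        simp [Lazy.exec, Config.exec, h3, ht, Phase.fill, Config.setPhase, hl', ← hi]; rfl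
      have elock : (L.exec t (.insert x) d).base.locked = Function.update L.base.locked i true := by
        simp [Lazy.exec, Config.exec, h3, ht, Phase.fill, Config.setPhase, hl', ← hi]; rfl
      have eph : (L.exec t (.insert x) d).base.phase t =
          .access i (BinHeap.insert x (L.base.queue i)).2 (BinHeap.insert x (L.base.queue i)).1
            ⊤ := by
        simp [Lazy.exec, Config.exec, h3, ht, Phase.fill, Config.setPhase, hl', ← hi]; rfl
      have ephne : ∀ u, u ≠ t → (L.exec t (.insert x) d).base.phase u =
          (L.base.phase u).fill (L.mem u) (L.sel u) d := by
        intro u hu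
        simp [Lazy.exec, Config.exec, h3, ht, Phase.fill, Config.setPhase, hl', ← hi, hu]; rfl
      have edur : (L.exec t (.insert x) d).dur = Function.update L.dur t
          (Function.update (L.dur t) (L.base.pos t)
            ((BinHeap.insert x (L.base.queue i)).2 + 2)) := by
        simp [Lazy.exec, ht, hl, ← hi]; rfl
      have eel : ∀ j, (L.exec t (.insert x) d).elements a j =
          L.elements a j ++ if i = j then [x] else [] := fun j =>
        elements_of_log_concat a j hk elog
      have hq : L.base.queue i = BinHeap.ofList (L.elements a i) := h.queue i (by simpa using hl)
      have hfree : ∀ u, (L.base.phase u).held ≠ some i := fun u hu =>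
        hl ((h.inv.locked i).2 ⟨u, hu⟩)
      refine ⟨hinv, fun j hj => ?_, fun u j r q e hu => ?_, fun u j e hu => ?_, ?_, ?_⟩
      · have hij : i ≠ j := by
          rintro rfl
          simp [elock] at hj
        rw [elock, Function.update_of_ne hij.symm] at hj
        rw [eque, eel, if_neg hij, List.append_nil]
        exact h.queue j hj
      · by_cases hut : u = t
        · subst hut
          rw [eph] at hu
          injection hu with e1 _ e3 _
          subst e1
          refine e3.symm.trans ?_
          rw [eel, if_pos rfl, BinHeap.ofList_concat, ← hq]
        · have hu' := fill_eq_access ((ephne u hut).symm.trans hu)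
          have hij : i ≠ j := by
            rintro rfl
            exact hfree u (by rw [hu']; rfl)
          rw [eel, if_neg hij, List.append_nil]
          exact h.access u j r q e hu'
      · by_cases hut : u = t
        · subst hut
          rw [eph] at hu
          simp at hu
        · have hu' := fill_eq_unlock ((ephne u hut).symm.trans hu)
          have hij : i ≠ j := by
            rintro rfl
            exact hfree u (by rw [hu']; rfl)
          rw [eel, if_neg hij, List.append_nil, eque]
          exact h.unlock u j e hu'
      · intro y hy
        rw [elog, List.mem_append, List.mem_singleton] at hy
        rcases hy with hy | rfl
        · exact h.log y hy
        · exact hk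
      · rw [edur]
        have h0 : L.dur t (L.base.pos t) = 0 :=
          h.inv.dur t _ (Or.inr ⟨rfl, by rw [ht]; rfl⟩)
        refine (sum_sum_update_le L.dur t hk _ h0).trans ?_
        have h4 : ∀ j, totalCost ((L.exec t (.insert x) d).elements a j) =
            totalCost (L.elements a j) +
              if j = i then (BinHeap.insert x (L.base.queue i)).2 + 2 else 0 := by
          intro j
          rw [eel]
          by_cases hij : j = i
          · subst hij
            rw [if_pos rfl, if_pos rfl, totalCost_concat, hq]
          · rw [if_neg (Ne.symm hij), if_neg hij, List.append_nil, add_zero]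
        simp only [h4, Finset.sum_add_distrib, Finset.sum_ite_eq', Finset.mem_univ, if_true]
        exact Nat.add_le_add_right h.dur _
  case access.zero =>
    set op : Op α := .insert (a ⟨t, L.base.pos t, hk⟩)
    have elog : (L.exec t op d).log = L.log := by simp [Lazy.exec, ht]
    have eque : (L.exec t op d).base.queue = Function.update L.base.queue i q := by
      simp [Lazy.exec, Config.exec, h3, ht, Phase.fill, Config.setPhase]; rfl
    have elock : (L.exec t op d).base.locked = L.base.locked := by
      simp [Lazy.exec, Config.exec, h3, ht, Phase.fill, Config.setPhase]; rfl
    have eph : (L.exec t op d).base.phase t = .unlock i e := by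
      simp [Lazy.exec, Config.exec, h3, ht, Phase.fill, Config.setPhase]
    have ephne : ∀ u, u ≠ t → (L.exec t op d).base.phase u =
        (L.base.phase u).fill (L.mem u) (L.sel u) d := by
      intro u hu
      simp [Lazy.exec, Config.exec, h3, ht, Phase.fill, Config.setPhase, hu]; rfl
    have edur : (L.exec t op d).dur = L.dur := by simp [Lazy.exec, ht]
    have hheld : (L.base.phase t).held = some i := by rw [ht]; rfl
    refine ⟨hinv, fun j hj => ?_, fun u j r q e hu => ?_, fun u j e hu => ?_, ?_, ?_⟩
    · rw [elock] at hj
      have hij : j ≠ i := by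
        rintro rfl
        rw [(h.inv.locked j).2 ⟨t, hheld⟩] at hj
        simp at hj
      rw [eque, Function.update_of_ne hij, elements_of_log_eq _ _ elog]
      exact h.queue j hj
    · rw [elements_of_log_eq _ _ elog]
      by_cases hut : u = t
      · subst hut
        rw [eph] at hu
        simp at hu
      · exact h.access u j r q e (fill_eq_access ((ephne u hut).symm.trans hu))
    · rw [elements_of_log_eq _ _ elog, eque]
      by_cases hut : u = t
      · subst hut
        rw [eph] at hu
        simp only [Phase.unlock.injEq] at hu
        obtain ⟨rfl, -⟩ := hu
        rw [Function.update_self]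
        exact h.access u i 0 q _ ht
      · have hu' := fill_eq_unlock ((ephne u hut).symm.trans hu)
        have hij : j ≠ i := by
          rintro rfl
          exact hut (h.inv.unique u t j (by rw [hu']; rfl) hheld)
        rw [Function.update_of_ne hij]
        exact h.unlock u j e hu'
    · rw [elog]
      exact h.log
    · simp only [edur, elements_of_log_eq _ _ elog]
      exact h.dur
  case unlock =>
    set op : Op α := .insert (a ⟨t, L.base.pos t, hk⟩)
    have elog : (L.exec t op d).log = L.log := by simp [Lazy.exec, ht]
    have eque : (L.exec t op d).base.queue = L.base.queue := by
      simp [Lazy.exec, Config.exec, h3, ht, Phase.fill, Config.setPhase]; rfl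
    have elock : (L.exec t op d).base.locked = Function.update L.base.locked i false := by
      simp [Lazy.exec, Config.exec, h3, ht, Phase.fill, Config.setPhase]; rfl
    have eph : (L.exec t op d).base.phase t = .start := by
      simp [Lazy.exec, Config.exec, h3, ht, Phase.fill, Config.setPhase]
    have ephne : ∀ u, u ≠ t → (L.exec t op d).base.phase u =
        (L.base.phase u).fill (L.mem u) (L.sel u) d := by
      intro u hu
      simp [Lazy.exec, Config.exec, h3, ht, Phase.fill, Config.setPhase, hu]; rfl
    have edur : (L.exec t op d).dur = L.dur := by simp [Lazy.exec, ht]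
    refine ⟨hinv, fun j hj => ?_, fun u j r q e hu => ?_, fun u j e hu => ?_, ?_, ?_⟩
    · rw [eque, elements_of_log_eq _ _ elog]
      by_cases hij : j = i
      · subst hij
        exact h.unlock t j e ht
      · rw [elock, Function.update_of_ne hij] at hj
        exact h.queue j hj
    · rw [elements_of_log_eq _ _ elog]
      by_cases hut : u = t
      · subst hut
        rw [eph] at hu
        simp at hu
      · exact h.access u j r q e (fill_eq_access ((ephne u hut).symm.trans hu))
    · rw [elements_of_log_eq _ _ elog, eque]
      by_cases hut : u = t
      · subst hut
        rw [eph] at hu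
        simp at hu
      · exact h.unlock u j e (fill_eq_unlock ((ephne u hut).symm.trans hu))
    · rw [elog]
      exact h.log
    · simp only [edur, elements_of_log_eq _ _ elog]
      exact h.dur
  all_goals
    refine h.of_quiet t hinv ?_ ?_ ?_ ?_ (fun u hu => ⟨L.mem u, L.sel u, d, ?_⟩)
      (fun i r q e => ?_) (fun i e => ?_)
    all_goals simp [Lazy.exec, Config.exec, h3, ht, Phase.fill, Config.setPhase] <;>
        first | rfl | (simp [hu]; rfl) | (intros; simp_all)

theorem HeapInv.next {a : (Σ t, Fin (len t)) → α} (h : L.HeapInv a) (t : Fin p)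
    (d : Fin m × Fin m) : (L.next (insertions a) t d).HeapInv a := by
  unfold Lazy.next
  by_cases hk : L.base.pos t < len t
  · rw [getElem?_insertions a t hk]
    exact h.exec t hk d
  · rw [getElem?_insertions_of_le a t (by omega)]
    exact h

end Lazy

end Insertions

end MultiQueue

namespace MultiQueue

open scoped BigOperators

/-! ### The sizes of the local queues -/

namespace Lazy

section Size

variable {α : Type*} [LinearOrder α] {Q : SeqPQ α} {p m : ℕ}

/-- The number of acquisitions of the lock of queue `i`. -/
def acquisitions (i : Fin m) (L : Lazy Q p m) : ℕ := (L.log.filter fun x => x.1 = i).length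

theorem log_exec_of_not_tryLock {L : Lazy Q p m} {t : Fin p}
    (ht : ∀ i, L.base.phase t ≠ .tryLock i) (op : Op α) (d : Fin m × Fin m) :
    (L.exec t op d).log = L.log := by
  rcases h : L.base.phase t with _ | ⟨i, j⟩ | ⟨i, j, x⟩ | i | ⟨i, _ | r, q, e⟩ | ⟨i, e⟩
  case tryLock => exact absurd h (ht i)
  all_goals simp only [exec, h]

/-- Exponential moments of the number of acquisitions of a lock. -/
theorem Inv.expect_pow_acquisitions_le [NeZero m] {L : Lazy Q p m} (h : L.Inv) (hpm : p ≤ m)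
    {a : ℝ} (ha : 1 ≤ a) (ha' : 6 / m ≤ (a - 1) * (1 - (p : ℝ) / m) ^ 2)
    (prog : Fin p → List (Op α)) (t : Fin p) (i : Fin m) :
    𝔼 d, ((4 : ℝ) ^ (L.next prog t d).acquisitions i * (1 / a) ^ (L.next prog t d).log.length) ≤
      4 ^ L.acquisitions i * (1 / a) ^ L.log.length := by
  have const : (∀ d, (L.next prog t d).log = L.log) → 𝔼 d,
      ((4 : ℝ) ^ (L.next prog t d).acquisitions i * (1 / a) ^ (L.next prog t d).log.length) ≤
      4 ^ L.acquisitions i * (1 / a) ^ L.log.length := by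
    intro hd
    simp only [acquisitions, hd, Fintype.expect_const, le_refl]
  cases hop : (prog t)[L.base.pos t]? with
  | none => exact const fun d => by simp only [Lazy.next, hop]
  | some op =>
    have hnext : ∀ d, L.next prog t d = L.exec t op d := fun d => by simp only [Lazy.next, hop]
    by_cases ht : ∃ j, L.base.phase t = .tryLock j
    · obtain ⟨j, ht⟩ := ht
      simp only [hnext]
      set F : ℝ := 4 ^ L.acquisitions i * (1 / a) ^ L.log.length with hF
      have hF0 : 0 ≤ F := by positivity
      have ha0 : 0 < a := by linarith
      -- The quantity is multiplied by `1` on failure, by `1 / a` on an acquisition of another queue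
      -- and by `4 / a = 1 / a + 3 / a` on one of queue `i`. The last event has probability at most
      -- `2 / m`, hence the `6 / m` in the hypothesis. Weighting by the length of the log counts
      -- acquisitions instead of attempts, whose number is not bounded by `N`.
      have h1 : ∀ d, (4 : ℝ) ^ (L.exec t op d).acquisitions i *
          (1 / a) ^ (L.exec t op d).log.length ≤
          F * (1 + (1 / a - 1) * (if L.base.locked (L.sel t d) = true then (0 : ℝ) else 1) +
            3 / a * (if L.sel t d = i then (1 : ℝ) else 0)) := by
        intro d
        by_cases hl : L.base.locked (L.sel t d) = true
        · have e : (L.exec t op d).log = L.log := by simp only [Lazy.exec, ht, hl, if_true]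
          simp only [acquisitions, e, hl, if_true, mul_zero, add_zero]
          rw [← acquisitions, ← hF]
          have : 0 ≤ 3 / a * (if L.sel t d = i then (1 : ℝ) else 0) := by
            split_ifs <;> positivity
          nlinarith
        · have e : (L.exec t op d).log = L.log ++ [(L.sel t d, t, L.base.pos t)] := by
            simp [Lazy.exec, ht, hl]
          have e1 : (L.exec t op d).log.length = L.log.length + 1 := by rw [e]; simp
          rw [if_neg hl, e1]
          by_cases hs : L.sel t d = i
          · have e2 : (L.exec t op d).acquisitions i = L.acquisitions i + 1 := by
              simp [acquisitions, e, hs]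
            rw [e2, if_pos hs, pow_succ, pow_succ, hF]
            apply le_of_eq
            field_simp
            ring
          · have e2 : (L.exec t op d).acquisitions i = L.acquisitions i := by
              simp [acquisitions, e, hs]
            rw [e2, if_neg hs, pow_succ, hF]
            apply le_of_eq
            ring
      refine (Finset.expect_le_expect fun d _ => h1 d).trans ?_
      rw [← Finset.mul_expect, Finset.expect_add_distrib, Finset.expect_add_distrib,
        ← Finset.mul_expect, ← Finset.mul_expect, Fintype.expect_const]
      have h2 := h.le_expect_unlocked t hpm
      have h3 := h.expect_sel_le t i
      set u := 𝔼 d, (if L.base.locked (L.sel t d) = true then (0 : ℝ) else 1)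
      set y := 𝔼 d, (if L.sel t d = i then (1 : ℝ) else 0)
      have h4 : 1 + (1 / a - 1) * u + 3 / a * y ≤ 1 := by
        have h5 : (1 / a - 1) * u + 3 / a * y = (3 * y - (a - 1) * u) / a := by
          field_simp
          ring
        have h6 : 3 * y - (a - 1) * u ≤ 0 := by
          have h7 : (a - 1) * (1 - (p : ℝ) / m) ^ 2 ≤ (a - 1) * u :=
            mul_le_mul_of_nonneg_left h2 (by linarith)
          have h8 : 3 * y ≤ 6 / m := by
            calc 3 * y ≤ 3 * (2 / m) := by linarith
              _ = 6 / m := by ring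
          linarith
        have := div_nonpos_of_nonpos_of_nonneg h6 ha0.le
        linarith
      exact (mul_le_mul_of_nonneg_left h4 hF0).trans (mul_one F).le
    · exact const fun d => by
        rw [hnext]
        exact log_exec_of_not_tryLock (fun j hj => ht ⟨j, hj⟩) op d

end Size

variable {α : Type*} [LinearOrder α] {p m : ℕ} {len : Fin p → ℕ} {L : Lazy (binaryHeap α) p m}
  {a : (Σ t, Fin (len t)) → α}

theorem HeapInv.length_log_le (h : L.HeapInv a) :
    L.log.length ≤ Fintype.card (Σ t, Fin (len t)) := by
  have h1 : (L.log.map Prod.snd).toFinset ⊆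
      (Finset.univ : Finset (Σ t, Fin (len t))).image fun σ => (σ.1, (σ.2 : ℕ)) := by
    intro y hy
    rw [List.mem_toFinset, List.mem_map] at hy
    obtain ⟨x, hx, rfl⟩ := hy
    rw [Finset.mem_image]
    exact ⟨⟨x.2.1, x.2.2, h.log x hx⟩, Finset.mem_univ _, rfl⟩
  have h2 := (Finset.card_le_card h1).trans Finset.card_image_le
  rw [List.toFinset_card_of_nodup h.inv.nodup, List.length_map] at h2
  simpa using h2

theorem HeapInv.length_elements (h : L.HeapInv a) (i : Fin m) :
    (L.elements a i).length = L.acquisitions i := by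
  unfold elements acquired acquisitions
  rw [List.length_map]
  have : ∀ l : List (Fin m × Fin p × ℕ), (∀ x ∈ l, x.2.2 < len x.2.1) →
      (l.filterMap fun x => slot len x.2).length = l.length := by
    intro l hl
    induction l with
    | nil => rfl
    | cons x l ih =>
      have hx : slot len x.2 = some ⟨x.2.1, x.2.2, hl x (by simp)⟩ := slot_of_lt _
      rw [List.filterMap_cons_some (f := fun x : Fin m × Fin p × ℕ => slot len x.2) hx,
        List.length_cons, List.length_cons, ih fun y hy => hl y (by simp [hy])]
  exact this _ fun x hx => h.log x (List.mem_of_mem_filter hx)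

/-- The log lists distinct insertions, so the supermartingale weight `(1 / b) ^ L.log.length` is at
least the inverse of the stated bound. -/
theorem evol_pow_length_le [NeZero m] (hpm : p ≤ m) {b : ℝ} (hb : 1 ≤ b)
    (hb' : 6 / m ≤ (b - 1) * (1 - (p : ℝ) / m) ^ 2) (a : (Σ t, Fin (len t)) → α)
    (l : List (Fin p)) (i : Fin m) :
    evol (fun t d L => Lazy.next (insertions a) t d L) l (Lazy.init (binaryHeap α) p m)
      (fun L => (4 : ℝ) ^ (L.elements a i).length) ≤ b ^ Fintype.card (Σ t, Fin (len t)) := by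
  have hb0 : 0 < b := by linarith
  have h1 := evol_le_of_supermartingale (fun t d L => Lazy.next (insertions a) t d L)
    (I := HeapInv a) (fun u d L h => h.next u d)
    (f := fun L : Lazy (binaryHeap α) p m =>
      ((4 : ℝ) ^ L.acquisitions i * (1 / b) ^ L.log.length))
    (fun u L h => h.inv.expect_pow_acquisitions_le hpm hb hb' _ u i) l (HeapInv.init a)
  have h2 : ((4 : ℝ) ^ (Lazy.init (binaryHeap α) p m).acquisitions i *
      (1 / b) ^ (Lazy.init (binaryHeap α) p m).log.length) = 1 := by
    simp [Lazy.init, acquisitions]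
  rw [h2] at h1
  have h3 := evol_le_of_invariant (fun t d L => Lazy.next (insertions a) t d L)
    (I := HeapInv a) (fun u d L h => h.next u d)
    (f := fun L : Lazy (binaryHeap α) p m => (4 : ℝ) ^ (L.elements a i).length)
    (g := fun L => b ^ Fintype.card (Σ t, Fin (len t)) *
      ((4 : ℝ) ^ L.acquisitions i * (1 / b) ^ L.log.length))
    (fun L h => by
      rw [h.length_elements i, mul_left_comm]
      apply le_mul_of_one_le_right (by positivity)
      rw [one_div, inv_pow, ← div_eq_mul_inv, one_le_div (by positivity)]
      exact pow_le_pow_right₀ hb h.length_log_le) l (HeapInv.init a)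
  rw [evol_const_mul] at h3
  refine h3.trans ?_
  exact (mul_le_mul_of_nonneg_left h1 (by positivity)).trans (mul_one _).le

end Lazy

/-! ### The cost of random insertions -/

section Cost

variable {α : Type*} [LinearOrder α] {p m : ℕ} {len : Fin p → ℕ}

/-- The cost of the `n`-th insertion into a local queue, `0` if there is none. -/
def costAt (n : ℕ) (l : List α) : ℕ := if n < l.length then lastCost (l.take (n + 1)) else 0

/-- With the draws fixed, the only randomness is the permutation. `exists_deck` embeds the elements
of queue `i` as an initial part of a uniformly random sequence. The cost of the `n`-th insertion is
at most that in the full sequence, even if the occurrence of this insertion depends on the elements.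
-/
theorem expect_costAt_tape_le [NeZero m] (key : (Σ t, Fin (len t)) → α)
    (tape : List (Fin p × (Fin m × Fin m))) (i : Fin m) (n : ℕ) :
    𝔼 π : Equiv.Perm (Σ t, Fin (len t)), (costAt n ((tape.foldl
      (fun L x => Lazy.next (insertions (key ∘ π)) x.1 x.2 L)
      (Lazy.init (binaryHeap α) p m)).elements (key ∘ π) i) : ℝ) ≤ 12 := by
  let x : Equiv.Perm (Σ t, Fin (len t)) → ℕ → Lazy (binaryHeap α) p m := fun π n =>
    (tape.take n).foldl (fun L x => Lazy.next (insertions (key ∘ π)) x.1 x.2 L)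
      (Lazy.init (binaryHeap α) p m)
  have hx : ∀ π n (hn : n < tape.length), x π (n + 1) =
      Lazy.next (insertions (key ∘ π)) tape[n].1 tape[n].2 (x π n) := by
    intro π n hn
    simp only [x]
    rw [← List.take_concat_get' tape n hn, List.foldl_append]
    rfl
  have hlog : ∀ π n, n < tape.length → ∀ (P : Fin m → Prop) [DecidablePred P],
      (x π n).acquired len P <+: (x π (n + 1)).acquired len P := by
    intro π n hn P _
    rw [hx π n hn]
    by_cases hk : (x π n).base.pos tape[n].1 < len tape[n].1
    · simp only [Lazy.next, getElem?_insertions _ _ hk]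
      rcases Lazy.exec_cases (x π n) tape[n].1 (.insert ((key ∘ π) ⟨_, _, hk⟩)) tape[n].2 with
        ⟨-, -, -, -, -, e⟩ | ⟨j, -, -, -, -, -, -, -, -, e⟩ | ⟨j, -, -, -, -, -, -, e⟩
      · rw [Lazy.acquired_of_log_eq P e]
      · rw [Lazy.acquired_of_log_concat P hk e]
        exact List.prefix_append _ _
      · rw [Lazy.acquired_of_log_eq P e]
    · simp only [Lazy.next, getElem?_insertions_of_le _ _ (not_lt.1 hk)]
      exact List.prefix_rfl
  have hinv : ∀ π n, (x π n).Inv := by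
    intro π n
    simp only [x]
    generalize tape.take n = l
    induction l using List.reverseRecOn with
    | nil => exact Lazy.Inv.init
    | append_singleton l y ih =>
      rw [List.foldl_append]
      exact ih.next _ _ _
  obtain ⟨Φ, hΦ, hpre⟩ := exists_deck tape.length x (fun L => L.acquired len (· = i))
    (fun L => L.acquired len fun j => ¬ j = i) (fun _ _ => rfl)
    (fun π n hn => hlog π n hn _) (fun π n hn => hlog π n hn _) (by
      intro π π' n hn hxn
      rw [hx π n hn, hx π' n hn, ← hxn]
      by_cases hk : (x π n).base.pos tape[n].1 < len tape[n].1
      · simp only [Lazy.next, getElem?_insertions _ _ hk]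
        rcases Lazy.exec_insert_congr (L := x π n) tape[n].1 tape[n].2
          ((key ∘ π) ⟨_, _, hk⟩) ((key ∘ π') ⟨_, _, hk⟩) with e | e
        · exact Or.inl e
        · right
          -- The place revealed is the operation that acquires the lock. Its queue is already known
          -- from the state and the fixed draws, so it is known which list it joins before its
          -- element matters.
          refine ⟨⟨_, _, hk⟩, fun h => by simp only [Function.comp, h], ?_⟩
          by_cases hi : (x π n).sel tape[n].1 tape[n].2 = i
          · left
            constructor <;> rw [Lazy.acquired_of_log_concat _ hk (e _), if_pos hi]
          · right
            constructor <;> rw [Lazy.acquired_of_log_concat _ hk (e _), if_pos hi]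
      · left
        simp only [Lazy.next, getElem?_insertions_of_le _ _ (not_lt.1 hk)])
    (fun π => (hinv π _).nodup_acquired _)
  have hfinal : ∀ π : Equiv.Perm (Σ t, Fin (len t)),
      tape.foldl (fun L x => Lazy.next (insertions (key ∘ π)) x.1 x.2 L)
      (Lazy.init (binaryHeap α) p m) = x π tape.length := by
    intro π
    simp only [x, List.take_length]
  simp only [hfinal]
  have : Nonempty (Fin (Fintype.card (Σ t, Fin (len t))) ≃ (Σ t, Fin (len t))) :=
    ⟨(Fintype.equivFin _).symm⟩
  calc _ ≤ 𝔼 π, (costAt n ((List.ofFn (Φ π)).map key) : ℝ) := by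
        refine Finset.expect_le_expect fun π _ => ?_
        have h1 : (x π tape.length).elements (key ∘ π) i <+: (List.ofFn (Φ π)).map key := by
          have := (hpre π).map key
          rwa [List.map_map] at this
        unfold costAt
        split_ifs with h2 h3
        · obtain ⟨r, hr⟩ := h1
          rw [← hr, List.take_append_of_le_length (by omega)]
        · exact absurd (h2.trans_le h1.length_le) h3
        · exact_mod_cast Nat.zero_le _
        · exact le_rfl
    _ = 𝔼 e : Fin (Fintype.card (Σ t, Fin (len t))) ≃ (Σ t, Fin (len t)),
          (costAt n ((List.ofFn e).map key) : ℝ) :=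
        Fintype.expect_bijective Φ hΦ _ _ fun _ => rfl
    _ ≤ 12 := by
        by_cases hn : n < Fintype.card (Σ t, Fin (len t))
        · refine le_trans (le_of_eq ?_) (expect_lastCost_le key hn)
          refine Finset.expect_congr rfl fun e _ => ?_
          rw [costAt, if_pos (by rw [List.length_map, List.length_ofFn]; exact hn)]
        · rw [Finset.expect_eq_zero]
          · norm_num
          · intro e _
            rw [costAt, if_neg (by rw [List.length_map, List.length_ofFn]; exact hn), Nat.cast_zero]

theorem expect_evol_costAt_le [NeZero m] (key : (Σ t, Fin (len t)) → α) (l : List (Fin p))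
    (i : Fin m) (n : ℕ) :
    𝔼 π : Equiv.Perm (Σ t, Fin (len t)),
      evol (fun t d L => Lazy.next (insertions (key ∘ π)) t d L) l (Lazy.init (binaryHeap α) p m)
        (fun L => (costAt n (L.elements (key ∘ π) i) : ℝ)) ≤ 12 := by
  -- The tapes do not depend on the step function, which contains `π`; so the average over `π` can
  -- be taken for each tape separately.
  obtain ⟨Ω, _, _, tape, h⟩ := exists_tape (S := Lazy (binaryHeap α) p m)
    (D := Fin m × Fin m) l
  simp only [h]
  rw [Finset.expect_comm]
  refine (Finset.expect_le_expect fun ω _ => ?_).trans (Fintype.expect_const (12 : ℝ)).le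
  exact expect_costAt_tape_le key (tape ω) i n

theorem sq_le_two_mul_two_pow (n : ℕ) : n ^ 2 ≤ 2 * 2 ^ n := by
  rcases Nat.lt_or_ge n 4 with h | h
  · interval_cases n <;> norm_num
  · induction n, h using Nat.le_induction with
    | base => norm_num
    | succ n hn ih =>
      rw [pow_succ 2 n]
      nlinarith

/-- The total cost of insertions into a heap, split according to the number of insertions. -/
theorem totalCost_le_split (l : List α) {κ x : ℝ} (hκ : 0 ≤ κ) (hx : 0 ≤ x) :
    (totalCost l : ℝ) ≤ ∑ n ∈ Finset.range ⌊κ / Real.log 2 * x⌋₊, (costAt n l : ℝ) +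
      12 * Real.exp (-(κ * x)) * (4 ^ l.length - 1) := by
  have hlog : 0 < Real.log 2 := Real.log_pos (by norm_num)
  have h4 : (1 : ℝ) ≤ 4 ^ l.length := one_le_pow₀ (by norm_num)
  by_cases hl : l.length ≤ ⌊κ / Real.log 2 * x⌋₊
  · have h1 : (totalCost l : ℝ) ≤
        ∑ n ∈ Finset.range ⌊κ / Real.log 2 * x⌋₊, (costAt n l : ℝ) := by
      unfold totalCost
      rw [Nat.cast_sum]
      refine (Finset.sum_le_sum fun n hn => ?_).trans (Finset.sum_le_sum_of_subset_of_nonneg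
        (Finset.range_subset_range.2 hl) fun n _ _ => by positivity)
      rw [costAt, if_pos (Finset.mem_range.1 hn)]
    have h2 : 0 ≤ 12 * Real.exp (-(κ * x)) * ((4 : ℝ) ^ l.length - 1) :=
      mul_nonneg (by positivity) (by linarith)
    linarith
  · have h0 : 0 ≤ ∑ n ∈ Finset.range ⌊κ / Real.log 2 * x⌋₊, (costAt n l : ℝ) :=
      Finset.sum_nonneg fun n _ => by positivity
    have hl1 : 1 ≤ l.length := by omega
    have h1 : κ / Real.log 2 * x < l.length := by
      rw [not_le] at hl
      exact (Nat.floor_lt (by positivity)).1 hl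
    -- Beyond the cut, one factor `2 ^ l.length` pays for `Real.exp (κ * x)` and the other one for
    -- the quadratic cost.
    have h2 : Real.exp (κ * x) ≤ 2 ^ l.length := by
      have h3 : κ * x ≤ l.length * Real.log 2 := by
        rw [div_mul_eq_mul_div, div_lt_iff₀ hlog] at h1
        exact h1.le
      refine (Real.exp_le_exp.2 h3).trans (le_of_eq ?_)
      rw [Real.exp_nat_mul, Real.exp_log (by norm_num)]
    have h3 : (totalCost l : ℝ) ≤ 4 * l.length ^ 2 := by exact_mod_cast totalCost_le l
    have h5 : ((l.length : ℝ)) ^ 2 ≤ 2 * 2 ^ l.length := by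
      exact_mod_cast sq_le_two_mul_two_pow l.length
    have h6 : (4 : ℝ) ≤ 4 ^ l.length := by
      calc (4 : ℝ) = 4 ^ 1 := by norm_num
        _ ≤ 4 ^ l.length := pow_le_pow_right₀ (by norm_num) hl1
    have h7 : (4 : ℝ) ^ l.length = 2 ^ l.length * 2 ^ l.length := by
      rw [← mul_pow]
      norm_num
    have h8 : 4 * (l.length : ℝ) ^ 2 * Real.exp (κ * x) ≤ 12 * (4 ^ l.length - 1) := by
      calc 4 * (l.length : ℝ) ^ 2 * Real.exp (κ * x)
          ≤ 4 * (2 * 2 ^ l.length) * 2 ^ l.length := by gcongr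
        _ = 8 * 4 ^ l.length := by rw [h7]; ring
        _ ≤ 12 * (4 ^ l.length - 1) := by linarith
    have h9 : 4 * (l.length : ℝ) ^ 2 ≤ 12 * Real.exp (-(κ * x)) * (4 ^ l.length - 1) := by
      rw [Real.exp_neg, mul_right_comm, ← div_eq_mul_inv, le_div_iff₀ (Real.exp_pos _)]
      exact h8
    linarith

/-- The expected cost of the insertions into one local queue. -/
theorem expect_evol_totalCost_le [NeZero m] (hpm : p ≤ m) {κ : ℝ} (hκ : 0 ≤ κ)
    (hκ' : 6 ≤ κ * (1 - (p : ℝ) / m) ^ 2) (key : (Σ t, Fin (len t)) → α) (l : List (Fin p))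
    (i : Fin m) :
    𝔼 π : Equiv.Perm (Σ t, Fin (len t)),
      evol (fun t d L => Lazy.next (insertions (key ∘ π)) t d L) l (Lazy.init (binaryHeap α) p m)
        (fun L => (totalCost (L.elements (key ∘ π) i) : ℝ)) ≤
      12 * (κ / Real.log 2 + κ) * (Fintype.card (Σ t, Fin (len t)) / m) := by
  have hlog : 0 < Real.log 2 := Real.log_pos (by norm_num)
  have hm : (0 : ℝ) < m := by exact_mod_cast Nat.pos_of_neZero m
  set N := Fintype.card (Σ t, Fin (len t)) with hN
  set x : ℝ := N / m with hx
  have hx0 : 0 ≤ x := by positivity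
  set Y := ⌊κ / Real.log 2 * x⌋₊ with hY
  have h1 : ∀ π : Equiv.Perm (Σ t, Fin (len t)),
      evol (fun t d L => Lazy.next (insertions (key ∘ π)) t d L) l (Lazy.init (binaryHeap α) p m)
        (fun L => (totalCost (L.elements (key ∘ π) i) : ℝ)) ≤
      ∑ n ∈ Finset.range Y, evol (fun t d L => Lazy.next (insertions (key ∘ π)) t d L) l
        (Lazy.init (binaryHeap α) p m) (fun L => (costAt n (L.elements (key ∘ π) i) : ℝ)) +
      12 * κ * x := by
    intro π
    have h2 := evol_le_of_invariant (fun t d L => Lazy.next (insertions (key ∘ π)) t d L)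
      (I := fun _ => True) (fun _ _ _ _ => trivial)
      (f := fun L => (totalCost (L.elements (key ∘ π) i) : ℝ))
      (fun L _ => totalCost_le_split (L.elements (key ∘ π) i) hκ hx0) l
      (s := Lazy.init (binaryHeap α) p m) trivial
    refine h2.trans ?_
    rw [evol_add, evol_sum, evol_const_mul]
    refine add_le_add le_rfl ?_
    simp only [sub_eq_add_neg]
    rw [evol_add, evol_const]
    -- The base `1 + κ / m` turns the moment bound into `(1 + κ / m) ^ N ≤ Real.exp (κ * x)`.
    have hb' : 6 / (m : ℝ) ≤ ((1 + κ / m) - 1) * (1 - (p : ℝ) / m) ^ 2 := by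
      rw [add_sub_cancel_left, div_mul_eq_mul_div]
      gcongr
    have h3 := Lazy.evol_pow_length_le hpm (b := 1 + κ / m)
      (by have : 0 ≤ κ / m := by positivity
          linarith) hb' (key ∘ π) l i
    have h4 : (1 + κ / m) ^ N ≤ Real.exp (κ * x) := by
      calc (1 + κ / m) ^ N ≤ Real.exp (κ / m) ^ N := by
            gcongr
            rw [add_comm]
            exact Real.add_one_le_exp _
        _ = Real.exp (κ * x) := by
            rw [← Real.exp_nat_mul, hx]
            congr 1
            ring
    -- Subtracting `1` from `4 ^ l.length` in the split pays off here: `1 - Real.exp (-(κ * x)) ≤ κ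
    -- * x`. The tail is thus proportional to `N / m`, so that the sum over all queues is `O(N)`
    -- even if `N` is much smaller than `m`.
    have h5 : 12 * Real.exp (-(κ * x)) * (Real.exp (κ * x) + -1) ≤ 12 * κ * x := by
      have h6 : Real.exp (-(κ * x)) * Real.exp (κ * x) = 1 := by
        rw [← Real.exp_add]
        simp
      have h7 := Real.add_one_le_exp (-(κ * x))
      nlinarith
    refine le_trans ?_ h5
    gcongr
    exact h3.trans h4
  refine (Finset.expect_le_expect fun π _ => h1 π).trans ?_
  rw [Finset.expect_add_distrib, Fintype.expect_const, Finset.expect_sum_comm]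
  have h2 : ∑ n ∈ Finset.range Y, 𝔼 π : Equiv.Perm (Σ t, Fin (len t)),
      evol (fun t d L => Lazy.next (insertions (key ∘ π)) t d L) l
        (Lazy.init (binaryHeap α) p m) (fun L => (costAt n (L.elements (key ∘ π) i) : ℝ)) ≤
      12 * (κ / Real.log 2 * x) := by
    refine (Finset.sum_le_sum fun n _ => expect_evol_costAt_le key l i n).trans ?_
    rw [Finset.sum_const, Finset.card_range, nsmul_eq_mul, mul_comm]
    gcongr
    exact Nat.floor_le (by positivity)
  linarith

/-- A bound for the expected number of steps of a random insertion after the acquisition of its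
lock. -/
noncomputable def insertionBound (c : ℝ) : ℝ :=
  12 * (2 * attemptBound c / Real.log 2 + 2 * attemptBound c)

theorem binaryHeap_random_insertions {c : ℝ} (hc : 1 < c) [NeZero m] (hm : (m : ℝ) = c * p)
    (key : (Σ t, Fin (len t)) → α) (sched : List (Fin p)) :
    expect (runRandomInsertions (m := m) (binaryHeap α) len key sched)
        (fun s => ∑ t, ∑ k : Fin (len t), (s.time t k : ℝ≥0∞)) ≤
      ((3 * attemptBound c + 3 * insertionBound c).toNNReal : ℝ≥0∞) *
        ∑ t, (len t : ℝ≥0∞) := by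
  have hB := four_le_attemptBound hc
  have hB' := four_le_attemptBound_mul hc hm
  have hpm := le_of_eq_mul hc hm
  have hlog : 0 < Real.log 2 := Real.log_pos (by norm_num)
  have hI : 0 ≤ insertionBound c := by
    have : 0 ≤ 2 * attemptBound c := by linarith
    unfold insertionBound
    positivity
  have hm0 : (0 : ℝ) < m := by exact_mod_cast Nat.pos_of_neZero m
  set N := Fintype.card (Σ t, Fin (len t)) with hN
  have hNsum : N = ∑ t, len t := by simp [hN, Fintype.card_sigma]
  have hcast : ∀ s : Config (binaryHeap α) p m, ∑ t, ∑ k : Fin (len t), (s.time t k : ℝ≥0∞) =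
      ((∑ t, ∑ k : Fin (len t), s.time t k : ℕ) : ℝ≥0∞) := fun s => by push_cast; rfl
  have hN' : ∑ t, (len t : ℝ≥0∞) = ENNReal.ofReal N := by
    rw [ENNReal.ofReal_natCast, hNsum]
    push_cast
    rfl
  simp only [hcast, hN']
  unfold runRandomInsertions
  rw [expect_bind]
  simp only [expect_natCast_run _ _ _ fun s : Config (binaryHeap α) p m =>
    ∑ t, ∑ k : Fin (len t), s.time t k]
  rw [expect_uniform _ fun π => evol_nonneg _ (fun s => Nat.cast_nonneg _) _ _,
    ← ENNReal.ofReal.eq_1, ← ENNReal.ofReal_mul (by linarith)]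
  apply ENNReal.ofReal_le_ofReal
  have h1 : ∀ π : Equiv.Perm (Σ t, Fin (len t)),
      evol (fun t (d : Fin m × Fin m) s => Config.next
        (fun t => List.ofFn fun k => Op.insert (key (π ⟨t, k⟩))) t d s) sched
        (Config.init (binaryHeap α) p m)
        (fun s => ((∑ t, ∑ k : Fin (len t), s.time t k : ℕ) : ℝ)) ≤
      3 * attemptBound c * N + 3 * ∑ i, evol (fun t d L =>
        Lazy.next (insertions (key ∘ π)) t d L) sched (Lazy.init (binaryHeap α) p m)
        (fun L => (totalCost (L.elements (key ∘ π) i) : ℝ)) := by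
    intro π
    change evol (fun t (d : Fin m × Fin m) s => Config.next (insertions (key ∘ π)) t d s) sched
        (Config.init (binaryHeap α) p m)
        (fun s => ((∑ t, ∑ k : Fin (len t), s.time t k : ℕ) : ℝ)) ≤ _
    simp only [Nat.cast_sum, evol_sum]
    have h2 : ∀ t : Fin p, ∀ k : Fin (len t), _ := fun t k =>
      evol_time_le_dur (Q := binaryHeap α) (m := m) hpm hB hB' (insertions (key ∘ π)) sched t k
    refine (Finset.sum_le_sum fun t _ => Finset.sum_le_sum fun k _ => h2 t k).trans ?_
    simp only [Finset.sum_add_distrib, ← Finset.mul_sum, Finset.sum_const, Finset.card_univ,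
      Fintype.card_fin, nsmul_eq_mul, ← Finset.sum_mul]
    have h3 : ∑ t, (len t : ℝ) = N := by
      rw [hNsum]
      push_cast
      rfl
    rw [h3, mul_comm (N : ℝ)]
    refine add_le_add (mul_assoc _ _ _).ge ?_
    simp only [← evol_sum]
    refine mul_le_mul_of_nonneg_left ?_ (by norm_num)
    refine evol_le_of_invariant _ (I := Lazy.HeapInv (key ∘ π)) (fun u d L h => h.next u d)
      (fun L hL => ?_) sched (Lazy.HeapInv.init _)
    exact_mod_cast hL.dur
  refine (Finset.expect_le_expect fun π _ => h1 π).trans ?_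
  rw [Finset.expect_add_distrib, Fintype.expect_const, ← Finset.mul_expect,
    Finset.expect_sum_comm]
  -- The choice `κ = 2 * attemptBound c` gives `κ * (1 - p / m) ^ 2 ≥ 8`, more than the required
  -- `6`.
  have h2 : ∀ i : Fin m, _ := fun i =>
    expect_evol_totalCost_le hpm (κ := 2 * attemptBound c) (by linarith) (by linarith) key sched i
  have h3 := Finset.sum_le_sum fun i (_ : i ∈ Finset.univ) => h2 i
  rw [Finset.sum_const, Finset.card_univ, Fintype.card_fin, nsmul_eq_mul, ← insertionBound] at h3
  have h4 : (m : ℝ) * (insertionBound c * (N / m)) = insertionBound c * N := by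
    field_simp
  rw [h4] at h3
  linarith

end Cost

end MultiQueue

/-! ### The three claims together -/

theorem mainTheorem2 (c : ℝ) (hc : 1 < c) :
    -- binary heaps: constant average insertion time
    (∃ C : ℝ≥0, ∀ (α : Type*) [LinearOrder α] (p m : ℕ) [NeZero m], (m : ℝ) = c * p →
      ∀ (len : Fin p → ℕ) (key : (Σ t, Fin (len t)) → α) (sched : List (Fin p)),
        MultiQueue.expect
            (MultiQueue.runRandomInsertions (m := m) (MultiQueue.binaryHeap α) len key sched)
            (fun s => ∑ t, ∑ k : Fin (len t), (s.time t k : ℝ≥0∞))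
          ≤ C * ∑ t, (len t : ℝ≥0∞)) ∧
    -- binary heaps: expected time `O(log n)` per operation on worst-case operation sequences
    (∃ C : ℝ≥0, ∀ (α : Type*) [LinearOrder α] (p m : ℕ) [NeZero m], (m : ℝ) = c * p →
      ∀ (prog : Fin p → List (MultiQueue.Op α)) (sched : List (Fin p)) (t : Fin p) (k : ℕ),
        MultiQueue.expect (MultiQueue.run (m := m) (MultiQueue.binaryHeap α) prog sched)
            (fun s => (s.time t k : ℝ≥0∞))
          ≤ C * MultiQueue.expect
              (MultiQueue.run (m := m) (MultiQueue.binaryHeap α) prog sched)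
              (fun s => ENNReal.ofReal (Real.logb 2 (s.sizeAtLock t k + 2)))) ∧
    -- van Emde Boas trees: expected time `O(log log U)` per operation
    (∃ C : ℝ≥0, ∀ (U p m : ℕ) [NeZero m], (m : ℝ) = c * p →
      ∀ (prog : Fin p → List (MultiQueue.Op ℕ)),
        (∀ (t : Fin p) (a : ℕ), MultiQueue.Op.insert a ∈ prog t → a ≤ U) →
      ∀ (sched : List (Fin p)) (t : Fin p) (k : ℕ),
        MultiQueue.expect (MultiQueue.run (m := m) (MultiQueue.vanEmdeBoas U) prog sched)
            (fun s => (s.time t k : ℝ≥0∞))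
          ≤ C * ENNReal.ofReal (Real.logb 2 (Real.logb 2 ((U : ℝ) + 4)))) := by
  refine ⟨⟨_, fun α _ p m _ hm len key sched =>
      MultiQueue.binaryHeap_random_insertions hc hm key sched⟩,
    ⟨_, fun α _ p m _ hm prog sched t k =>
      MultiQueue.binaryHeap_worst_case hc hm prog sched t k⟩,
    ⟨_, fun U p m _ hm prog _ sched t k =>
      MultiQueue.vanEmdeBoas_worst_case hc U hm prog sched t k⟩⟩
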